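/- Let $R$ be an integral domain of characteristic zero with fraction field $Q(R)$, and let $G=(G^{(1)},\dots,G^{(m)})$ be an $m$-dimensional formal group law over $R$: $G^{(j)}\in R[[\mathbf X,\mathbf Y]]$ with $G^{(j)}= X_j+Y_j+\sum_{l,k}\gamma^j_{lk}X_lY_k+O(\deg\ge 3)$ and $G(G(\mathbf X,\mathbf Y),\mathbf Z)=G(\mathbf X,G(\mathbf Y,\mathbf Z))$. Let $\mathfrak g$ be its Lie algebra, i.e. the free $R$-module on $e_1,\dots,e_m$ with $[e_l,e_k]=\sum_j(\gamma^j_{lk}-\gamma^j_{kl})e_j$. *Modified formal group cohomology.* For $n\ge 0$ let $\tilde K^n(G,R)$ be the $R$-module of power series $\sum_{e} b_e t^e\in Q(R)[[t_i^{(j)}: 1\le i\le n,\ 1\le j\le m]]$ with $e!\,b_e\in R$ for all multi-indices $e$; this is the $n$-fold completed tensor power of the modified ring of functions $\tilde{\mathcal O}(G)=\tilde K^1(G,R)$. Put $\underline t_i=(t_i^{(1)},\dots,t_i^{(m)})$ and $$\partial f(\underline t_1,\dots,\underline t_{n+1})=f(\underline t_2,\dots,\underline t_{n+1})+\sum_{i=1}^n(-1)^i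 f(\underline t_1,\dots,G(\underline t_i,\underline t_{i+1}),\dots,\underline t_{n+1})+(-1)^{n+1}f(\underline t_1,\dots,\underline t_n).$$ Then $(\tilde K^\bullet(G,R),\partial)$ is a cochain complex of $R$-modules; its cohomology is $H^n(\tilde G,R)$. *Lie algebra cohomology.* Let $C^n(\mathfrak g,R)=\mathrm{Hom}_R(\bigwedge^n\mathfrak g,R)$ with $$\partial'\omega(x_1\wedge\dots\wedge x_{n+1})=\sum_{r<s}(-1)^{r+s}\omega([x_r,x_s]\wedge x_1\wedge\dots\widehat{x_r}\dots\widehat{x_s}\dots\wedge x_{n+1}).$$ Then $(C^\bullet(\mathfrak g,R),\partial')$ is a cochain complex; its cohomology is $H^n(\mathfrak g,R)$. *Comparison map.* Let $\alpha$ be the homomorphism from the universal enveloping algebra $\mathcal U(\mathfrak g)$ to the algebra of continuous $R$-linear functionals on $\tilde{\mathcal O}(G)$, with product $(\varphi\psi)(f)=(\varphi\hat\otimes\psi)(f(G(\underline t_1,\underline t_2)))$, which extends $e_j\mapsto\bigl[f\mapsto\frac{\partial f}{\partial t^{(j)}}(0)\bigr]$ on $\mathfrak g$. Define $\tilde\phi^n:\tilde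 K^n(G,R)\to C^n(\mathfrak g,R)$ by $$\tilde\phi^n(f)(x_1\wedge\dots\wedge x_n)=\sum_{\sigma\in S_n}\mathrm{sgn}(\sigma)\,\bigl(\alpha(x_{\sigma(1)})\hat\otimes\cdots\hat\otimes\alpha(x_{\sigma(n)})\bigr)(f).$$ Then $\tilde\phi$ is a morphism of cochain complexes, and for every $n\ge 0$ the map $[f]\mapsto[\tilde\phi^n(f)]$ is a well-defined isomorphism of $R$-modules $$\tilde\Phi: H^n(\tilde G,R)\xrightarrow{\ \sim\ }H^n(\mathfrak g,R).$$ -/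

import Mathlib

set_option linter.unusedSectionVars false

section

open MvPowerSeries

namespace FGL

section Calculus

theorem pderiv_comm {R σ : Type*} [CommRing R] (i j : σ) (f : MvPowerSeries σ R) :
    pderiv R i (pderiv R j f) = pderiv R j (pderiv R i f) := by
  ext d
  simp only [coeff_pderiv]
  rw [add_right_comm]
  by_cases h : i = j
  · subst h; rfl
  · simp [h, Ne.symm h]
    ring

theorem map_pderiv {R S σ : Type*} [CommRing R] [CommRing S] (h : R →+* S) (i : σ)
    (f : MvPowerSeries σ R) : (pderiv R i f).map h = pderiv S i (f.map h) := by
  ext d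
  simp [coeff_pderiv]

open scoped MvPowerSeries.WithPiTopology in
theorem continuous_pderiv {Q κ : Type*} [CommRing Q] [TopologicalSpace Q] [DiscreteTopology Q]
    (s : κ) : Continuous (fun f : MvPowerSeries κ Q => pderiv Q s f) := by
  refine continuous_pi fun d => ?_
  have : (fun f : MvPowerSeries κ Q => pderiv Q s f d) =
      fun f : MvPowerSeries κ Q => coeff (d + Finsupp.single s 1) f * ((d s : Q) + 1) := by
    funext f; exact coeff_pderiv f d
  rw [this]
  exact (continuous_of_discreteTopology (f := fun x : Q => x * ((d s : Q) + 1))).comp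
    (WithPiTopology.continuous_coeff Q _)

open scoped MvPowerSeries.WithPiTopology in
theorem chain_rule {R S σ τ : Type*} [CommRing R] [CommRing S] [Algebra R S] [Fintype σ]
    {a : σ → MvPowerSeries τ S} (ha : HasSubst a) (t : τ) (f : MvPowerSeries σ R) :
    pderiv S t (f.subst a) = ∑ s, (pderiv R s f).subst a * pderiv S t (a s) := by
  let _ : UniformSpace R := ⊥
  let _ : UniformSpace S := ⊥
  have _ : DiscreteUniformity R := ⟨rfl⟩
  have _ : DiscreteUniformity S := ⟨rfl⟩
  have hs := continuous_subst (R := R) ha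
  have h1 : Continuous (fun f : MvPowerSeries σ R => pderiv S t (f.subst a)) :=
    (continuous_pderiv t).comp hs
  have h2 : Continuous (fun f : MvPowerSeries σ R =>
      ∑ s, (pderiv R s f).subst a * pderiv S t (a s)) :=
    continuous_finsetSum _ fun s _ => (hs.comp (continuous_pderiv s)).mul continuous_const
  refine congrFun (WithPiTopology.denseRange_toMvPowerSeries.equalizer h1 h2 ?_) f
  funext p
  change pderiv S t (subst a (p : MvPowerSeries σ R)) =
    ∑ s, (pderiv R s (p : MvPowerSeries σ R)).subst a * pderiv S t (a s)
  simp only [pderiv_coe, subst_coe]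
  classical
  induction p using MvPolynomial.induction_on with
  | C r =>
    have : (MvPolynomial.aeval a (MvPolynomial.C r) : MvPowerSeries τ S) = C (algebraMap R S r) := by
      simp [MvPowerSeries.algebraMap_apply]
    simp [this]
  | add p q hp hq => simp [map_add, hp, hq, add_mul, Finset.sum_add_distrib]
  | mul_X p s hp =>
    simp only [map_mul, MvPolynomial.aeval_X, Derivation.leibniz, smul_eq_mul, hp, map_add,
      MvPolynomial.pderiv_X, add_mul, Finset.sum_add_distrib, Finset.mul_sum]
    congr 1
    · rw [Finset.sum_eq_single s]
      · simp
      · intro b _ hb; simp [Ne.symm hb]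
      · simp
    · exact Finset.sum_congr rfl fun _ _ => by ring

theorem hasSubst_elim {R S τ : Type*} [CommRing R] [CommRing S] {m : ℕ}
    {a b : Fin m → MvPowerSeries τ S} (ha : ∀ k, constantCoeff (a k) = 0)
    (hb : ∀ k, constantCoeff (b k) = 0) : HasSubst (Sum.elim a b) :=
  hasSubst_of_constantCoeff_zero (by rintro (k | k) <;> simp [ha, hb])

theorem constantCoeff_subst' {R S σ τ : Type*} [CommRing R] [CommRing S] [Algebra R S] [Finite σ]
    {a : σ → MvPowerSeries τ S} (ha : ∀ s, constantCoeff (a s) = 0) (f : MvPowerSeries σ R) :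
    constantCoeff (f.subst a) = algebraMap R S (constantCoeff f) := by
  have hs := hasSubst_of_constantCoeff_zero ha
  have h : f = (f - C (constantCoeff f)) + C (constantCoeff f) := by ring
  rw [h, subst_add hs, map_add, constantCoeff_subst_eq_zero hs ha (by simp)]
  have : (C (constantCoeff f)).subst a = algebraMap R (MvPowerSeries τ S) (constantCoeff f) := by
    rw [← substAlgHom_apply hs]
    exact (substAlgHom hs).commutes _
  rw [this]
  simp [MvPowerSeries.algebraMap_apply]

/-- Substitution of a family congruent to the identity modulo degree two is injective. -/
theorem eq_zero_of_subst_eq_zero {R σ : Type*} [CommRing R] [IsDomain R] [CharZero R] [Fintype σ]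
    [DecidableEq σ] {h : σ → MvPowerSeries σ R} (h0 : ∀ s, constantCoeff (h s) = 0)
    (h1 : ∀ s t, constantCoeff (pderiv R t (h s)) = if s = t then 1 else 0)
    {f : MvPowerSeries σ R} (hf : f.subst h = 0) : f = 0 := by
  have hs := hasSubst_of_constantCoeff_zero h0
  let J : Matrix σ σ (MvPowerSeries σ R) := Matrix.of fun t s => pderiv R t (h s)
  have hJ : J.det ≠ 0 := by
    intro hd
    have : constantCoeff J.det = 1 := by
      rw [RingHom.map_det]
      have : (constantCoeff (σ := σ) (R := R)).mapMatrix J = 1 := by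
        ext t s
        simp only [RingHom.mapMatrix_apply, Matrix.map_apply, J, Matrix.of_apply, h1,
          Matrix.one_apply, eq_comm]
      rw [this, Matrix.det_one]
    rw [hd] at this
    simp at this
  have key : ∀ (n : ℕ) (f : MvPowerSeries σ R), f.subst h = 0 →
      ∀ e : σ →₀ ℕ, e.degree = n → coeff e f = 0 := by
    intro n
    induction n with
    | zero =>
      intro f hf e he
      rw [Finsupp.degree_eq_zero_iff] at he
      subst he
      have := constantCoeff_subst' h0 f
      rw [hf] at this
      simpa using this.symm
    | succ n ih =>
      intro f hf e he
      have hv : (fun s => (pderiv R s f).subst h) = 0 := by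
        refine Matrix.eq_zero_of_mulVec_eq_zero hJ ?_
        funext t
        have := chain_rule hs t f
        rw [hf, map_zero] at this
        simp only [Matrix.mulVec, dotProduct, J, Matrix.of_apply, Pi.zero_apply]
        rw [this]
        exact Finset.sum_congr rfl fun _ _ => mul_comm _ _
      obtain ⟨i, hi⟩ : ∃ i, e i ≠ 0 := by
        by_contra! hc
        have : e = 0 := Finsupp.ext hc
        simp [this] at he
      have hle : Finsupp.single i 1 ≤ e := by
        rw [Finsupp.single_le_iff]; omega
      obtain ⟨e', rfl⟩ : ∃ e', e = e' + Finsupp.single i 1 := ⟨_, (tsub_add_cancel_of_le hle).symm⟩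
      have hd : e'.degree = n := by
        rw [map_add, Finsupp.degree_single] at he; omega
      have := ih (pderiv R i f) (congrFun hv i) e' hd
      rw [coeff_pderiv] at this
      refine (mul_eq_zero.mp this).resolve_right ?_
      exact_mod_cast Nat.succ_ne_zero (e' i)
  ext e
  exact key _ f hf e rfl

end Calculus

end FGL

/-- An `m`-dimensional formal group law over `R`: an `m`-tuple of power series
`G^(j)(X, Y)`, the variable `X_k` being indexed by `Sum.inl k` and `Y_k` by `Sum.inr k`. -/
structure FormalGroupLaw (R : Type*) [CommRing R] (m : ℕ) where
  /-- The power series `G^(j)(X, Y)`. -/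
  series : Fin m → MvPowerSeries (Fin m ⊕ Fin m) R
  /-- `G^(j) = X_j + Y_j + ∑ γ^j_{lk} X_l Y_k` modulo degree three. -/
  low_degree : ∃ γ : Fin m → Fin m → Fin m → R, ∀ j, ∀ d : Fin m ⊕ Fin m →₀ ℕ, d.degree < 3 →
    coeff d (series j) = coeff d (X (Sum.inl j) + X (Sum.inr j) +
      ∑ l, ∑ k, C (γ j l k) * (X (Sum.inl l) * X (Sum.inr k)))
  /-- `G(G(X, Y), Z) = G(X, G(Y, Z))`, with `X_k = X (0, k)`, `Y_k = X (1, k)`,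
  `Z_k = X (2, k)`. -/
  assoc : ∀ j,
    (series j).subst (Sum.elim
        (fun k => (series k).subst (Sum.elim (fun l => X ((0 : Fin 3), l)) (fun l => X (1, l))
          : Fin m ⊕ Fin m → MvPowerSeries (Fin 3 × Fin m) R))
        (fun k => X (2, k)) : Fin m ⊕ Fin m → MvPowerSeries (Fin 3 × Fin m) R) =
    (series j).subst (Sum.elim
        (fun k => X (0, k))
        (fun k => (series k).subst (Sum.elim (fun l => X ((1 : Fin 3), l)) (fun l => X (2, l))
          : Fin m ⊕ Fin m → MvPowerSeries (Fin 3 × Fin m) R))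
        : Fin m ⊕ Fin m → MvPowerSeries (Fin 3 × Fin m) R)

namespace FormalGroupLaw

open FGL

section Basic

variable {R : Type*} [CommRing R] {m : ℕ} (G : FormalGroupLaw R m)

/-- The coefficient `γ^j_{lk}` of `X_l Y_k` in `G^(j)(X, Y)`. -/
noncomputable def gam (j l k : Fin m) : R :=
  coeff (Finsupp.single (Sum.inl l) 1 + Finsupp.single (Sum.inr k) 1) (G.series j)

theorem constantCoeff_series (j : Fin m) : constantCoeff (G.series j) = 0 := by
  obtain ⟨γ, h⟩ := G.low_degree
  have := h j 0 (by simp)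
  simpa using this

theorem coeff_single_series (j : Fin m) (s : Fin m ⊕ Fin m) :
    coeff (Finsupp.single s 1) (G.series j) = if s = Sum.inl j ∨ s = Sum.inr j then 1 else 0 := by
  classical
  obtain ⟨γ, h⟩ := G.low_degree
  rw [h j _ (by simp [Finsupp.degree_single])]
  have hz : ∀ l k : Fin m, coeff (Finsupp.single s 1)
      (C (γ j l k) * (X (Sum.inl l) * X (Sum.inr k)) : MvPowerSeries (Fin m ⊕ Fin m) R) = 0 := by
    intro l k
    rw [coeff_C_mul, X, X, monomial_mul_monomial, coeff_monomial, if_neg, mul_zero]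
    intro hh
    have := congrArg Finsupp.degree hh
    simp [Finsupp.degree_single] at this
  simp only [map_add, map_sum, hz, Finset.sum_const_zero, add_zero, coeff_X,
    Finsupp.single_left_inj (one_ne_zero : (1 : ℕ) ≠ 0)]
  rcases s with s | s <;> simp

variable {τ : Type*}

/-- `G^(j)(a, b)`. -/
noncomputable def comp (a b : Fin m → MvPowerSeries τ R) (j : Fin m) : MvPowerSeries τ R :=
  (G.series j).subst (Sum.elim a b)

variable {G}

theorem constantCoeff_comp {a b : Fin m → MvPowerSeries τ R} (ha : ∀ k, constantCoeff (a k) = 0)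
    (hb : ∀ k, constantCoeff (b k) = 0) (j : Fin m) : constantCoeff (G.comp a b j) = 0 := by
  rw [comp, constantCoeff_subst' (by rintro (k | k) <;> simp [ha, hb]), G.constantCoeff_series]
  simp

theorem subst_comp {υ : Type*} [Finite τ] {a b : Fin m → MvPowerSeries τ R}
    (ha : ∀ k, constantCoeff (a k) = 0) (hb : ∀ k, constantCoeff (b k) = 0)
    {c : τ → MvPowerSeries υ R} (hc : ∀ t, constantCoeff (c t) = 0)
    (f : MvPowerSeries (Fin m ⊕ Fin m) R) :
    (f.subst (Sum.elim a b)).subst c =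
      f.subst (Sum.elim (fun k => (a k).subst c) (fun k => (b k).subst c)) := by
  rw [subst_comp_subst_apply (hasSubst_elim (R := R) ha hb) (hasSubst_of_constantCoeff_zero hc)]
  congr 1
  funext s
  rcases s with s | s <;> rfl

theorem assoc_comp [Finite τ] {a b c : Fin m → MvPowerSeries τ R}
    (ha : ∀ k, constantCoeff (a k) = 0) (hb : ∀ k, constantCoeff (b k) = 0)
    (hc : ∀ k, constantCoeff (c k) = 0) (j : Fin m) :
    G.comp (G.comp a b) c j = G.comp a (G.comp b c) j := by
  have hx : ∀ i : Fin 3, ∀ k : Fin m,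
    constantCoeff (X (i, k) : MvPowerSeries (Fin 3 × Fin m) R) = 0 := by simp
  let e : Fin 3 × Fin m → MvPowerSeries τ R := fun p => ![a, b, c] p.1 p.2
  have he : ∀ p, constantCoeff (e p) = 0 := by
    rintro ⟨i, k⟩
    fin_cases i <;> simp [e, ha, hb, hc]
  have hes := hasSubst_of_constantCoeff_zero he
  have := congrArg (subst e) (G.assoc j)
  have h1 := constantCoeff_comp (G := G) (hx 0) (hx 1)
  have h2 := constantCoeff_comp (G := G) (hx 1) (hx 2)
  simp only [comp] at h1 h2
  rw [subst_comp h1 (hx 2) he, subst_comp (hx 0) h2 he] at this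
  simp only [subst_comp (hx _) (hx _) he, subst_X hes] at this
  exact this

theorem chain_rule_comp {a b : Fin m → MvPowerSeries τ R} (ha : ∀ k, constantCoeff (a k) = 0)
    (hb : ∀ k, constantCoeff (b k) = 0) (t : τ) (f : MvPowerSeries (Fin m ⊕ Fin m) R) :
    pderiv R t (f.subst (Sum.elim a b)) =
      ∑ q, (pderiv R (Sum.inl q) f).subst (Sum.elim a b) * pderiv R t (a q) +
      ∑ q, (pderiv R (Sum.inr q) f).subst (Sum.elim a b) * pderiv R t (b q) := by
  rw [chain_rule (hasSubst_elim (R := R) ha hb)]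
  simp

theorem constantCoeff_pderiv_series (s : Fin m ⊕ Fin m) (j : Fin m) :
    constantCoeff (pderiv R s (G.series j)) = if s = Sum.inl j ∨ s = Sum.inr j then 1 else 0 := by
  rw [← coeff_zero_eq_constantCoeff_apply, coeff_pderiv, zero_add, coeff_single_series]
  simp

theorem constantCoeff_pderiv_pderiv_series (l k j : Fin m) :
    constantCoeff (pderiv R (Sum.inl l) (pderiv R (Sum.inr k) (G.series j))) = G.gam j l k := by
  rw [← coeff_zero_eq_constantCoeff_apply, coeff_pderiv, zero_add, coeff_pderiv, gam]
  simp

variable (G) in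
/-- The coefficients of the left-invariant vector fields: the power series
`∂G^(j)(t, s)/∂s_l` at `s = 0`, where `t` is the tuple of variables. -/
noncomputable def vf (t : Fin m → MvPowerSeries τ R) (l j : Fin m) : MvPowerSeries τ R :=
  (pderiv R (Sum.inr l) (G.series j)).subst (Sum.elim t 0)

theorem constantCoeff_vf {t : Fin m → MvPowerSeries τ R} (ht : ∀ k, constantCoeff (t k) = 0)
    (l j : Fin m) : constantCoeff (G.vf t l j) = if l = j then 1 else 0 := by
  rw [vf, constantCoeff_subst' (by rintro (k | k) <;> simp [ht]), constantCoeff_pderiv_series]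
  simp

end Basic

section Domain

variable {R : Type*} [CommRing R] [IsDomain R] [CharZero R] {m : ℕ} {G : FormalGroupLaw R m}

/-- `G(X, 0) = X`. -/
theorem comp_X_zero (j : Fin m) :
    G.comp (fun k => (X k : MvPowerSeries (Fin m) R)) 0 j = X j := by
  have hx : ∀ k, constantCoeff (X k : MvPowerSeries (Fin m) R) = 0 := by simp
  have hz : ∀ k, constantCoeff ((0 : Fin m → MvPowerSeries (Fin m) R) k) = 0 := by simp
  set h : Fin m → MvPowerSeries (Fin m) R := G.comp (fun k => X k) 0 with hh
  have h0 : ∀ k, constantCoeff (h k) = 0 := constantCoeff_comp hx hz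
  have hhs := hasSubst_of_constantCoeff_zero h0
  have h1 : ∀ s t, constantCoeff (pderiv R t (h s)) = if s = t then 1 else 0 := by
    intro s t
    rw [hh, comp, chain_rule_comp hx hz]
    have he : ∀ r : Fin m ⊕ Fin m, constantCoeff (Sum.elim (fun k => X k) (0 : Fin m → _) r
      : MvPowerSeries (Fin m) R) = 0 := by rintro (r | r) <;> simp
    simp only [map_sum, map_mul, constantCoeff_subst' he, constantCoeff_pderiv_series,
      pderiv_X, Pi.zero_apply, map_zero, mul_zero, Finset.sum_const_zero, add_zero,
      Pi.single_apply]
    simp [apply_ite, eq_comm]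
  refine sub_eq_zero.mp (eq_zero_of_subst_eq_zero h0 h1 ?_)
  rw [subst_sub hhs, subst_X hhs, sub_eq_zero]
  conv_lhs => rw [hh, comp, subst_comp hx hz h0]
  simp only [subst_X hhs]
  have e0 : (fun k => ((0 : Fin m → MvPowerSeries (Fin m) R) k).subst h) = 0 := by
    funext k
    exact (substAlgHom_apply (R := R) hhs 0).symm.trans (map_zero _)
  rw [e0]
  have := assoc_comp (G := G) hx hz hz j
  have z0 : G.comp (0 : Fin m → MvPowerSeries (Fin m) R) 0 = 0 := by
    funext k
    have : (Sum.elim 0 0 : Fin m ⊕ Fin m → MvPowerSeries (Fin m) R) = 0 := by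
      funext s; rcases s with s | s <;> rfl
    rw [comp, this, subst_zero_of_constantCoeff_zero (G.constantCoeff_series k)]; rfl
  rw [z0] at this
  exact this

variable {τ : Type*}

theorem comp_zero_right {t : Fin m → MvPowerSeries τ R} (ht : ∀ k, constantCoeff (t k) = 0)
    (j : Fin m) : G.comp t 0 j = t j := by
  have hx : ∀ k, constantCoeff (X k : MvPowerSeries (Fin m) R) = 0 := by simp
  have hz : ∀ k, constantCoeff ((0 : Fin m → MvPowerSeries (Fin m) R) k) = 0 := by simp
  have hs := hasSubst_of_constantCoeff_zero ht
  have := congrArg (subst t) (comp_X_zero (G := G) j)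
  rw [comp, subst_comp hx hz ht] at this
  simp only [subst_X hs] at this
  have e0 : (fun k => ((0 : Fin m → MvPowerSeries (Fin m) R) k).subst t) = 0 := by
    funext k
    exact (substAlgHom_apply (R := R) hs 0).symm.trans (map_zero _)
  rw [e0] at this
  exact this

/-- The structure equation of the left-invariant vector fields. -/
theorem vf_structure [Finite τ] {t : Fin m → MvPowerSeries τ R}
    (ht : ∀ k, constantCoeff (t k) = 0) (l k p : Fin m) :
    ∑ j, G.vf t l j * (pderiv R (Sum.inl j) (pderiv R (Sum.inr k) (G.series p))).subst
        (Sum.elim t 0) =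
      (pderiv R (Sum.inr l) (pderiv R (Sum.inr k) (G.series p))).subst (Sum.elim t 0) +
        ∑ q, G.vf t q p * algebraMap R _ (G.gam q l k) := by
  have hx : ∀ i : Fin 3, ∀ k : Fin m,
    constantCoeff (X (i, k) : MvPowerSeries (Fin 3 × Fin m) R) = 0 := by simp
  have hz : ∀ k, constantCoeff ((0 : Fin m → MvPowerSeries τ R) k) = 0 := by simp
  set x : Fin m → MvPowerSeries (Fin 3 × Fin m) R := fun k => X (0, k) with hxd
  set y : Fin m → MvPowerSeries (Fin 3 × Fin m) R := fun k => X (1, k) with hyd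
  set z : Fin m → MvPowerSeries (Fin 3 × Fin m) R := fun k => X (2, k) with hzd
  have dx : ∀ i q, pderiv R ((1 : Fin 3), i) (x q) = 0 := fun i q =>
    pderiv_X_of_ne (by simp)
  have dx' : ∀ i q, pderiv R ((2 : Fin 3), i) (x q) = 0 := fun i q =>
    pderiv_X_of_ne (by simp)
  have dy' : ∀ i q, pderiv R ((2 : Fin 3), i) (y q) = 0 := fun i q =>
    pderiv_X_of_ne (by simp)
  have dz : ∀ i q, pderiv R ((1 : Fin 3), i) (z q) = 0 := fun i q =>
    pderiv_X_of_ne (by simp)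
  have dy : ∀ i q, pderiv R ((1 : Fin 3), i) (y q) = if i = q then 1 else 0 := fun i q => by
    rw [hyd, pderiv_X]; simp [Pi.single_apply, eq_comm]
  have dz' : ∀ i q, pderiv R ((2 : Fin 3), i) (z q) = if i = q then 1 else 0 := fun i q => by
    rw [hzd, pderiv_X]; simp [Pi.single_apply, eq_comm]
  have hu := constantCoeff_comp (G := G) (hx 0) (hx 1)
  have hv := constantCoeff_comp (G := G) (hx 1) (hx 2)
  have as := assoc_comp (G := G) (hx 0) (hx 1) (hx 2) p
  rw [← hxd, ← hyd, ← hzd] at as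
  rw [← hxd, ← hyd] at hu
  rw [← hyd, ← hzd] at hv
  have hx0 : ∀ k, constantCoeff (x k) = 0 := hx 0
  have hy0 : ∀ k, constantCoeff (y k) = 0 := hx 1
  have hz0 : ∀ k, constantCoeff (z k) = 0 := hx 2
  -- the evaluation `x = t`, `y = z = 0`
  let e : Fin 3 × Fin m → MvPowerSeries τ R := fun p => ![t, 0, 0] p.1 p.2
  have he : ∀ p, constantCoeff (e p) = 0 := by
    rintro ⟨i, k⟩
    fin_cases i <;> simp [e, ht]
  have hes := hasSubst_of_constantCoeff_zero he
  have ex : ∀ q, (x q).subst e = t q := fun q => by rw [hxd, subst_X hes]; rfl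
  have ey : ∀ q, (y q).subst e = 0 := fun q => by rw [hyd, subst_X hes]; rfl
  have ez : ∀ q, (z q).subst e = 0 := fun q => by rw [hzd, subst_X hes]; rfl
  have eu : ∀ q, (G.comp x y q).subst e = t q := fun q => by
    rw [comp, subst_comp hx0 hy0 he]
    simp only [ex, ey]
    exact comp_zero_right ht q
  have e00 : (Sum.elim (fun _ => 0) (fun _ => 0) : Fin m ⊕ Fin m → MvPowerSeries τ R) = 0 := by
    funext s; rcases s with s | s <;> rfl
  have ev : ∀ q, (G.comp y z q).subst e = 0 := fun q => by
    rw [comp, subst_comp hy0 hz0 he]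
    simp only [ey, ez]
    rw [e00, subst_zero_of_constantCoeff_zero (G.constantCoeff_series q)]
  -- differentiate associativity in `z_k`
  have d1 := congrArg (pderiv R ((2 : Fin 3), k)) as
  have duz : ∀ q, pderiv R ((2 : Fin 3), k) (G.comp x y q) = 0 := fun q => by
    rw [comp, chain_rule_comp hx0 hy0]
    simp [dx', dy']
  have dvz : ∀ q, pderiv R ((2 : Fin 3), k) (G.comp y z q) =
      (pderiv R (Sum.inr k) (G.series q)).subst (Sum.elim y z) := fun q => by
    rw [comp, chain_rule_comp hy0 hz0]
    simp [dy', dz']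
  rw [comp, comp, chain_rule_comp hu hz0, chain_rule_comp hx0 hv] at d1
  simp only [duz, dz', dx', dvz, mul_zero, Finset.sum_const_zero, zero_add, mul_ite, mul_one,
    Finset.sum_ite_eq, Finset.mem_univ, if_true] at d1
  -- then in `y_l`
  have d2 := congrArg (pderiv R ((1 : Fin 3), l)) d1
  have duy : ∀ q, pderiv R ((1 : Fin 3), l) (G.comp x y q) =
      (pderiv R (Sum.inr l) (G.series q)).subst (Sum.elim x y) := fun q => by
    rw [comp, chain_rule_comp hx0 hy0]
    simp [dx, dy]
  have dvy : ∀ q, pderiv R ((1 : Fin 3), l) (G.comp y z q) =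
      (pderiv R (Sum.inl l) (G.series q)).subst (Sum.elim y z) := fun q => by
    rw [comp, chain_rule_comp hy0 hz0]
    simp [dy, dz]
  rw [chain_rule_comp hu hz0] at d2
  simp only [map_sum, Derivation.leibniz, smul_eq_mul] at d2
  simp only [chain_rule_comp hx0 hv, chain_rule_comp hy0 hz0, dx, dy, dz, duy, dvy, mul_zero,
    Finset.sum_const_zero, zero_add, add_zero, mul_ite, mul_one, Finset.sum_ite_eq,
    Finset.mem_univ, if_true] at d2
  -- and evaluate
  have d3 := congrArg (substAlgHom (R := R) hes) d2
  simp only [map_sum, map_add, map_mul, substAlgHom_apply, subst_comp hu hz0 he,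
    subst_comp hx0 hv he, subst_comp hy0 hz0 he, subst_comp hx0 hy0 he, ex, ey, ez, eu, ev,
    e00, subst_zero_eq_C_constantCoeff, constantCoeff_pderiv_series,
    constantCoeff_pderiv_pderiv_series] at d3
  have e0 : (fun _ => 0 : Fin m → MvPowerSeries τ R) = 0 := rfl
  rw [e0] at d3
  simp only [vf]
  have ha : ∀ r : R, algebraMap R (MvPowerSeries τ R) r = C r := fun r => by
    simp [MvPowerSeries.algebraMap_apply]
  simp only [ha]
  rw [Finset.sum_congr rfl fun j _ => mul_comm _ _, d3]
  rw [Finset.sum_add_distrib, add_comm]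
  simp [apply_ite]

variable (G) in
/-- The bracket `[e_l, e_k] = ∑_j (γ^j_{lk} - γ^j_{kl}) e_j` on `R^m`. -/
noncomputable def bracket (x y : Fin m → R) : Fin m → R :=
  fun j => ∑ l, ∑ k, x l * y k * (G.gam j l k - G.gam j k l)

theorem bracket_add_left (x y z : Fin m → R) :
    G.bracket (x + y) z = G.bracket x z + G.bracket y z := by
  funext j
  simp [bracket, add_mul, Finset.sum_add_distrib]

theorem bracket_add_right (x y z : Fin m → R) :
    G.bracket x (y + z) = G.bracket x y + G.bracket x z := by
  funext j
  simp [bracket, mul_add, add_mul, Finset.sum_add_distrib]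

theorem bracket_smul_right (r : R) (x y : Fin m → R) :
    G.bracket x (r • y) = r • G.bracket x y := by
  funext j
  simp only [bracket, Finset.mul_sum, Pi.smul_apply, smul_eq_mul]
  exact Finset.sum_congr rfl fun _ _ => Finset.sum_congr rfl fun _ _ => by ring

section Op

variable {S : Type*} [CommRing S] [Algebra R S] {n : ℕ}

variable (G S) in
/-- The left-invariant derivation `∑_j (∂G^(j)(t_i, s)/∂s_l)(s = 0) ∂/∂t_i^(j)` attached to `e_l`,
acting on power series in the variables `t_1, …, t_n` through the `i`-th block of variables. -/
noncomputable def opBasis (i : Fin n) (l : Fin m) :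
    MvPowerSeries (Fin n × Fin m) S →ₗ[R] MvPowerSeries (Fin n × Fin m) S :=
  ∑ j, (LinearMap.mulLeft R ((G.vf (fun k => X (i, k)) l j).map (algebraMap R S))).comp
    ((pderiv S (i, j)).toLinearMap.restrictScalars R)

theorem opBasis_apply (i : Fin n) (l : Fin m) (f : MvPowerSeries (Fin n × Fin m) S) :
    G.opBasis S i l f = ∑ j, (G.vf (fun k => X (i, k)) l j).map (algebraMap R S) *
      pderiv S (i, j) f := by
  simp [opBasis]

theorem pderiv_vf (i : Fin n) (j k p : Fin m) :
    pderiv R (i, j) (G.vf (fun k => X (i, k)) k p) =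
      (pderiv R (Sum.inl j) (pderiv R (Sum.inr k) (G.series p))).subst
        (Sum.elim (fun k => (X (i, k) : MvPowerSeries (Fin n × Fin m) R)) 0) := by
  rw [vf, chain_rule_comp (by simp) (by simp)]
  simp [pderiv_X, Pi.single_apply]

theorem vf_bracket (i : Fin n) (l k p : Fin m) :
    ∑ j, (G.vf (fun k => X (i, k)) l j * pderiv R (i, j) (G.vf (fun k => X (i, k)) k p) -
      G.vf (fun k => X (i, k)) k j * pderiv R (i, j) (G.vf (fun k => X (i, k)) l p)) =
    ∑ q, G.vf (fun k => (X (i, k) : MvPowerSeries (Fin n × Fin m) R)) q p *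
      algebraMap R _ (G.gam q l k - G.gam q k l) := by
  simp only [pderiv_vf, Finset.sum_sub_distrib]
  rw [vf_structure (by simp), vf_structure (by simp), pderiv_comm (Sum.inr l)]
  simp [mul_sub]

theorem opBasis_comm (i : Fin n) (l k : Fin m) (f : MvPowerSeries (Fin n × Fin m) S) :
    G.opBasis S i l (G.opBasis S i k f) - G.opBasis S i k (G.opBasis S i l f) =
      ∑ q, (G.gam q l k - G.gam q k l) • G.opBasis S i q f := by
  have h2 : ∀ l k, G.opBasis S i l (G.opBasis S i k f) =
      (∑ p, (∑ j, G.vf (fun k => X (i, k)) l j *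
        pderiv R (i, j) (G.vf (fun k => X (i, k)) k p)).map (algebraMap R S) * pderiv S (i, p) f) +
      ∑ j, ∑ p, (G.vf (fun k => X (i, k)) l j).map (algebraMap R S) *
        (G.vf (fun k => X (i, k)) k p).map (algebraMap R S) *
          pderiv S (i, j) (pderiv S (i, p) f) := by
    intro l k
    simp only [opBasis_apply, map_sum, Derivation.leibniz, smul_eq_mul, map_mul,
      map_pderiv, Finset.sum_mul, mul_add, Finset.sum_add_distrib]
    rw [add_comm]
    congr 1
    · exact Finset.sum_congr rfl fun _ _ => Finset.sum_congr rfl fun _ _ => by ring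
    · rw [Finset.sum_comm]
      exact Finset.sum_congr rfl fun _ _ => Finset.sum_congr rfl fun _ _ => by ring
  have h3 : ∑ j, ∑ p, (G.vf (fun k => X (i, k)) k j).map (algebraMap R S) *
        (G.vf (fun k => X (i, k)) l p).map (algebraMap R S) *
          pderiv S (i, j) (pderiv S (i, p) f) =
      ∑ j, ∑ p, (G.vf (fun k => X (i, k)) l j).map (algebraMap R S) *
        (G.vf (fun k => X (i, k)) k p).map (algebraMap R S) *
          pderiv S (i, j) (pderiv S (i, p) f) := by
    rw [Finset.sum_comm]
    refine Finset.sum_congr rfl fun _ _ => Finset.sum_congr rfl fun _ _ => ?_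
    rw [pderiv_comm]
    ring
  rw [h2, h2, h3, add_sub_add_right_eq_sub, ← Finset.sum_sub_distrib]
  simp only [← sub_mul, ← map_sub, ← Finset.sum_sub_distrib, vf_bracket]
  simp only [opBasis_apply, Finset.smul_sum, map_sum, map_mul, Finset.sum_mul]
  rw [Finset.sum_comm]
  refine Finset.sum_congr rfl fun q _ => Finset.sum_congr rfl fun p _ => ?_
  simp only [MvPowerSeries.algebraMap_apply, map_C, Algebra.algebraMap_self, RingHom.id_apply]
  rw [← MvPowerSeries.algebraMap_apply (R := R) (A := S), Algebra.smul_def]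
  ring

variable (G S) in
/-- The action of `∑_l x_l e_l`. -/
noncomputable def op (i : Fin n) : (Fin m → R) →ₗ[R]
    (MvPowerSeries (Fin n × Fin m) S →ₗ[R] MvPowerSeries (Fin n × Fin m) S) :=
  ∑ l, (LinearMap.proj l).smulRight (G.opBasis S i l)

theorem op_apply (i : Fin n) (x : Fin m → R) (f : MvPowerSeries (Fin n × Fin m) S) :
    G.op S i x f = ∑ l, x l • G.opBasis S i l f := by
  simp [op]

theorem op_bracket (i : Fin n) (x y : Fin m → R) (f : MvPowerSeries (Fin n × Fin m) S) :
    G.op S i (G.bracket x y) f = G.op S i x (G.op S i y f) - G.op S i y (G.op S i x f) := by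
  have h : G.op S i x (G.op S i y f) - G.op S i y (G.op S i x f) =
      ∑ l, ∑ k, (x l * y k) • ∑ q, (G.gam q l k - G.gam q k l) • G.opBasis S i q f := by
    simp only [← opBasis_comm, op_apply, map_sum, map_smul, Finset.smul_sum, smul_sub,
      Finset.sum_sub_distrib, smul_smul]
    congr 1
    rw [Finset.sum_comm]
    simp only [mul_comm]
  rw [h]
  simp only [op_apply, bracket, Finset.sum_smul, Finset.smul_sum, smul_smul]
  rw [Finset.sum_comm]
  refine Finset.sum_congr rfl fun l _ => ?_
  rw [Finset.sum_comm]

end Op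

theorem op_X (x : Fin m → R) (j : Fin m) :
    constantCoeff (G.op R (0 : Fin 1) x (X (0, j))) = x j := by
  simp only [op_apply, opBasis_apply]
  have : ∀ l : Fin m, constantCoeff (G.vf (fun k => (X ((0 : Fin 1), k) :
    MvPowerSeries (Fin 1 × Fin m) R)) l j) = if l = j then 1 else 0 := fun l =>
      constantCoeff_vf (by simp) l j
  simp [pderiv_X, Pi.single_apply, this]

theorem op_injective {x y : Fin m → R} (h : G.op R (0 : Fin 1) x = G.op R (0 : Fin 1) y) :
    x = y := by
  funext j
  rw [← op_X (G := G) x j, h, op_X]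

theorem bracket_self (x : Fin m → R) : G.bracket x x = 0 := by
  funext j
  simp only [bracket, mul_sub, Finset.sum_sub_distrib, Pi.zero_apply]
  rw [sub_eq_zero, Finset.sum_comm]
  simp only [mul_comm]

theorem bracket_leibniz (x y z : Fin m → R) :
    G.bracket x (G.bracket y z) = G.bracket (G.bracket x y) z + G.bracket y (G.bracket x z) := by
  refine op_injective (G := G) ?_
  ext1 f
  simp only [map_add, LinearMap.add_apply, op_bracket, map_sub]
  abel

end Domain

/-- The Lie algebra of `G`: the free `R`-module with basis `e_1, …, e_m`, the vector `e_j` being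
the functional `f ↦ (∂f/∂t^(j))(0)`. -/
def LieAlg {R : Type*} [CommRing R] {m : ℕ} (_G : FormalGroupLaw R m) : Type _ := Fin m → R

section LieAlg

variable {R : Type*} [CommRing R] {m : ℕ} (G : FormalGroupLaw R m)

instance : AddCommGroup G.LieAlg := inferInstanceAs (AddCommGroup (Fin m → R))

instance : Module R G.LieAlg := inferInstanceAs (Module R (Fin m → R))

variable [IsDomain R] [CharZero R]

noncomputable instance : LieRing G.LieAlg where
  bracket x y := G.bracket x y
  add_lie := bracket_add_left
  lie_add := bracket_add_right
  lie_self x := bracket_self x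
  leibniz_lie x y z := bracket_leibniz x y z

noncomputable instance : LieAlgebra R G.LieAlg where
  lie_smul := bracket_smul_right

end LieAlg

end FormalGroupLaw

namespace FGL

section DividedPower

variable {R K : Type*} [CommRing R] [CommRing K] [Algebra R K] {σ τ : Type*} [Fintype σ] [Fintype τ]

variable (R K τ) in
/-- The power series `∑ b_e t^e` over `K` with `e! b_e ∈ R` for all multi-indices `e`. -/
def dpSeries : Submodule R (MvPowerSeries τ K) where
  carrier := {f | ∀ e : τ →₀ ℕ, ∃ r : R,
    algebraMap R K r = ((∏ t, (e t).factorial : ℕ) : K) * coeff e f}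
  add_mem' := by
    intro f g hf hg e
    obtain ⟨a, ha⟩ := hf e
    obtain ⟨b, hb⟩ := hg e
    exact ⟨a + b, by rw [map_add, map_add, ha, hb, mul_add]⟩
  zero_mem' := fun e => ⟨0, by simp⟩
  smul_mem' := by
    intro r f hf e
    obtain ⟨a, ha⟩ := hf e
    refine ⟨r * a, ?_⟩
    have : coeff e (r • f) = algebraMap R K r * coeff e f := Algebra.smul_def _ _
    rw [map_mul, ha, this]
    ring

theorem mem_dpSeries {f : MvPowerSeries τ K} : f ∈ dpSeries R K τ ↔ ∀ e : τ →₀ ℕ, ∃ r : R,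
    algebraMap R K r = ((∏ t, (e t).factorial : ℕ) : K) * coeff e f := Iff.rfl

theorem factorial_add_single [DecidableEq τ] (e : τ →₀ ℕ) (i : τ) :
    ∏ t : τ, ((e + Finsupp.single i 1 : τ →₀ ℕ) t).factorial = (e i + 1) * ∏ t, (e t).factorial := by
  rw [← Finset.mul_prod_erase _ _ (Finset.mem_univ i),
    ← Finset.mul_prod_erase Finset.univ (fun t => (e t).factorial) (Finset.mem_univ i), ← mul_assoc]
  congr 1
  · simp [Nat.factorial_succ]
  · refine Finset.prod_congr rfl fun t ht => ?_
    simp [(Finset.ne_of_mem_erase ht).symm]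

theorem pderiv_mem_dpSeries {f : MvPowerSeries τ K} (hf : f ∈ dpSeries R K τ) (i : τ) :
    pderiv K i f ∈ dpSeries R K τ := by
  classical
  intro e
  obtain ⟨r, hr⟩ := hf (e + Finsupp.single i 1)
  refine ⟨r, hr.trans ?_⟩
  rw [factorial_add_single, coeff_pderiv]
  push_cast
  ring

theorem constantCoeff_dpSeries {f : MvPowerSeries τ K} (hf : f ∈ dpSeries R K τ) :
    ∃ r : R, algebraMap R K r = constantCoeff f := by
  obtain ⟨r, hr⟩ := hf 0
  exact ⟨r, by simpa using hr⟩

/-- A set of power series stable under partial derivatives, with constant coefficients in `R`,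
consists of elements of `dpSeries`. -/
theorem mem_dpSeries_of_stable (P : Set (MvPowerSeries τ K))
    (h0 : ∀ f ∈ P, ∃ r : R, algebraMap R K r = constantCoeff f)
    (h1 : ∀ f ∈ P, ∀ i, pderiv K i f ∈ P) {f : MvPowerSeries τ K} (hf : f ∈ P) :
    f ∈ dpSeries R K τ := by
  classical
  have key : ∀ (n : ℕ) (f : MvPowerSeries τ K), f ∈ P → ∀ e : τ →₀ ℕ, e.degree = n →
      ∃ r : R, algebraMap R K r = ((∏ t, (e t).factorial : ℕ) : K) * coeff e f := by
    intro n
    induction n with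
    | zero =>
      intro f hf e he
      rw [Finsupp.degree_eq_zero_iff] at he
      subst he
      simpa using h0 f hf
    | succ n ih =>
      intro f hf e he
      obtain ⟨i, hi⟩ : ∃ i, e i ≠ 0 := by
        by_contra! hc
        have : e = 0 := Finsupp.ext hc
        simp [this] at he
      have hle : Finsupp.single i 1 ≤ e := by
        rw [Finsupp.single_le_iff]; omega
      obtain ⟨e', rfl⟩ : ∃ e', e = e' + Finsupp.single i 1 := ⟨_, (tsub_add_cancel_of_le hle).symm⟩
      have hd : e'.degree = n := by
        rw [map_add, Finsupp.degree_single] at he; omega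
      obtain ⟨r, hr⟩ := ih _ (h1 f hf i) e' hd
      refine ⟨r, hr.trans ?_⟩
      rw [factorial_add_single, coeff_pderiv]
      push_cast
      ring
  exact fun e => key _ f hf e rfl

/-- `dpSeries` is stable under substitution of power series over `R` without constant term, and
under multiplication by power series over `R`. -/
theorem subst_mul_mem_dpSeries {a : σ → MvPowerSeries τ R} (ha : ∀ s, constantCoeff (a s) = 0)
    {f : MvPowerSeries σ K} (hf : f ∈ dpSeries R K σ) (h : MvPowerSeries τ R) :
    f.subst (fun s => (a s).map (algebraMap R K)) * h.map (algebraMap R K) ∈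
      dpSeries R K τ := by
  have ha' : ∀ s, constantCoeff ((a s).map (algebraMap R K)) = 0 := fun s => by
    simp [constantCoeff_map, ha]
  have hs := hasSubst_of_constantCoeff_zero ha'
  let Q : AddSubmonoid (MvPowerSeries τ K) := AddSubmonoid.closure
    {g | ∃ f ∈ dpSeries R K σ, ∃ h : MvPowerSeries τ R,
      g = f.subst (fun s => (a s).map (algebraMap R K)) * h.map (algebraMap R K)}
  refine mem_dpSeries_of_stable (Q : Set (MvPowerSeries τ K)) ?_ ?_
    (AddSubmonoid.subset_closure ⟨f, hf, h, rfl⟩)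
  · intro g hg
    induction hg using AddSubmonoid.closure_induction with
    | mem g hg =>
      obtain ⟨f, hf, h, rfl⟩ := hg
      obtain ⟨r, hr⟩ := constantCoeff_dpSeries hf
      refine ⟨r * constantCoeff h, ?_⟩
      rw [map_mul, map_mul, constantCoeff_subst' ha', hr, constantCoeff_map]
      rfl
    | zero => exact ⟨0, by simp⟩
    | add x y _ _ hx hy =>
      obtain ⟨r, hr⟩ := hx
      obtain ⟨r', hr'⟩ := hy
      exact ⟨r + r', by rw [map_add, map_add, hr, hr']⟩
  · intro g hg i
    induction hg using AddSubmonoid.closure_induction with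
    | mem g hg =>
      obtain ⟨f, hf, h, rfl⟩ := hg
      rw [Derivation.leibniz, smul_eq_mul, smul_eq_mul, chain_rule hs, ← map_pderiv,
        Finset.mul_sum]
      refine AddSubmonoid.add_mem _ (AddSubmonoid.subset_closure ⟨f, hf, _, rfl⟩)
        (AddSubmonoid.sum_mem _ fun s _ => AddSubmonoid.subset_closure
          ⟨pderiv K s f, pderiv_mem_dpSeries hf s, pderiv R i (a s) * h, ?_⟩)
      rw [map_mul, map_pderiv]
      ring
    | zero => simp
    | add x y _ _ hx hy =>
      rw [map_add]
      exact AddSubmonoid.add_mem _ hx hy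

theorem subst_mem_dpSeries {a : σ → MvPowerSeries τ R} (ha : ∀ s, constantCoeff (a s) = 0)
    {f : MvPowerSeries σ K} (hf : f ∈ dpSeries R K σ) :
    f.subst (fun s => (a s).map (algebraMap R K)) ∈ dpSeries R K τ := by
  simpa using subst_mul_mem_dpSeries ha hf 1

theorem mul_mem_dpSeries {f : MvPowerSeries τ K} (hf : f ∈ dpSeries R K τ)
    (h : MvPowerSeries τ R) : h.map (algebraMap R K) * f ∈ dpSeries R K τ := by
  have := subst_mul_mem_dpSeries (a := fun s : τ => (X s : MvPowerSeries τ R)) (by simp) hf h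
  simp only [map_X] at this
  have e : f.subst (fun s => (X s : MvPowerSeries τ K)) = f := congrFun subst_self f
  rwa [e, mul_comm] at this

end DividedPower

section Complex

/-- The coboundaries in degree `n` of a sequence of linear maps `d n : C n → C (n + 1)`. -/
def coboundaries {R : Type*} [CommRing R] {C : ℕ → Type*} [∀ n, AddCommGroup (C n)]
    [∀ n, Module R (C n)] (d : ∀ n, C n →ₗ[R] C (n + 1)) : ∀ n, Submodule R (C n)
  | 0 => ⊥
  | n + 1 => LinearMap.range (d n)

/-- The `n`-th cohomology `ker d^n / im d^(n-1)` of a cochain complex in nonnegative degrees. -/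
abbrev Cohomology {R : Type*} [CommRing R] {C : ℕ → Type*} [∀ n, AddCommGroup (C n)]
    [∀ n, Module R (C n)] (d : ∀ n, C n →ₗ[R] C (n + 1)) (n : ℕ) : Type _ :=
  ↥(LinearMap.ker (d n)) ⧸ (coboundaries d n).submoduleOf (LinearMap.ker (d n))

end Complex

section ChevalleyEilenberg

variable {R L : Type*} [CommRing R] [IsDomain R] [CharZero R] [LieRing L] [LieAlgebra R L]

/-- The value of the Chevalley-Eilenberg differential with trivial coefficients,
`∑_{r < s} (-1)^(r + s) ω([x_r, x_s], x_1, …, x_(n+2))` with `x_r`, `x_s` omitted. In terms of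
indices starting at `0`, the pair `r < s` is `i`, `j + 1` with `i ≤ j`. -/
def ceFun {n : ℕ} (ω : L [⋀^Fin (n + 1)]→ₗ[R] R) (x : Fin (n + 2) → L) : R :=
  ∑ i : Fin (n + 1), ∑ j ∈ Finset.Ici i, (-1) ^ (i + j + 1 : ℕ) *
    ω (Matrix.vecCons ⁅x i.castSucc, x j.succ⁆ (j.removeNth (i.castSucc.removeNth x)))

theorem two_mul_ceFun {n : ℕ} (ω : L [⋀^Fin (n + 1)]→ₗ[R] R) (x : Fin (n + 2) → L) :
    2 * ceFun ω x = - AlternatingMap.alternatizeUncurryFin (AlternatingMap.alternatizeUncurryFinLM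
      ∘ₗ ((LieModule.toEnd R L L : L →ₗ[R] Module.End R L).compr₂
        (AlternatingMap.curryLeft ω))) x := by
  rw [AlternatingMap.alternatizeUncurryFin_alternatizeUncurryFinLM_comp_apply, ceFun,
    Finset.mul_sum, ← Finset.sum_neg_distrib]
  refine Finset.sum_congr rfl fun i _ => ?_
  rw [Finset.mul_sum, ← Finset.sum_neg_distrib]
  refine Finset.sum_congr rfl fun j _ => ?_
  have h := lie_skew (x i.castSucc) (x j.succ)
  simp only [LinearMap.compr₂_apply, LieHom.coe_toLinearMap, LieModule.toEnd_apply_apply]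
  rw [← h, map_neg, AlternatingMap.neg_apply, AlternatingMap.curryLeft_apply_apply, zsmul_eq_mul]
  have h2 : ω (Matrix.vecCons (-⁅x j.succ, x i.castSucc⁆)
      (j.removeNth (i.castSucc.removeNth x))) =
      - ω (Matrix.vecCons ⁅x j.succ, x i.castSucc⁆ (j.removeNth (i.castSucc.removeNth x))) := by
    have := congrArg (fun g => g (j.removeNth (i.castSucc.removeNth x)))
      (map_neg (AlternatingMap.curryLeft ω) ⁅x j.succ, x i.castSucc⁆)
    simpa using this
  rw [h2]
  push_cast
  ring

theorem exists_two_mul_ceFun {n : ℕ} (ω : L [⋀^Fin (n + 1)]→ₗ[R] R) :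
    ∃ D : L [⋀^Fin (n + 2)]→ₗ[R] R, ∀ x, 2 * ceFun ω x = D x :=
  ⟨- AlternatingMap.alternatizeUncurryFin (AlternatingMap.alternatizeUncurryFinLM
      ∘ₗ ((LieModule.toEnd R L L : L →ₗ[R] Module.End R L).compr₂
        (AlternatingMap.curryLeft ω))), two_mul_ceFun ω⟩

/-- The Chevalley-Eilenberg differential, cochains being alternating maps. -/
noncomputable def ceD (R L : Type*) [CommRing R] [IsDomain R] [CharZero R] [LieRing L]
    [LieAlgebra R L] : ∀ n : ℕ, (L [⋀^Fin n]→ₗ[R] R) →ₗ[R] (L [⋀^Fin (n + 1)]→ₗ[R] R)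
  | 0 => 0
  | n + 1 =>
    { toFun := fun ω =>
        { toFun := ceFun ω
          map_update_add' := by
            intro _ x i a b
            obtain ⟨D, hD⟩ := exists_two_mul_ceFun ω
            refine mul_left_cancel₀ (two_ne_zero (α := R)) ?_
            rw [mul_add, hD, hD, hD, D.map_update_add]
          map_update_smul' := by
            intro _ x i c a
            obtain ⟨D, hD⟩ := exists_two_mul_ceFun ω
            refine mul_left_cancel₀ (two_ne_zero (α := R)) ?_
            rw [smul_eq_mul, mul_left_comm, hD, hD, D.map_update_smul, smul_eq_mul]
          map_eq_zero_of_eq' := by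
            intro x i j hx hij
            obtain ⟨D, hD⟩ := exists_two_mul_ceFun ω
            refine mul_left_cancel₀ (two_ne_zero (α := R)) ?_
            rw [mul_zero]
            exact (hD x).trans (D.map_eq_zero_of_eq x hx hij) }
      map_add' := by
        intro ω η
        ext x
        simp [ceFun, mul_add, Finset.sum_add_distrib]
      map_smul' := by
        intro c ω
        ext x
        simp [ceFun, Finset.mul_sum, mul_left_comm] }

end ChevalleyEilenberg

end FGL

namespace FormalGroupLaw

open FGL

section Cochains

variable {R : Type*} [CommRing R] {m : ℕ}

/-- The module `Õ(G)^{⊗̂ n}` of modified inhomogeneous `n`-cochains, as the power series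
`∑ b_e t^e` in the variables `t_i^(j)` (`i` in `Fin n`, `j` in `Fin m`) over the fraction field of
`R` with `e! b_e ∈ R`. For `n = 1` this is the modified ring of functions `Õ(G)`. -/
abbrev Cochain (_G : FormalGroupLaw R m) (n : ℕ) :
    Submodule R (MvPowerSeries (Fin n × Fin m) (FractionRing R)) :=
  dpSeries R (FractionRing R) (Fin n × Fin m)

variable (G : FormalGroupLaw R m)

/-- The substitution defining the `i`-th coface map: `t_1, …, t_n` is replaced by
`t_2, …, t_(n+1)` for `i = 0`, by `t_1, …, G(t_i, t_(i+1)), …, t_(n+1)` for `1 ≤ i ≤ n`, and by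
`t_1, …, t_n` for `i = n + 1`. -/
noncomputable def cofaceVar {n : ℕ} (i : Fin (n + 2)) (p : Fin n × Fin m) :
    MvPowerSeries (Fin (n + 1) × Fin m) R :=
  if (p.1 : ℕ) + 1 < i then X (p.1.castSucc, p.2)
  else if (p.1 : ℕ) + 1 = i then
    G.comp (fun k => X (p.1.castSucc, k)) (fun k => X (p.1.succ, k)) p.2
  else X (p.1.succ, p.2)

theorem constantCoeff_cofaceVar {n : ℕ} (i : Fin (n + 2)) (p : Fin n × Fin m) :
    constantCoeff (G.cofaceVar i p) = 0 := by
  unfold cofaceVar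
  split_ifs
  · simp
  · exact constantCoeff_comp (by simp) (by simp) _
  · simp

/-- The `i`-th coface map `∂_n^i`. -/
noncomputable def coface {n : ℕ} (i : Fin (n + 2)) : G.Cochain n →ₗ[R] G.Cochain (n + 1) where
  toFun f := ⟨(f : MvPowerSeries (Fin n × Fin m) (FractionRing R)).subst
    (fun p => (G.cofaceVar i p).map (algebraMap R (FractionRing R))),
    subst_mem_dpSeries (G.constantCoeff_cofaceVar i) f.2⟩
  map_add' f g := by
    ext1
    exact subst_add (hasSubst_of_constantCoeff_zero fun p => by
      simp [constantCoeff_map, constantCoeff_cofaceVar]) _ _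
  map_smul' r f := by
    ext1
    exact subst_smul (hasSubst_of_constantCoeff_zero fun p => by
      simp [constantCoeff_map, constantCoeff_cofaceVar]) _ _

/-- The differential `∂ = ∑_{i=0}^{n+1} (-1)^i ∂_n^i` of the cobar complex of `Õ(G)`. -/
noncomputable def cobarD (n : ℕ) : G.Cochain n →ₗ[R] G.Cochain (n + 1) :=
  ∑ i : Fin (n + 2), (-1 : R) ^ (i : ℕ) • G.coface i

/-- The modified group cohomology `H^n(G̃, R)`. -/
abbrev ModifiedCohomology (n : ℕ) : Type _ := Cohomology (C := fun n => G.Cochain n) G.cobarD n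

/-- The Lie algebra cohomology `H^n(𝔤, R)` with trivial coefficients. -/
abbrev LieCohomology [IsDomain R] [CharZero R] (n : ℕ) : Type _ :=
  Cohomology (C := fun n => G.LieAlg [⋀^Fin n]→ₗ[R] R) (ceD R G.LieAlg) n

end Cochains

section Comparison

variable {R : Type*} [CommRing R] [IsDomain R] [CharZero R] {m : ℕ} (G : FormalGroupLaw R m)

/-- The counit `f ↦ f(0)`, with values in `R`. -/
noncomputable def counit (n : ℕ) : G.Cochain n →ₗ[R] R :=
  (LinearEquiv.ofInjective (Algebra.linearMap R (FractionRing R))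
      (IsFractionRing.injective R (FractionRing R))).symm.toLinearMap ∘ₗ
    LinearMap.codRestrict (LinearMap.range (Algebra.linearMap R (FractionRing R)))
      (((coeff (R := FractionRing R) (0 : Fin n × Fin m →₀ ℕ)).restrictScalars R) ∘ₗ
        (G.Cochain n).subtype)
      (fun f => by
        obtain ⟨r, hr⟩ := constantCoeff_dpSeries f.2
        exact ⟨r, by simpa using hr⟩)

theorem op_mem_cochain {n : ℕ} (i : Fin n) (x : Fin m → R)
    (f : MvPowerSeries (Fin n × Fin m) (FractionRing R)) (hf : f ∈ G.Cochain n) :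
    G.op (FractionRing R) i x f ∈ G.Cochain n := by
  rw [op_apply]
  refine Submodule.sum_mem _ fun l _ => Submodule.smul_mem _ _ ?_
  rw [opBasis_apply]
  exact Submodule.sum_mem _ fun j _ => mul_mem_dpSeries (pderiv_mem_dpSeries hf _) _

attribute [local instance] LieRing.ofAssociativeRing

/-- The action of `𝔤` on `n`-cochains by left-invariant derivations in the `i`-th block of
variables. -/
noncomputable def lieAction {n : ℕ} (i : Fin n) : G.LieAlg →ₗ⁅R⁆ Module.End R (G.Cochain n) where
  toFun x := (G.op (FractionRing R) i x).restrict (G.op_mem_cochain i x)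
  map_add' x y := by
    ext1 f
    ext1
    exact congrFun (congrArg DFunLike.coe (map_add (G.op (FractionRing R) i) x y)) _
  map_smul' r x := by
    ext1 f
    ext1
    exact congrFun (congrArg DFunLike.coe (map_smul (G.op (FractionRing R) i) r x)) _
  map_lie' := by
    intro x y
    ext1 f
    ext1
    exact op_bracket i x y _

/-- The action of `U(𝔤)` on `n`-cochains in the `i`-th block of variables: the algebra
homomorphism extending `lieAction`. Writing `α(u)` for the functional `f ↦ (u • f)(0)` on `Õ(G)`,
one has `u • f = (id ⊗̂ α(u))(μ f)` with `μ f = f(G(t_1, t_2))`, so `α` is the algebra homomorphism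
from `U(𝔤)` to the functionals on `Õ(G)`, multiplied by `(φ ψ)(f) = (φ ⊗̂ ψ)(μ f)`, which extends
`L ↦ L(f)` on `𝔤`. -/
noncomputable def envAction {n : ℕ} (i : Fin n) :
    UniversalEnvelopingAlgebra R G.LieAlg →ₐ[R] Module.End R (G.Cochain n) :=
  UniversalEnvelopingAlgebra.lift R (G.lieAction i)

/-- The map `Õ(G)^{⊗̂ n} → Hom_R(U(𝔤)^{⊗ n}, R)` induced by `Õ(G) → U(𝔤)^*`: it sends `f` to
`u_1 ⊗ ⋯ ⊗ u_n ↦ (α(u_1) ⊗̂ ⋯ ⊗̂ α(u_n))(f)`. Linear forms on `U(𝔤)^{⊗ n}` are written as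
multilinear forms. -/
noncomputable def alphaStar (n : ℕ) : G.Cochain n →ₗ[R]
    MultilinearMap R (fun _ : Fin n => UniversalEnvelopingAlgebra R G.LieAlg) R where
  toFun f := (G.counit n ∘ₗ LinearMap.applyₗ f).compMultilinearMap
    ((MultilinearMap.mkPiAlgebraFin R n (Module.End R (G.Cochain n))).compLinearMap
      (fun i => (G.envAction i).toLinearMap))
  map_add' f g := by
    ext u
    simp
  map_smul' r f := by
    ext u
    simp

/-- The comparison map on cochains: the composite of `alphaStar` with restriction along the
antisymmetrisation `x_1 ∧ ⋯ ∧ x_n ↦ ∑_σ sgn(σ) x_{σ(1)} ⊗ ⋯ ⊗ x_{σ(n)}` from `⋀^n 𝔤` to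
`U(𝔤)^{⊗ n}`. -/
noncomputable def phi (n : ℕ) : G.Cochain n →ₗ[R] (G.LieAlg [⋀^Fin n]→ₗ[R] R) where
  toFun f := MultilinearMap.alternatization ((G.alphaStar n f).compLinearMap
    (fun _ => (UniversalEnvelopingAlgebra.ι R : G.LieAlg →ₗ⁅R⁆ _).toLinearMap))
  map_add' f g := by
    ext x
    simp [MultilinearMap.alternatization_apply, Finset.sum_add_distrib]
  map_smul' r f := by
    ext x
    simp [MultilinearMap.alternatization_apply, Finset.mul_sum, mul_left_comm,
      Units.smul_def]

end Comparison

end FormalGroupLaw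

end

/-! An `(n+1)`-cochain can be read as an `n`-cochain of the formal group with coefficients in
functions of the last block of variables. This gives a double complex. In position `(n, q)` it has
the alternating `q`-forms on the Lie algebra with values in `Cochain (n + 1)`. The horizontal
differential `δ` is `mapForm (transD _)`, the sum of all cofaces but the last. The vertical
differential `formD` is the Chevalley-Eilenberg differential for the left-invariant derivations in
the last block. The two commute because these derivations are invariant under left translation
(`transD_lastAction`).

Rows are exact: setting the last block to zero is a contracting homotopy (`restr_transD_succ`),
because `G(t, 0) = t`. The augmentation edge consists of forms with values in `Cochain 0`, that is,
in `R`, and there the differential is the one of `H(𝔤, R)`. Columns are exact in positive degree: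
the left-invariant fields form a frame, so a column is a de Rham complex in the last block, and the
Poincaré lemma holds (`exists_formD_eq`). It needs integration, and the condition `e! b_e ∈ R` is
exactly what survives integration. In degree zero the closed forms are the cochains independent of
the last block, on which `δ` becomes the cobar differential (`transD_incl`). Both edges therefore
have the same cohomology.

It remains to see that this isomorphism is induced by `phi`, up to sign. The map `cmpMap` extends
`phi` to the double complex: it repeatedly restricts the last block to zero and differentiates in
the preceding one. By `cmpMap_transD`, one zigzag step changes its value only by a sign and an exact
form; by `cmpMap_embed` it equals `phi` on the cochain edge. The chain map property `ceD_phi` is a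
special case. Surjectivity follows a zigzag from the Lie algebra edge to the cochain edge
(`exists_cobarD_eq_zero`), and injectivity runs the zigzag backwards (`mem_nullForm`). -/

section

namespace FGL

/-! ### Exterior calculus: contraction, antisymmetrisation and first order operators. -/

section Forms

variable (R L M : Type*) [CommRing R] [AddCommGroup L] [Module R L] [AddCommGroup M] [Module R M]

/-- Alternating forms of all degrees on `L` with values in `M`. -/
abbrev Forms : Type _ := ∀ q : ℕ, L [⋀^Fin q]→ₗ[R] M

variable {R L M} {M' M'' : Type*} [AddCommGroup M'] [Module R M'] [AddCommGroup M''] [Module R M'']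

/-- Contraction of forms with a vector. -/
def contr : L →ₗ[R] Forms R L M →ₗ[R] Forms R L M :=
  LinearMap.mk₂ R (fun x w q => AlternatingMap.curryLeft (w (q + 1)) x)
    (by intros; funext q; simp) (by intros; funext q; simp)
    (by intros; funext q; simp) (by intros; funext q; simp)

theorem contr_apply (x : L) (w : Forms R L M) (q : ℕ) (v : Fin q → L) :
    contr x w q v = w (q + 1) (Matrix.vecCons x v) := rfl

/-- The form `∑ (-1)^i g(x_i)(x_1, …, x̂_i, …)` attached to a linear family of forms. -/
def uncurryForm : (L →ₗ[R] Forms R L M) →ₗ[R] Forms R L M :=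
  LinearMap.pi fun q => match q with
    | 0 => 0
    | q + 1 => AlternatingMap.alternatizeUncurryFinLM ∘ₗ
        LinearMap.compRight R (LinearMap.proj q : Forms R L M →ₗ[R] L [⋀^Fin q]→ₗ[R] M)

@[simp] theorem uncurryForm_zero (g : L →ₗ[R] Forms R L M) : uncurryForm g 0 = 0 := rfl

theorem uncurryForm_succ (g : L →ₗ[R] Forms R L M) (q : ℕ) (v : Fin (q + 1) → L) :
    uncurryForm g (q + 1) v = ∑ i : Fin (q + 1), (-1) ^ (i : ℕ) • g (v i) q (i.removeNth v) :=
  AlternatingMap.alternatizeUncurryFin_apply _ _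

/-- The vector `x` sits either in the slot fed to `g` (the summand `i = 0`) or in a slot of the form
`g (v i)`, and moving it to the front of the latter costs one sign. The Cartan formulas for `actD`,
`coad` and `trivD` all come from this rule. -/
theorem contr_uncurryForm (x : L) (g : L →ₗ[R] Forms R L M) :
    contr x (uncurryForm g) = g x - uncurryForm (contr x ∘ₗ g) := by
  funext q
  ext v
  rw [contr_apply, uncurryForm_succ, Fin.sum_univ_succ]
  have h0 : (0 : Fin (q + 1)).removeNth (Matrix.vecCons x v) = v := by
    funext k; simp [Fin.removeNth]
  rcases q with _ | q
  · simp [h0]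
  · have h1 : ∀ i : Fin (q + 1), i.succ.removeNth (Matrix.vecCons x v) =
        Matrix.vecCons x (i.removeNth v) := by
      intro i
      funext k
      refine Fin.cases ?_ (fun k => ?_) k <;> simp [Fin.removeNth]
    simp only [Pi.sub_apply, AlternatingMap.sub_apply, uncurryForm_succ, LinearMap.comp_apply,
      contr_apply, h0, h1, Matrix.cons_val_zero, Matrix.cons_val_succ, Fin.val_succ, Fin.val_zero,
      pow_zero, one_smul, pow_succ, mul_neg, mul_one, neg_smul, Finset.sum_neg_distrib]
    abel

/-- The action of a linear map between the coefficient modules on forms. -/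
def mapForm : (M →ₗ[R] M') →ₗ[R] Forms R L M →ₗ[R] Forms R L M' :=
  LinearMap.mk₂ R (fun f w q => f.compAlternatingMap (w q))
    (by intros; funext q; ext v; simp) (by intros; funext q; ext v; simp)
    (by intros; funext q; ext v; simp) (by intros; funext q; ext v; simp)

@[simp] theorem mapForm_apply (f : M →ₗ[R] M') (w : Forms R L M) (q : ℕ) (v : Fin q → L) :
    mapForm f w q v = f (w q v) := rfl

theorem mapForm_id (w : Forms R L M) : mapForm LinearMap.id w = w := rfl

theorem contr_mapForm (x : L) (f : M →ₗ[R] M') (w : Forms R L M) :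
    contr x (mapForm f w) = mapForm f (contr x w) := rfl

theorem mapForm_uncurryForm (f : M →ₗ[R] M') (g : L →ₗ[R] Forms R L M) :
    mapForm f (uncurryForm g) = uncurryForm (mapForm f ∘ₗ g) := by
  funext q
  ext v
  rcases q with _ | q
  · simp
  · simp [uncurryForm_succ, map_sum, map_zsmul]

/-- A form is determined by its degree zero part and its contractions. -/
theorem form_ext {w w' : Forms R L M} (h0 : w 0 = w' 0) (h : ∀ x, contr x w = contr x w') :
    w = w' := by
  funext q
  rcases q with _ | q
  · exact h0
  · ext v
    have := congrArg (fun u => u q (Matrix.vecTail v)) (h (Matrix.vecHead v))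
    simpa [contr_apply, Matrix.cons_head_tail] using this

/-- A family of forms without degree zero part, stable under contractions up to scalars,
vanishes. -/
theorem eq_zero_of_contr {T : Type*} (E : T → Forms R L M) (h0 : ∀ t, E t 0 = 0)
    (h : ∀ x t, ∃ (t' : T) (c : R), contr x (E t) = c • E t') (t : T) : E t = 0 := by
  funext q
  induction q generalizing t with
  | zero => exact h0 t
  | succ q ih =>
    ext v
    obtain ⟨t', c, htc⟩ := h (Matrix.vecHead v) t
    have := congrArg (fun u => u q (Matrix.vecTail v)) htc
    simp only [contr_apply, Matrix.cons_head_tail, Pi.smul_apply, ih] at this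
    simpa using this

theorem contr_contr (x y : L) (w : Forms R L M) : contr x (contr y w) = - contr y (contr x w) := by
  funext q
  ext v
  simp only [contr_apply, Pi.neg_apply, AlternatingMap.neg_apply]
  rw [← (w (q + 1 + 1)).map_swap _ (show (0 : Fin (q + 2)) ≠ 1 by simp)]
  congr 1
  funext k
  refine Fin.cases ?_ (fun k => Fin.cases ?_ (fun k => ?_) k) k
  · simp
  · simp
  · have h1 : k.succ.succ ≠ (0 : Fin (q + 2)) := Fin.succ_ne_zero _
    have h2 : k.succ.succ ≠ (1 : Fin (q + 2)) := by
      rw [← Fin.succ_zero_eq_one]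
      exact fun h => Fin.succ_ne_zero _ (Fin.succ_injective _ h)
    simp [Equiv.swap_apply_of_ne_of_ne h1 h2]

/-- Inserting two vectors antisymmetrically sees only the antisymmetric part of `g`. Contraction of
a double antisymmetrisation produces the boundary terms `g x - g.flip x`, which change sign under
`flip`, so the sum of both sides passes to its own contractions and vanishes by `eq_zero_of_contr`.
-/
theorem uncurryForm_uncurryForm_flip (g : L →ₗ[R] L →ₗ[R] Forms R L M) :
    uncurryForm (uncurryForm ∘ₗ g) = - uncurryForm (uncurryForm ∘ₗ g.flip) := by
  refine eq_neg_of_add_eq_zero_left (eq_zero_of_contr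
    (fun g : L →ₗ[R] L →ₗ[R] Forms R L M =>
      uncurryForm (uncurryForm ∘ₗ g) + uncurryForm (uncurryForm ∘ₗ g.flip)) ?_ ?_ g)
  · intro g; simp
  · intro x g
    refine ⟨g.compr₂ (contr x), 1, ?_⟩
    have key : ∀ g : L →ₗ[R] L →ₗ[R] Forms R L M, contr x (uncurryForm (uncurryForm ∘ₗ g)) =
        uncurryForm (g x) - uncurryForm (g.flip x) +
          uncurryForm (uncurryForm ∘ₗ g.compr₂ (contr x)) := by
      intro g
      rw [contr_uncurryForm]
      have : contr x ∘ₗ uncurryForm ∘ₗ g = g.flip x - uncurryForm ∘ₗ g.compr₂ (contr x) := by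
        refine LinearMap.ext fun y => ?_
        simp only [LinearMap.comp_apply, contr_uncurryForm, LinearMap.sub_apply,
          LinearMap.flip_apply]
        rfl
      rw [this, map_sub]
      simp only [LinearMap.comp_apply]
      abel
    rw [map_add, key, key, one_smul, LinearMap.flip_flip]
    have : (g.compr₂ (contr x)).flip = g.flip.compr₂ (contr x) := rfl
    rw [this]
    abel

/-- The first order operator `w ↦ ∑ (-1)^i A(x_i) w(x_1, …, x̂_i, …)`. -/
def actD (A : L →ₗ[R] M →ₗ[R] M') : Forms R L M →ₗ[R] Forms R L M' :=
  uncurryForm ∘ₗ (mapForm ∘ₗ A).flip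

theorem actD_apply (A : L →ₗ[R] M →ₗ[R] M') (w : Forms R L M) :
    actD A w = uncurryForm ((mapForm ∘ₗ A).flip w) := rfl

@[simp] theorem actD_zero_apply (A : L →ₗ[R] M →ₗ[R] M') (w : Forms R L M) : actD A w 0 = 0 := rfl

theorem actD_succ (A : L →ₗ[R] M →ₗ[R] M') (w : Forms R L M) (q : ℕ) (v : Fin (q + 1) → L) :
    actD A w (q + 1) v = ∑ i : Fin (q + 1), (-1) ^ (i : ℕ) • A (v i) (w q (i.removeNth v)) :=
  uncurryForm_succ _ _ _

theorem contr_actD (A : L →ₗ[R] M →ₗ[R] M') (x : L) (w : Forms R L M) :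
    contr x (actD A w) = mapForm (A x) w - actD A (contr x w) :=
  contr_uncurryForm _ _

theorem mapForm_actD (f : M' →ₗ[R] M'') (A : L →ₗ[R] M →ₗ[R] M') (w : Forms R L M) :
    mapForm f (actD A w) = actD (A.compr₂ f) w :=
  mapForm_uncurryForm _ _

theorem actD_mapForm (f : M →ₗ[R] M') (A : L →ₗ[R] M' →ₗ[R] M'') (w : Forms R L M) :
    actD A (mapForm f w) = actD (A.compl₂ f) w := rfl

theorem mapForm_actD_comm (f : M →ₗ[R] M') (A : L →ₗ[R] M →ₗ[R] M) (A' : L →ₗ[R] M' →ₗ[R] M')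
    (h : ∀ x a, f (A x a) = A' x (f a)) (w : Forms R L M) :
    mapForm f (actD A w) = actD A' (mapForm f w) := by
  rw [mapForm_actD, actD_mapForm, show A.compr₂ f = A'.compl₂ f from LinearMap.ext₂ h]

theorem actD_sub (A A' : L →ₗ[R] M →ₗ[R] M') (w : Forms R L M) :
    actD (A - A') w = actD A w - actD A' w := by
  have : (mapForm ∘ₗ (A - A')).flip w = (mapForm ∘ₗ A).flip w - (mapForm ∘ₗ A').flip w :=
    LinearMap.ext fun x =>
      congrArg (fun f : Forms R L M →ₗ[R] Forms R L M' => f w) (map_sub mapForm (A x) (A' x))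
  rw [actD_apply, this, map_sub]
  rfl

theorem actD_actD_of_comm (A : L →ₗ[R] M →ₗ[R] M) (h : ∀ x y a, A x (A y a) = A y (A x a))
    (w : Forms R L M) : actD A (actD A w) = 0 := by
  refine eq_zero_of_contr (fun w : Forms R L M => actD A (actD A w)) (by simp) ?_ w
  intro x w
  refine ⟨contr x w, 1, ?_⟩
  simp only [contr_actD, map_sub, one_smul]
  rw [mapForm_actD_comm (A x) A A (h x)]
  abel

/-- Forms concentrated in degree `q`. -/
def homogForm (R L M : Type*) [CommRing R] [AddCommGroup L] [Module R L] [AddCommGroup M]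
    [Module R M] (q : ℕ) : Submodule R (Forms R L M) where
  carrier := {w | ∀ q', q' ≠ q → w q' = 0}
  add_mem' := by intro a b ha hb q' h; simp [ha q' h, hb q' h]
  zero_mem' := by intro q' _; rfl
  smul_mem' := by intro c a ha q' h; simp [ha q' h]

theorem single_mem_homogForm (q : ℕ) (w : L [⋀^Fin q]→ₗ[R] M) :
    (Pi.single q w : Forms R L M) ∈ homogForm R L M q :=
  fun q' h => by simp [h]

theorem eq_single_of_mem_homogForm {q : ℕ} {w : Forms R L M} (h : w ∈ homogForm R L M q) :
    w = Pi.single q (w q) := by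
  funext q'
  by_cases hq : q' = q
  · subst hq; simp
  · simp [hq, h q' hq]

theorem mapForm_mem_homogForm (f : M →ₗ[R] M') {q : ℕ} {w : Forms R L M}
    (h : w ∈ homogForm R L M q) : mapForm f w ∈ homogForm R L M' q := by
  intro q' hq
  ext v
  simp [h q' hq]

theorem actD_mem_homogForm (A : L →ₗ[R] M →ₗ[R] M') {q : ℕ} {w : Forms R L M}
    (h : w ∈ homogForm R L M q) : actD A w ∈ homogForm R L M' (q + 1) := by
  intro q' hq
  rcases q' with _ | q'
  · rfl
  · ext v
    rw [actD_succ]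
    simp [h q' (by omega)]

theorem mapForm_single (f : M →ₗ[R] M') (q : ℕ) (w : L [⋀^Fin q]→ₗ[R] M) :
    mapForm f (Pi.single q w) = Pi.single q (f.compAlternatingMap w) := by
  have h := eq_single_of_mem_homogForm (mapForm_mem_homogForm f (single_mem_homogForm q w))
  rw [h]
  congr 1
  ext v
  simp

end Forms

/-! ### Cartan calculus and the Chevalley-Eilenberg differential. -/

section LieForms

variable {R L M : Type*} [CommRing R] [LieRing L] [LieAlgebra R L] [AddCommGroup M] [Module R M]
  {M' : Type*} [AddCommGroup M'] [Module R M']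

/-- The coadjoint action of a Lie algebra on forms,
`w ↦ - ∑ w(x_1, …, [x, x_i], …)`. -/
noncomputable def coad : L →ₗ[R] Forms R L M →ₗ[R] Forms R L M :=
  LinearMap.mk₂ R (fun x w => - uncurryForm (contr.flip w ∘ₗ (LieModule.toEnd R L L x)))
    (by intro x y w; rw [map_add, LinearMap.comp_add, map_add, neg_add])
    (by intro c x w; rw [map_smul, LinearMap.comp_smul, map_smul, smul_neg])
    (by intro x w w'; rw [map_add, LinearMap.add_comp, map_add, neg_add])
    (by intro c x w; rw [map_smul, LinearMap.smul_comp, map_smul, smul_neg])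

theorem coad_apply (x : L) (w : Forms R L M) :
    coad x w = - uncurryForm (contr.flip w ∘ₗ (LieModule.toEnd R L L x)) := rfl

@[simp] theorem coad_zero_apply (x : L) (w : Forms R L M) : coad x w 0 = 0 := by
  simp [coad_apply]

/-- Cartan's relation between contraction and Lie derivative: the slot occupied by `x` is either hit
by the action of `y`, giving the bracket, or left alone. -/
theorem contr_coad (x y : L) (w : Forms R L M) :
    contr x (coad y w) = contr ⁅x, y⁆ w + coad y (contr x w) := by
  rw [coad_apply, map_neg, contr_uncurryForm, coad_apply]
  have h1 : contr x ∘ₗ contr.flip w ∘ₗ (LieModule.toEnd R L L y : L →ₗ[R] L) =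
      - (contr.flip (contr x w) ∘ₗ (LieModule.toEnd R L L y)) := by
    refine LinearMap.ext fun z => ?_
    exact contr_contr x ⁅y, z⁆ w
  have h2 : contr ⁅x, y⁆ w = - (contr ⁅y, x⁆ w) := by
    rw [← lie_skew, map_neg]; rfl
  rw [h1, map_neg, h2]
  simp only [LinearMap.comp_apply, LinearMap.flip_apply, LieModule.toEnd_apply_apply]
  abel

theorem mapForm_coad (f : M →ₗ[R] M') (x : L) (w : Forms R L M) :
    mapForm f (coad x w) = coad x (mapForm f w) := by
  rw [coad_apply, map_neg, mapForm_uncurryForm]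
  rfl

/-- The Jacobi identity enters the calculus of forms here. Contracting the defect with `z` leaves
the contraction with a Jacobi sum, which is zero, and the defect at `contr z w`. -/
theorem coad_bracket (x y : L) (w : Forms R L M) :
    coad ⁅x, y⁆ w = coad x (coad y w) - coad y (coad x w) := by
  refine (sub_eq_zero.mp (eq_zero_of_contr
    (fun w : Forms R L M => coad x (coad y w) - coad y (coad x w) - coad ⁅x, y⁆ w) (by simp)
    ?_ w)).symm
  intro z w
  refine ⟨contr z w, 1, ?_⟩
  have h : contr ⁅z, ⁅x, y⁆⁆ w = contr ⁅⁅z, x⁆, y⁆ w - contr ⁅⁅z, y⁆, x⁆ w := by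
    rw [leibniz_lie, ← lie_skew x ⁅z, y⁆, map_add, map_neg]
    simp only [LinearMap.add_apply, LinearMap.neg_apply]
    abel
  simp only [map_sub, contr_coad, map_add, one_smul, h]
  abel

variable [IsDomain R] [CharZero R] [Module.IsTorsionFree R M] [Module.IsTorsionFree R M']

/-- The value of the Chevalley-Eilenberg differential with trivial coefficients on forms with
values in a module. -/
def ceSum {n : ℕ} (ω : L [⋀^Fin (n + 1)]→ₗ[R] M) (x : Fin (n + 2) → L) : M :=
  ∑ i : Fin (n + 1), ∑ j ∈ Finset.Ici i, (-1 : R) ^ (i + j + 1 : ℕ) •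
    ω (Matrix.vecCons ⁅x i.castSucc, x j.succ⁆ (j.removeNth (i.castSucc.removeNth x)))

theorem two_smul_injective {a b : M} (h : (2 : R) • a = (2 : R) • b) : a = b :=
  smul_right_injective M (two_ne_zero (α := R)) h

/-- Each pair `r < s` is counted twice when the coadjoint action is antisymmetrised. Since
multiplication by `2` is injective on a torsion-free module in characteristic zero, multilinearity
and alternation of `ceSum`, and its Cartan formula, can be read off from the doubled expression. -/
theorem uncurryForm_coad_succ (w : Forms R L M) (n : ℕ) (x : Fin (n + 2) → L) :
    uncurryForm (coad.flip w) (n + 2) x = (2 : R) • ceSum (w (n + 1)) x := by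
  have h0 : uncurryForm (coad.flip w) (n + 2) =
      - AlternatingMap.alternatizeUncurryFin (AlternatingMap.alternatizeUncurryFinLM
      ∘ₗ ((LieModule.toEnd R L L : L →ₗ[R] Module.End R L).compr₂
        (AlternatingMap.curryLeft (w (n + 1))))) := by
    rw [← neg_one_smul R, ← AlternatingMap.alternatizeUncurryFin_smul]
    change AlternatingMap.alternatizeUncurryFin _ = _
    congr 1
    refine LinearMap.ext fun y => ?_
    rw [LinearMap.smul_apply, neg_one_smul]
    rfl
  rw [h0, AlternatingMap.neg_apply,
    AlternatingMap.alternatizeUncurryFin_alternatizeUncurryFinLM_comp_apply, ceSum,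
    Finset.smul_sum, ← Finset.sum_neg_distrib]
  refine Finset.sum_congr rfl fun i _ => ?_
  rw [Finset.smul_sum, ← Finset.sum_neg_distrib]
  refine Finset.sum_congr rfl fun j _ => ?_
  have h := lie_skew (x i.castSucc) (x j.succ)
  simp only [LinearMap.compr₂_apply, LieHom.coe_toLinearMap, LieModule.toEnd_apply_apply]
  rw [← h, map_neg, AlternatingMap.neg_apply]
  have h2 : (w (n + 1)) (Matrix.vecCons (-⁅x j.succ, x i.castSucc⁆)
      (j.removeNth (i.castSucc.removeNth x))) =
      - (w (n + 1)) (Matrix.vecCons ⁅x j.succ, x i.castSucc⁆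
        (j.removeNth (i.castSucc.removeNth x))) := by
    have := congrArg (fun g => g (j.removeNth (i.castSucc.removeNth x)))
      (map_neg (AlternatingMap.curryLeft (w (n + 1))) ⁅x j.succ, x i.castSucc⁆)
    simpa using this
  rw [h2, AlternatingMap.curryLeft_apply_apply]
  rcases Nat.even_or_odd (i + j : ℕ) with he | he
  · rw [he.neg_one_pow, he.add_one.neg_one_pow]
    module
  · rw [he.neg_one_pow, he.add_one.neg_one_pow]
    module

/-- The Chevalley-Eilenberg differential with trivial action on the coefficients. -/
def trivD : Forms R L M →ₗ[R] Forms R L M where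
  toFun w q := match q with
    | 0 => 0
    | 1 => 0
    | n + 2 =>
      { toFun := ceSum (w (n + 1))
        map_update_add' := by
          intro _ x i a b
          refine two_smul_injective (R := R) ?_
          rw [smul_add, ← uncurryForm_coad_succ, ← uncurryForm_coad_succ, ← uncurryForm_coad_succ,
            AlternatingMap.map_update_add]
        map_update_smul' := by
          intro _ x i c a
          refine two_smul_injective (R := R) ?_
          rw [smul_comm, ← uncurryForm_coad_succ, ← uncurryForm_coad_succ,
            AlternatingMap.map_update_smul]
        map_eq_zero_of_eq' := by
          intro x i j hx hij
          refine two_smul_injective (R := R) ?_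
          rw [smul_zero, ← uncurryForm_coad_succ]
          exact AlternatingMap.map_eq_zero_of_eq _ x hx hij }
  map_add' w w' := by
    funext q
    rcases q with _ | _ | n
    · simp
    · simp
    · ext x
      simp [ceSum, Finset.sum_add_distrib]
  map_smul' c w := by
    funext q
    rcases q with _ | _ | n
    · simp
    · simp
    · ext x
      simp [ceSum, Finset.smul_sum, smul_comm c]

@[simp] theorem trivD_zero_apply (w : Forms R L M) : trivD w 0 = 0 := rfl

@[simp] theorem trivD_one_apply (w : Forms R L M) : trivD w 1 = 0 := rfl

theorem trivD_apply (w : Forms R L M) (n : ℕ) (x : Fin (n + 2) → L) :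
    trivD w (n + 2) x = ceSum (w (n + 1)) x := rfl

theorem two_smul_trivD (w : Forms R L M) : (2 : R) • trivD w = uncurryForm (coad.flip w) := by
  funext q
  rcases q with _ | _ | n
  · simp
  · ext x
    rw [uncurryForm_succ]
    simp
  · ext x
    rw [uncurryForm_coad_succ]
    rfl

/-- Proved after doubling, where `contr_uncurryForm` and `contr_coad` apply. The bracket term of
`contr_coad` antisymmetrises to another copy of `coad x w`, which provides the factor `2` on the
right. -/
theorem contr_trivD (x : L) (w : Forms R L M) :
    contr x (trivD w) = coad x w - trivD (contr x w) := by
  have h : (2 : R) • contr x (trivD w) = (2 : R) • (coad x w - trivD (contr x w)) := by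
    rw [← map_smul, two_smul_trivD, contr_uncurryForm, smul_sub, two_smul_trivD]
    have : contr x ∘ₗ coad.flip w = - (contr.flip w ∘ₗ (LieModule.toEnd R L L (-x))) +
        coad.flip (contr x w) := by
      refine LinearMap.ext fun y => ?_
      have h1 := contr_coad x y w
      simp only [map_neg, LinearMap.comp_neg, neg_neg, LinearMap.add_apply]
      exact h1
    rw [this, map_add, map_neg, map_neg, LinearMap.comp_neg, map_neg, neg_neg]
    have h2 := coad_apply x w
    rw [LinearMap.flip_apply, two_smul, eq_neg_of_add_eq_zero_left (by rw [h2]; abel :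
      uncurryForm (contr.flip w ∘ₗ (LieModule.toEnd R L L x)) + coad x w = 0)]
    abel
  funext q
  ext v
  exact two_smul_injective (R := R) (congrArg (fun u => u q v) h)

theorem mapForm_trivD (f : M →ₗ[R] M') (w : Forms R L M) :
    mapForm f (trivD w) = trivD (mapForm f w) := by
  refine (sub_eq_zero.mp (eq_zero_of_contr
    (fun w : Forms R L M => mapForm f (trivD w) - trivD (mapForm f w)) ?_ ?_ w))
  · intro w; ext v; simp
  · intro x w
    refine ⟨contr x w, -1, ?_⟩
    simp only [map_sub, contr_mapForm, contr_trivD, mapForm_coad]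
    module

theorem trivD_mem_homogForm {q : ℕ} {w : Forms R L M}
    (h : w ∈ homogForm R L M q) : trivD w ∈ homogForm R L M (q + 1) := by
  intro q' hq
  rcases q' with _ | _ | q'
  · rfl
  · rfl
  · ext v
    rw [trivD_apply]
    simp [ceSum, h (q' + 1) (by omega)]

/-- The Chevalley-Eilenberg differential attached to an action `A` on the coefficients. -/
def chevD (A : L →ₗ[R] M →ₗ[R] M) : Forms R L M →ₗ[R] Forms R L M := actD A + trivD

theorem chevD_apply (A : L →ₗ[R] M →ₗ[R] M) (w : Forms R L M) :
    chevD A w = actD A w + trivD w := rfl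

theorem chevD_zero : (chevD 0 : Forms R L M →ₗ[R] Forms R L M) = trivD := by
  ext w : 1
  rw [chevD_apply, actD_apply]
  have : (mapForm ∘ₗ (0 : L →ₗ[R] M →ₗ[R] M)).flip w = 0 := by
    refine LinearMap.ext fun x => ?_
    exact congrArg (fun f : Forms R L M →ₗ[R] Forms R L M => f w) (map_zero mapForm)
  rw [this, map_zero, zero_add]

theorem chevD_mem_homogForm (A : L →ₗ[R] M →ₗ[R] M) {q : ℕ} {w : Forms R L M}
    (h : w ∈ homogForm R L M q) : chevD A w ∈ homogForm R L M (q + 1) :=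
  add_mem (actD_mem_homogForm A h) (trivD_mem_homogForm h)

theorem mapForm_chevD_comm (f : M →ₗ[R] M') (A : L →ₗ[R] M →ₗ[R] M)
    (A' : L →ₗ[R] M' →ₗ[R] M') (h : ∀ x a, f (A x a) = A' x (f a)) (w : Forms R L M) :
    mapForm f (chevD A w) = chevD A' (mapForm f w) := by
  rw [chevD_apply, map_add, mapForm_actD_comm f A A' h, mapForm_trivD, chevD_apply]

/-- The usual Cartan argument. With `ℒ x` the Lie derivative, `h1` is the magic formula, `h2` and
`h3` are its commutation with contractions and brackets, and `h4` its commutation with the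
differential. Then contraction passes through the square of the differential, which therefore
vanishes by `eq_zero_of_contr`. -/
theorem chevD_chevD (A : L →ₗ[R] M →ₗ[R] M)
    (hA : ∀ x y a, A ⁅x, y⁆ a = A x (A y a) - A y (A x a)) (w : Forms R L M) :
    chevD A (chevD A w) = 0 := by
  let ℒ : L → Forms R L M →ₗ[R] Forms R L M := fun x => mapForm (A x) + coad x
  have hℒ : ∀ x w, ℒ x w = mapForm (A x) w + coad x w := fun _ _ => rfl
  have h1 : ∀ x w, contr x (chevD A w) = ℒ x w - chevD A (contr x w) := by
    intro x w
    rw [chevD_apply, map_add, contr_actD, contr_trivD, chevD_apply, hℒ]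
    abel
  have h2 : ∀ x y w, contr y (ℒ x w) = ℒ x (contr y w) + contr ⁅y, x⁆ w := by
    intro x y w
    rw [hℒ, map_add, contr_mapForm, contr_coad, hℒ]
    abel
  have h3 : ∀ x y w, ℒ ⁅x, y⁆ w = ℒ x (ℒ y w) - ℒ y (ℒ x w) := by
    intro x y w
    have : mapForm (A ⁅x, y⁆) w = mapForm (A x) (mapForm (A y) w) -
        mapForm (A y) (mapForm (A x) w) := by
      funext q
      ext v
      simp [hA]
    simp only [hℒ, map_add, coad_bracket, this, mapForm_coad]
    abel
  have h4 : ∀ x w, ℒ x (chevD A w) - chevD A (ℒ x w) = 0 := by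
    intro x w
    refine eq_zero_of_contr
      (fun w : Forms R L M => ℒ x (chevD A w) - chevD A (ℒ x w)) ?_ ?_ w
    · intro w
      ext v
      simp [hℒ, chevD_apply]
    · intro y w
      refine ⟨contr y w, -1, ?_⟩
      -- This cancels all terms quadratic in `ℒ` in the contraction of the commutator; what remains
      -- is minus the commutator at `contr y w`.
      have h5 : ℒ ⁅y, x⁆ w = ℒ y (ℒ x w) - ℒ x (ℒ y w) := h3 y x w
      simp only [map_sub, h1, h2, map_add, h5]
      module
  refine eq_zero_of_contr (fun w : Forms R L M => chevD A (chevD A w)) ?_ ?_ w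
  · intro w
    simp [chevD_apply]
  · intro x w
    refine ⟨contr x w, 1, ?_⟩
    have := sub_eq_zero.mp (h4 x w)
    simp only [h1, map_sub, this, one_smul]
    abel

/-- The square-zero relation with its purely trivial part removed. It is needed because `stepMap`
applies `actD` alone rather than the whole differential. -/
theorem actD_actD_add (A : L →ₗ[R] M →ₗ[R] M)
    (hA : ∀ x y a, A ⁅x, y⁆ a = A x (A y a) - A y (A x a)) (w : Forms R L M) :
    actD A (actD A w) = - actD A (trivD w) - trivD (actD A w) := by
  have h := chevD_chevD A hA w
  have h0 : trivD (trivD w) = 0 := by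
    rw [← chevD_zero]
    exact chevD_chevD 0 (by simp) w
  simp only [chevD_apply, map_add, h0, add_zero] at h
  rw [eq_sub_iff_add_eq, eq_neg_iff_add_eq_zero, ← h]

theorem trivD_eq_ceD (w : Forms R L R) (n : ℕ) : trivD w (n + 1) = ceD R L n (w n) := by
  rcases n with _ | n
  · rfl
  · ext x
    rfl

end LieForms

end FGL

end

section

open MvPowerSeries

namespace FormalGroupLaw

open FGL

/-! ### Coface maps and restriction to the locus where the last block vanishes. -/

section SubstCochain

variable {R : Type*} [CommRing R] {m : ℕ} (G : FormalGroupLaw R m)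

theorem hasSubst_map {n n' : ℕ} {a : Fin n × Fin m → MvPowerSeries (Fin n' × Fin m) R}
    (ha : ∀ p, constantCoeff (a p) = 0) :
    HasSubst (fun p => (a p).map (algebraMap R (FractionRing R))) :=
  hasSubst_of_constantCoeff_zero fun p => by simp [constantCoeff_map, ha]

/-- Substitution of power series over `R` without constant term in cochains. -/
noncomputable def substCochain {n n' : ℕ} (a : Fin n × Fin m → MvPowerSeries (Fin n' × Fin m) R)
    (ha : ∀ p, constantCoeff (a p) = 0) : G.Cochain n →ₗ[R] G.Cochain n' where
  toFun f := ⟨(f : MvPowerSeries (Fin n × Fin m) (FractionRing R)).subst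
    (fun p => (a p).map (algebraMap R (FractionRing R))), subst_mem_dpSeries ha f.2⟩
  map_add' f g := by
    ext1
    exact subst_add (hasSubst_map ha) _ _
  map_smul' r f := by
    ext1
    exact subst_smul (hasSubst_map ha) _ _

theorem coe_substCochain {n n' : ℕ} {a : Fin n × Fin m → MvPowerSeries (Fin n' × Fin m) R}
    (ha : ∀ p, constantCoeff (a p) = 0) (f : G.Cochain n) :
    (G.substCochain a ha f : MvPowerSeries (Fin n' × Fin m) (FractionRing R)) =
      (f : MvPowerSeries (Fin n × Fin m) (FractionRing R)).subst
        (fun p => (a p).map (algebraMap R (FractionRing R))) := rfl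

theorem coface_eq_substCochain {n : ℕ} (i : Fin (n + 2)) :
    G.coface (n := n) i = G.substCochain (G.cofaceVar i) (G.constantCoeff_cofaceVar i) := rfl

theorem constantCoeff_subst_zero {σ τ : Type*} [Finite σ] {a : MvPowerSeries σ R}
    {b : σ → MvPowerSeries τ R} (ha : constantCoeff a = 0) (hb : ∀ s, constantCoeff (b s) = 0) :
    constantCoeff (a.subst b) = 0 := by
  rw [constantCoeff_subst' hb, ha, map_zero]

theorem substCochain_substCochain {n n' n'' : ℕ}
    {a : Fin n × Fin m → MvPowerSeries (Fin n' × Fin m) R} (ha : ∀ p, constantCoeff (a p) = 0)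
    {b : Fin n' × Fin m → MvPowerSeries (Fin n'' × Fin m) R} (hb : ∀ p, constantCoeff (b p) = 0)
    (f : G.Cochain n) :
    G.substCochain b hb (G.substCochain a ha f) =
      G.substCochain (fun p => (a p).subst b) (fun p => constantCoeff_subst_zero (ha p) hb) f := by
  ext1
  rw [coe_substCochain, coe_substCochain, coe_substCochain,
    subst_comp_subst_apply (hasSubst_map ha) (hasSubst_map hb)]
  congr 1
  funext p
  rw [map_subst (hasSubst_of_constantCoeff_zero hb)]

theorem substCochain_congr {n n' : ℕ} {a b : Fin n × Fin m → MvPowerSeries (Fin n' × Fin m) R}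
    (ha : ∀ p, constantCoeff (a p) = 0) (hb : ∀ p, constantCoeff (b p) = 0) (h : ∀ p, a p = b p)
    (f : G.Cochain n) : G.substCochain a ha f = G.substCochain b hb f := by
  obtain rfl : a = b := funext h
  rfl

theorem substCochain_X {n : ℕ} {a : Fin n × Fin m → MvPowerSeries (Fin n × Fin m) R}
    (ha : ∀ p, constantCoeff (a p) = 0) (h : ∀ p, a p = X p) (f : G.Cochain n) :
    G.substCochain a ha f = f := by
  ext1
  rw [coe_substCochain]
  simp only [h, map_X]
  exact congrFun subst_self _

/-- The variables of the restriction to the locus where the last block vanishes. -/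
noncomputable def restrVar {n : ℕ} (p : Fin (n + 1) × Fin m) : MvPowerSeries (Fin n × Fin m) R :=
  if h : (p.1 : ℕ) < n then X (⟨p.1, h⟩, p.2) else 0

theorem constantCoeff_restrVar {n : ℕ} (p : Fin (n + 1) × Fin m) :
    constantCoeff (restrVar p : MvPowerSeries (Fin n × Fin m) R) = 0 := by
  unfold restrVar
  split_ifs <;> simp

theorem hasSubst_restrVar {n : ℕ} :
    HasSubst (restrVar : Fin (n + 1) × Fin m → MvPowerSeries (Fin n × Fin m) R) :=
  hasSubst_of_constantCoeff_zero constantCoeff_restrVar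

theorem hasSubst_cofaceVar {n : ℕ} (i : Fin (n + 2)) : HasSubst (G.cofaceVar (n := n) i) :=
  hasSubst_of_constantCoeff_zero (G.constantCoeff_cofaceVar i)

/-- Setting the last block of variables to zero. -/
noncomputable def restr (n : ℕ) : G.Cochain (n + 1) →ₗ[R] G.Cochain n :=
  G.substCochain restrVar constantCoeff_restrVar

theorem comp_subst_eq {σ τ : Type*} [Finite σ] {a b : Fin m → MvPowerSeries σ R}
    (ha : ∀ k, constantCoeff (a k) = 0) (hb : ∀ k, constantCoeff (b k) = 0)
    {c : σ → MvPowerSeries τ R} (hc : ∀ t, constantCoeff (c t) = 0) (j : Fin m) :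
    (G.comp a b j).subst c = G.comp (fun k => (a k).subst c) (fun k => (b k).subst c) j :=
  subst_comp ha hb hc _

theorem cofaceVar_of_lt {n : ℕ} {i : Fin (n + 2)} {p : Fin n × Fin m} (h : (p.1 : ℕ) + 1 < i) :
    G.cofaceVar i p = X (p.1.castSucc, p.2) := if_pos h

theorem cofaceVar_of_eq {n : ℕ} {i : Fin (n + 2)} {p : Fin n × Fin m} (h : (p.1 : ℕ) + 1 = i) :
    G.cofaceVar i p =
      G.comp (fun k => X (p.1.castSucc, k)) (fun k => X (p.1.succ, k)) p.2 := by
  rw [cofaceVar, if_neg (by omega), if_pos h]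

theorem cofaceVar_of_gt {n : ℕ} {i : Fin (n + 2)} {p : Fin n × Fin m} (h : (i : ℕ) < p.1 + 1) :
    G.cofaceVar i p = X (p.1.succ, p.2) := by
  rw [cofaceVar, if_neg (by omega), if_neg (by omega)]

theorem restrVar_of_lt {n : ℕ} {p : Fin (n + 1) × Fin m} (h : (p.1 : ℕ) < n) :
    (restrVar p : MvPowerSeries (Fin n × Fin m) R) = X (⟨p.1, h⟩, p.2) := dif_pos h

theorem restrVar_of_eq {n : ℕ} {p : Fin (n + 1) × Fin m} (h : (p.1 : ℕ) = n) :
    (restrVar p : MvPowerSeries (Fin n × Fin m) R) = 0 := dif_neg (by omega)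

theorem zero_subst {σ τ : Type*} {c : σ → MvPowerSeries τ R} (hc : HasSubst c) :
    (0 : MvPowerSeries σ R).subst c = 0 := by
  rw [← substAlgHom_apply hc]; exact map_zero _

theorem restr_coface_castSucc {n : ℕ} (i : Fin (n + 1)) (f : G.Cochain (n + 1)) :
    G.restr (n + 1) (G.coface i.castSucc.castSucc f) = G.coface i.castSucc (G.restr n f) := by
  rw [coface_eq_substCochain, coface_eq_substCochain, restr, restr, substCochain_substCochain,
    substCochain_substCochain]
  refine substCochain_congr _ _ _ (fun p => ?_) f
  have hp := p.1.isLt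
  have hi := i.isLt
  have hi1 : (i.castSucc.castSucc : ℕ) = i := rfl
  have hi2 : (i.castSucc : ℕ) = i := rfl
  rcases lt_trichotomy ((p.1 : ℕ) + 1) i with h | h | h
  · rw [cofaceVar_of_lt _ (by omega), subst_X hasSubst_restrVar, restrVar_of_lt (by simp; omega),
      restrVar_of_lt (by omega), subst_X (G.hasSubst_cofaceVar _), cofaceVar_of_lt _ (by simp; omega)]
    rfl
  · rw [cofaceVar_of_eq _ (by omega), comp_subst_eq _ (by simp) (by simp) constantCoeff_restrVar,
      restrVar_of_lt (by omega), subst_X (G.hasSubst_cofaceVar _), cofaceVar_of_eq _ (by simp; omega)]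
    congr 1
    · funext k
      rw [subst_X hasSubst_restrVar, restrVar_of_lt (by simp; omega)]
      rfl
    · funext k
      rw [subst_X hasSubst_restrVar, restrVar_of_lt (by simp; omega)]
      rfl
  · rw [cofaceVar_of_gt _ (by omega), subst_X hasSubst_restrVar]
    by_cases hpn : (p.1 : ℕ) < n
    · rw [restrVar_of_lt (by simp; omega), restrVar_of_lt hpn, subst_X (G.hasSubst_cofaceVar _),
        cofaceVar_of_gt _ (by simp; omega)]
      rfl
    · rw [restrVar_of_eq (by simp; omega), restrVar_of_eq (by omega),
        zero_subst (G.hasSubst_cofaceVar _)]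

theorem coface_castSucc_coface_last {n : ℕ} (i : Fin (n + 2)) (f : G.Cochain n) :
    G.coface i.castSucc (G.coface (Fin.last (n + 1)) f) =
      G.coface (Fin.last (n + 2)) (G.coface i f) := by
  simp only [coface_eq_substCochain, substCochain_substCochain]
  refine substCochain_congr _ _ _ (fun p => ?_) f
  have hp := p.1.isLt
  have hi := i.isLt
  have hi1 : (i.castSucc : ℕ) = i := rfl
  have hX : ∀ k (j : Fin (n + 1)), (X (j, k) : MvPowerSeries (Fin (n + 1) × Fin m) R).subst
      (G.cofaceVar (Fin.last (n + 2))) = X (j.castSucc, k) := by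
    intro k j
    rw [subst_X (G.hasSubst_cofaceVar _), cofaceVar_of_lt _ (by simp; omega)]
  rw [cofaceVar_of_lt _ (i := Fin.last (n + 1)) (by simp), subst_X (G.hasSubst_cofaceVar _)]
  rcases lt_trichotomy ((p.1 : ℕ) + 1) i with h | h | h
  · rw [cofaceVar_of_lt _ (by simp; omega), cofaceVar_of_lt _ h, hX]
  · rw [cofaceVar_of_eq _ (by simp; omega), cofaceVar_of_eq _ h,
      comp_subst_eq _ (by simp) (by simp) (G.constantCoeff_cofaceVar _)]
    simp only [hX]
    rfl
  · rw [cofaceVar_of_gt _ (by simp; omega), cofaceVar_of_gt _ h, hX]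
    rfl

theorem restr_coface_last {n : ℕ} (f : G.Cochain n) :
    G.restr n (G.coface (Fin.last (n + 1)) f) = f := by
  rw [coface_eq_substCochain, restr, substCochain_substCochain]
  refine substCochain_X _ _ (fun p => ?_) f
  rw [cofaceVar_of_lt _ (by simp), subst_X hasSubst_restrVar, restrVar_of_lt (by simp)]
  rfl

end SubstCochain

/-! ### The row differential and its contracting homotopy. -/

section Domain

variable {R : Type*} [CommRing R] [IsDomain R] [CharZero R] {m : ℕ} (G : FormalGroupLaw R m)

theorem restr_coface_castSucc_last {n : ℕ} (f : G.Cochain n) :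
    G.restr n (G.coface (Fin.last n).castSucc f) = f := by
  rw [coface_eq_substCochain, restr, substCochain_substCochain]
  refine substCochain_X _ _ (fun p => ?_) f
  have hp := p.1.isLt
  have hX : ∀ k (j : Fin n), (X (j.castSucc, k) : MvPowerSeries (Fin (n + 1) × Fin m) R).subst
      restrVar = (X (j, k) : MvPowerSeries (Fin n × Fin m) R) := by
    intro k j
    rw [subst_X hasSubst_restrVar, restrVar_of_lt (by simp)]
    rfl
  rcases lt_or_eq_of_le (show (p.1 : ℕ) + 1 ≤ n by omega) with h | h
  · rw [cofaceVar_of_lt _ (by simpa using h), hX]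
  · rw [cofaceVar_of_eq _ (by simpa using h), comp_subst_eq _ (by simp) (by simp)
      constantCoeff_restrVar]
    have h0 : (fun k => (X (p.1.succ, k) : MvPowerSeries (Fin (n + 1) × Fin m) R).subst
        restrVar : Fin m → MvPowerSeries (Fin n × Fin m) R) = 0 := by
      funext k
      rw [subst_X hasSubst_restrVar, restrVar_of_eq (by simpa using h)]
      rfl
    simp only [hX, h0]
    exact comp_zero_right (by simp) _

/-- The sum `∑_{i=0}^n (-1)^i ∂^i` of all coface maps but the last one. -/
noncomputable def transD (n : ℕ) : G.Cochain n →ₗ[R] G.Cochain (n + 1) :=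
  ∑ i : Fin (n + 1), (-1 : R) ^ (i : ℕ) • G.coface i.castSucc

/-- The inclusion of the cochains which do not depend on the last block of variables. -/
noncomputable def incl (n : ℕ) : G.Cochain n →ₗ[R] G.Cochain (n + 1) :=
  G.coface (Fin.last (n + 1))

theorem restr_incl {n : ℕ} (f : G.Cochain n) : G.restr n (G.incl n f) = f :=
  G.restr_coface_last f

theorem incl_injective (n : ℕ) : Function.Injective (G.incl n) :=
  Function.LeftInverse.injective G.restr_incl

theorem transD_apply {n : ℕ} (f : G.Cochain n) :
    G.transD n f = ∑ i : Fin (n + 1), (-1 : R) ^ (i : ℕ) • G.coface i.castSucc f := by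
  simp [transD, LinearMap.sum_apply]

theorem restr_transD_zero (f : G.Cochain 0) : G.restr 0 (G.transD 0 f) = f := by
  rw [transD_apply, Fin.sum_univ_one, Fin.val_zero, pow_zero, one_smul]
  exact G.restr_coface_castSucc_last f

/-- The coface multiplying the last two blocks becomes the identity when the last block is zero,
since `G(t, 0) = t`; it accounts for the signed copy of `f`. The other cofaces commute with the
restriction. Up to sign, `restr` is thus a contracting homotopy of the rows. -/
theorem restr_transD_succ {n : ℕ} (f : G.Cochain (n + 1)) :
    G.restr (n + 1) (G.transD (n + 1) f) =
      G.transD n (G.restr n f) + (-1 : R) ^ (n + 1) • f := by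
  rw [transD_apply, Fin.sum_univ_castSucc, map_add, map_sum, transD_apply]
  simp only [map_smul, restr_coface_castSucc_last, restr_coface_castSucc, Fin.val_castSucc,
    Fin.val_last]

/-- Adding a dummy last block shifts the count by one: the `n + 2` cofaces in `transD (n + 1)`
correspond to all cofaces of `cobarD n`, including the last one, which `transD n` omits. -/
theorem transD_incl {n : ℕ} (f : G.Cochain n) :
    G.transD (n + 1) (G.incl n f) = G.incl (n + 1) (G.cobarD n f) := by
  rw [transD_apply, cobarD, LinearMap.sum_apply, map_sum]
  refine Finset.sum_congr rfl fun i _ => ?_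
  rw [LinearMap.smul_apply, map_smul, incl, coface_castSucc_coface_last]
  rfl

end Domain

/-! ### Left-invariant derivations and their compatibility with cofaces. -/

section Action

variable {R : Type*} [CommRing R] [IsDomain R] [CharZero R] {m : ℕ} (G : FormalGroupLaw R m)

theorem vf_subst {σ τ : Type*} [Finite σ] {t : Fin m → MvPowerSeries σ R}
    (ht : ∀ k, constantCoeff (t k) = 0) {c : σ → MvPowerSeries τ R}
    (hc : ∀ s, constantCoeff (c s) = 0) (l j : Fin m) :
    (G.vf t l j).subst c = G.vf (fun k => (t k).subst c) l j := by
  rw [vf, subst_comp ht (by simp) hc, vf]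
  congr 2
  funext k
  exact zero_subst (hasSubst_of_constantCoeff_zero hc)

/-- Left invariance of the vector fields `vf`. -/
theorem sum_vf_mul_pderiv_series {τ : Type*} [Finite τ] {a b : Fin m → MvPowerSeries τ R}
    (ha : ∀ k, constantCoeff (a k) = 0) (hb : ∀ k, constantCoeff (b k) = 0) (l k : Fin m) :
    ∑ j, G.vf b l j * (pderiv R (Sum.inr j) (G.series k)).subst (Sum.elim a b) =
      G.vf (G.comp a b) l k := by
  have hx : ∀ i : Fin 3, ∀ k : Fin m,
    constantCoeff (X (i, k) : MvPowerSeries (Fin 3 × Fin m) R) = 0 := by simp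
  set x : Fin m → MvPowerSeries (Fin 3 × Fin m) R := fun k => X (0, k) with hxd
  set y : Fin m → MvPowerSeries (Fin 3 × Fin m) R := fun k => X (1, k) with hyd
  set z : Fin m → MvPowerSeries (Fin 3 × Fin m) R := fun k => X (2, k) with hzd
  have dx : ∀ i q, pderiv R ((2 : Fin 3), i) (x q) = 0 := fun i q =>
    pderiv_X_of_ne (by simp)
  have dy : ∀ i q, pderiv R ((2 : Fin 3), i) (y q) = 0 := fun i q =>
    pderiv_X_of_ne (by simp)
  have dz : ∀ i q, pderiv R ((2 : Fin 3), i) (z q) = if i = q then 1 else 0 := fun i q => by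
    rw [hzd, pderiv_X]; simp [Pi.single_apply, eq_comm]
  have hx0 : ∀ k, constantCoeff (x k) = 0 := hx 0
  have hy0 : ∀ k, constantCoeff (y k) = 0 := hx 1
  have hz0 : ∀ k, constantCoeff (z k) = 0 := hx 2
  have hu := constantCoeff_comp (G := G) hx0 hy0
  have hv := constantCoeff_comp (G := G) hy0 hz0
  have as := assoc_comp (G := G) hx0 hy0 hz0 k
  let e : Fin 3 × Fin m → MvPowerSeries τ R := fun p => ![a, b, 0] p.1 p.2
  have he : ∀ p, constantCoeff (e p) = 0 := by
    rintro ⟨i, k⟩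
    fin_cases i <;> simp [e, ha, hb]
  have hes := hasSubst_of_constantCoeff_zero he
  have ex : ∀ q, (x q).subst e = a q := fun q => by rw [hxd, subst_X hes]; rfl
  have ey : ∀ q, (y q).subst e = b q := fun q => by rw [hyd, subst_X hes]; rfl
  have ez : ∀ q, (z q).subst e = 0 := fun q => by rw [hzd, subst_X hes]; rfl
  have e0 : (fun _ => 0 : Fin m → MvPowerSeries τ R) = 0 := rfl
  have eu : ∀ q, (G.comp x y q).subst e = G.comp a b q := fun q => by
    rw [comp, subst_comp hx0 hy0 he]
    simp only [ex, ey]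
    rfl
  have ev : ∀ q, (G.comp y z q).subst e = b q := fun q => by
    rw [comp, subst_comp hy0 hz0 he]
    simp only [ey, ez]
    exact comp_zero_right hb q
  -- Left invariance is associativity differentiated in the third argument, then evaluated at `x =
  -- a`, `y = b`, `z = 0`, where `G(b, 0) = b`.
  have d1 := congrArg (pderiv R ((2 : Fin 3), l)) as
  have duz : ∀ q, pderiv R ((2 : Fin 3), l) (G.comp x y q) = 0 := fun q => by
    rw [comp, chain_rule_comp hx0 hy0]
    simp [dx, dy]
  have dvz : ∀ q, pderiv R ((2 : Fin 3), l) (G.comp y z q) =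
      (pderiv R (Sum.inr l) (G.series q)).subst (Sum.elim y z) := fun q => by
    rw [comp, chain_rule_comp hy0 hz0]
    simp [dy, dz]
  rw [comp, comp, chain_rule_comp hu hz0, chain_rule_comp hx0 hv] at d1
  simp only [duz, dz, dx, dvz, mul_zero, Finset.sum_const_zero, zero_add, mul_ite, mul_one,
    Finset.sum_ite_eq, Finset.mem_univ, if_true] at d1
  have d3 := congrArg (substAlgHom (R := R) hes) d1
  simp only [map_sum, map_mul, substAlgHom_apply, subst_comp hu hz0 he, subst_comp hx0 hv he,
    subst_comp hy0 hz0 he, ex, ey, ez, eu, ev] at d3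
  rw [e0] at d3
  simp only [vf]
  refine Eq.trans (Finset.sum_congr rfl fun j _ => mul_comm _ _) (d3.symm.trans ?_)
  rfl

variable {G} in
-- The chain rule for related vector fields: by `h0` only block `i'` of the substituted series
-- depends on `t_i`, and by `h1` the substitution carries the left-invariant frame in block `i` to
-- the one in block `i'`.
theorem opBasis_subst {n n' : ℕ} {a : Fin n × Fin m → MvPowerSeries (Fin n' × Fin m) R}
    (ha : ∀ p, constantCoeff (a p) = 0) (i : Fin n') (i' : Fin n)
    (h0 : ∀ p : Fin n × Fin m, p.1 ≠ i' → ∀ j, pderiv R (i, j) (a p) = 0)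
    (h1 : ∀ l k, ∑ j, G.vf (fun k => X (i, k)) l j * pderiv R (i, j) (a (i', k)) =
      G.vf (fun k => a (i', k)) l k)
    (l : Fin m) (f : MvPowerSeries (Fin n × Fin m) (FractionRing R)) :
    G.opBasis (FractionRing R) i l
        (f.subst (fun p => (a p).map (algebraMap R (FractionRing R)))) =
      (G.opBasis (FractionRing R) i' l f).subst
        (fun p => (a p).map (algebraMap R (FractionRing R))) := by
  have hs := hasSubst_map ha
  rw [opBasis_apply, opBasis_apply]
  conv_rhs => rw [← substAlgHom_apply (R := FractionRing R) hs, map_sum]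
  simp only [map_mul, substAlgHom_apply, chain_rule hs, ← map_pderiv]
  have h2 : ∀ k, ((G.vf (fun k => (X (i', k) : MvPowerSeries (Fin n × Fin m) R)) l k).map
      (algebraMap R (FractionRing R))).subst
        (fun p => (a p).map (algebraMap R (FractionRing R))) =
      (G.vf (fun k => a (i', k)) l k).map (algebraMap R (FractionRing R)) := by
    intro k
    rw [← map_subst (hasSubst_of_constantCoeff_zero ha), vf_subst _ (by simp) ha]
    simp only [subst_X (hasSubst_of_constantCoeff_zero ha)]
  simp only [h2, ← h1, map_sum, map_mul, Fintype.sum_prod_type, Finset.mul_sum, Finset.sum_mul]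
  rw [Finset.sum_comm]
  rw [Finset.sum_eq_single i']
  · rw [Finset.sum_comm]
    exact Finset.sum_congr rfl fun k _ => Finset.sum_congr rfl fun j _ => by ring
  · intro q _ hq
    refine Finset.sum_eq_zero fun j _ => Finset.sum_eq_zero fun k _ => ?_
    rw [h0 (q, k) hq, map_zero, mul_zero, mul_zero]
  · simp

theorem coe_lieAction {n : ℕ} (i : Fin n) (x : G.LieAlg) (f : G.Cochain n) :
    (G.lieAction i x f : MvPowerSeries (Fin n × Fin m) (FractionRing R)) =
      ∑ l, (show Fin m → R from x) l • G.opBasis (FractionRing R) i l f :=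
  op_apply i _ _

variable {G} in
theorem lieAction_substCochain {n n' : ℕ}
    {a : Fin n × Fin m → MvPowerSeries (Fin n' × Fin m) R}
    (ha : ∀ p, constantCoeff (a p) = 0) (i : Fin n') (i' : Fin n)
    (h0 : ∀ p : Fin n × Fin m, p.1 ≠ i' → ∀ j, pderiv R (i, j) (a p) = 0)
    (h1 : ∀ l k, ∑ j, G.vf (fun k => X (i, k)) l j * pderiv R (i, j) (a (i', k)) =
      G.vf (fun k => a (i', k)) l k) (x : G.LieAlg) (f : G.Cochain n) :
    G.lieAction i x (G.substCochain a ha f) = G.substCochain a ha (G.lieAction i' x f) := by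
  ext1
  have hs := hasSubst_map ha
  rw [coe_lieAction, coe_substCochain, coe_substCochain, coe_lieAction]
  simp only [opBasis_subst ha i i' h0 h1]
  rw [← substAlgHom_apply (R := FractionRing R) hs, map_sum]
  refine Finset.sum_congr rfl fun l _ => ?_
  rw [substAlgHom_apply, subst_smul hs]

variable {G} in
theorem lieAction_substCochain_eq_zero {n n' : ℕ}
    {a : Fin n × Fin m → MvPowerSeries (Fin n' × Fin m) R}
    (ha : ∀ p, constantCoeff (a p) = 0) (i : Fin n')
    (h0 : ∀ p : Fin n × Fin m, ∀ j, pderiv R (i, j) (a p) = 0) (x : G.LieAlg) (f : G.Cochain n) :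
    G.lieAction i x (G.substCochain a ha f) = 0 := by
  ext1
  have hs := hasSubst_map ha
  rw [coe_lieAction, coe_substCochain]
  refine Finset.sum_eq_zero fun l _ => ?_
  rw [opBasis_apply, Finset.sum_eq_zero, smul_zero]
  intro j _
  rw [chain_rule hs, Finset.sum_eq_zero, mul_zero]
  intro p _
  rw [← map_pderiv, h0, map_zero, mul_zero]

theorem sum_vf_mul_pderiv_X {n : ℕ} (i : Fin n) (l k : Fin m) :
    ∑ j, G.vf (fun k => X (i, k)) l j * pderiv R (i, j)
      (X (i, k) : MvPowerSeries (Fin n × Fin m) R) = G.vf (fun k => X (i, k)) l k := by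
  rw [Finset.sum_eq_single k]
  · simp
  · intro j _ hj
    rw [pderiv_X_of_ne (by simpa using hj.symm), mul_zero]
  · simp

theorem lieAction_restr {n : ℕ} (i : Fin n) (x : G.LieAlg) (f : G.Cochain (n + 1)) :
    G.lieAction i x (G.restr n f) = G.restr n (G.lieAction i.castSucc x f) := by
  refine lieAction_substCochain _ _ _ (fun p hp j => ?_) (fun l k => ?_) x f
  · by_cases h : (p.1 : ℕ) < n
    · rw [restrVar_of_lt h, pderiv_X_of_ne]
      intro he
      exact hp (Fin.ext (by simpa [Fin.ext_iff] using congrArg (fun q => (q.1 : ℕ)) he))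
    · rw [restrVar_of_eq (by omega), map_zero]
  · have h : ∀ k, (restrVar (i.castSucc, k) : MvPowerSeries (Fin n × Fin m) R) = X (i, k) :=
      fun k => restrVar_of_lt (by simp)
    simp only [h]
    exact G.sum_vf_mul_pderiv_X i l k

theorem pderiv_cofaceVar_last {n : ℕ} (i : Fin (n + 2)) (p : Fin n × Fin m)
    (hi : (p.1 : ℕ) + 1 < n ∨ n < i) (j : Fin m) :
    pderiv R (Fin.last n, j) (G.cofaceVar i p) = 0 := by
  have hX : ∀ (q : Fin (n + 1)) k, (q : ℕ) ≠ n →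
      pderiv R (Fin.last n, j) (X (q, k) : MvPowerSeries (Fin (n + 1) × Fin m) R) = 0 := by
    intro q k hq
    refine pderiv_X_of_ne fun he => hq ?_
    simpa using congrArg (fun q => (q.1 : ℕ)) he
  have hp := p.1.isLt
  have hi' := i.isLt
  rcases lt_trichotomy ((p.1 : ℕ) + 1) i with h | h | h
  · rw [cofaceVar_of_lt _ h]
    exact hX _ _ (by simp; omega)
  · rw [cofaceVar_of_eq _ h, comp, chain_rule_comp (by simp) (by simp)]
    simp only [hX p.1.castSucc _ (by simp; omega), hX p.1.succ _ (by simp; omega), mul_zero,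
      Finset.sum_const_zero, add_zero]
  · rw [cofaceVar_of_gt _ h]
    exact hX _ _ (by simp; omega)

theorem lieAction_last_incl {n : ℕ} (x : G.LieAlg) (f : G.Cochain n) :
    G.lieAction (Fin.last n) x (G.incl n f) = 0 :=
  lieAction_substCochain_eq_zero (G.constantCoeff_cofaceVar _) _
    (fun p j => G.pderiv_cofaceVar_last _ p (Or.inr (by simp)) j) x f

/-- For `i ≤ n` the coface merely relabels the last block. For `i = n + 1` it replaces the last
block by a left translate of it, and the commutation is the left invariance
`sum_vf_mul_pderiv_series`. -/
theorem lieAction_last_coface {n : ℕ} (i : Fin (n + 2)) (x : G.LieAlg) (f : G.Cochain (n + 1)) :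
    G.lieAction (Fin.last (n + 1)) x (G.coface i.castSucc f) =
      G.coface i.castSucc (G.lieAction (Fin.last n) x f) := by
  refine lieAction_substCochain (G.constantCoeff_cofaceVar _) _ _ (fun p hp j => ?_)
    (fun l k => ?_) x f
  · refine G.pderiv_cofaceVar_last _ p (Or.inl ?_) j
    have : (p.1 : ℕ) ≠ n := fun h => hp (Fin.ext h)
    have := p.1.isLt
    omega
  · have hi := i.isLt
    rcases lt_or_eq_of_le (show (i : ℕ) ≤ n + 1 by omega) with h | h
    · have h2 : ∀ k, G.cofaceVar i.castSucc (Fin.last n, k) = X (Fin.last (n + 1), k) := by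
        intro k
        rw [cofaceVar_of_gt _ (by simpa using h)]
        rfl
      simp only [h2]
      exact G.sum_vf_mul_pderiv_X _ l k
    · have h2 : ∀ k, G.cofaceVar i.castSucc (Fin.last n, k) =
          G.comp (fun k => X ((Fin.last n).castSucc, k)) (fun k => X (Fin.last (n + 1), k)) k := by
        intro k
        rw [cofaceVar_of_eq _ (by simpa using h.symm)]
        rfl
      simp only [h2]
      rw [← sum_vf_mul_pderiv_series _ (by simp) (by simp)]
      refine Finset.sum_congr rfl fun j _ => ?_
      congr 1
      have h3 : ∀ q, pderiv R (Fin.last (n + 1), j)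
          (X ((Fin.last n).castSucc, q) : MvPowerSeries (Fin (n + 2) × Fin m) R) = 0 := by
        intro q
        refine pderiv_X_of_ne fun he => ?_
        have := congrArg (fun q => (q.1 : ℕ)) he
        simp at this
      rw [comp, chain_rule_comp (by simp) (by simp)]
      simp [h3, pderiv_X, Pi.single_apply]

attribute [local instance] LieRing.ofAssociativeRing

/-- The action of the Lie algebra through the last block of variables. -/
noncomputable def lastAction : ∀ n : ℕ, G.LieAlg →ₗ[R] Module.End R (G.Cochain n)
  -- With no block left the action on constants is trivial. Hence `formD 0` is the differential with
  -- trivial coefficients, and `stepMap 0` vanishes.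
  | 0 => 0
  | n + 1 => (G.lieAction (Fin.last n)).toLinearMap

theorem lastAction_succ {n : ℕ} (x : G.LieAlg) :
    G.lastAction (n + 1) x = G.lieAction (Fin.last n) x := rfl

theorem lastAction_bracket {n : ℕ} (x y : G.LieAlg) (f : G.Cochain n) :
    G.lastAction n ⁅x, y⁆ f =
      G.lastAction n x (G.lastAction n y f) - G.lastAction n y (G.lastAction n x f) := by
  rcases n with _ | n
  · simp [lastAction]
  · ext1
    exact op_bracket (Fin.last n) x y _

theorem lastAction_incl {n : ℕ} (x : G.LieAlg) (f : G.Cochain n) :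
    G.lastAction (n + 1) x (G.incl n f) = 0 := G.lieAction_last_incl x f

theorem transD_zero : G.transD 0 = G.incl 0 := by
  ext1 f
  rw [transD_apply, Fin.sum_univ_one, Fin.val_zero, pow_zero, one_smul, incl,
    coface_eq_substCochain, coface_eq_substCochain]
  exact substCochain_congr _ _ _ (fun p => p.1.elim0) f

theorem transD_lastAction {n : ℕ} (x : G.LieAlg) (f : G.Cochain n) :
    G.transD n (G.lastAction n x f) = G.lastAction (n + 1) x (G.transD n f) := by
  rcases n with _ | n
  · rw [transD_zero, lastAction_incl]
    simp [lastAction]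
  · rw [transD_apply, transD_apply, map_sum]
    refine Finset.sum_congr rfl fun i _ => ?_
    rw [map_smul, lastAction_succ, lastAction_succ, lieAction_last_coface]

theorem algebraMap_counit {n : ℕ} (f : G.Cochain n) :
    algebraMap R (FractionRing R) (G.counit n f) =
      constantCoeff (f : MvPowerSeries (Fin n × Fin m) (FractionRing R)) := by
  let e := LinearEquiv.ofInjective (Algebra.linearMap R (FractionRing R))
      (IsFractionRing.injective R (FractionRing R))
  have := LinearEquiv.apply_symm_apply e
    (LinearMap.codRestrict (LinearMap.range (Algebra.linearMap R (FractionRing R)))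
      (((coeff (R := FractionRing R) (0 : Fin n × Fin m →₀ ℕ)).restrictScalars R) ∘ₗ
        (G.Cochain n).subtype)
      (fun f => by
        obtain ⟨r, hr⟩ := constantCoeff_dpSeries f.2
        exact ⟨r, by simpa using hr⟩) f)
  exact congrArg Subtype.val this

theorem counit_restr {n : ℕ} (f : G.Cochain (n + 1)) :
    G.counit n (G.restr n f) = G.counit (n + 1) f := by
  refine IsFractionRing.injective R (FractionRing R) ?_
  rw [algebraMap_counit, algebraMap_counit, restr, coe_substCochain, constantCoeff_subst']
  · rfl
  · simp [constantCoeff_map, constantCoeff_restrVar]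

theorem counit_zero_bijective : Function.Bijective (G.counit 0) := by
  constructor
  · intro f g h
    have := congrArg (algebraMap R (FractionRing R)) h
    rw [algebraMap_counit, algebraMap_counit] at this
    ext e
    obtain rfl : e = 0 := Finsupp.ext fun p => p.1.elim0
    simpa using this
  · intro r
    refine ⟨⟨C (algebraMap R (FractionRing R) r), fun e => ⟨r, ?_⟩⟩, ?_⟩
    · obtain rfl : e = 0 := Finsupp.ext fun p => p.1.elim0
      simp
    · refine IsFractionRing.injective R (FractionRing R) ?_
      rw [algebraMap_counit]
      simp

end Action

end FormalGroupLaw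

end

section

open MvPowerSeries

namespace FGL

/-! ### Differentiation, integration and convergence for divided power series. -/

section Calculus

variable {R K σ : Type*} [CommRing R] [Field K] [CharZero K] [Algebra R K] [Fintype σ]

theorem coeff_smul_dpSeries (c : R) (f : dpSeries R K σ) (e : σ →₀ ℕ) :
    coeff e ((c • f : dpSeries R K σ) : MvPowerSeries σ K) =
      c • coeff e (f : MvPowerSeries σ K) := rfl

theorem dpSeries_ext {f g : dpSeries R K σ}
    (h : ∀ e, coeff e (f : MvPowerSeries σ K) = coeff e (g : MvPowerSeries σ K)) : f = g :=
  Subtype.ext (MvPowerSeries.ext h)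

/-- Partial derivatives on `dpSeries`. -/
noncomputable def dpDeriv (s : σ) : dpSeries R K σ →ₗ[R] dpSeries R K σ :=
  ((pderiv K s).toLinearMap.restrictScalars R).restrict fun _ hf => pderiv_mem_dpSeries hf s

theorem coe_dpDeriv (s : σ) (f : dpSeries R K σ) :
    (dpDeriv s f : MvPowerSeries σ K) = pderiv K s f := rfl

theorem coeff_dpDeriv (s : σ) (f : dpSeries R K σ) (e : σ →₀ ℕ) :
    coeff e (dpDeriv s f : MvPowerSeries σ K) =
      coeff (e + Finsupp.single s 1) (f : MvPowerSeries σ K) * (e s + 1) :=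
  coeff_pderiv _ _

theorem dpDeriv_comm (s t : σ) (f : dpSeries R K σ) :
    dpDeriv s (dpDeriv t f) = dpDeriv t (dpDeriv s f) :=
  Subtype.ext (pderiv_comm s t _)

open Classical in
/-- Setting a variable to zero. -/
noncomputable def dpEval (s : σ) : dpSeries R K σ →ₗ[R] dpSeries R K σ where
  toFun f := ⟨fun e => if e s = 0 then coeff e (f : MvPowerSeries σ K) else 0, fun e => by
    by_cases h : e s = 0
    · obtain ⟨r, hr⟩ := f.2 e
      exact ⟨r, by rw [hr]; congr 1; exact (if_pos h).symm⟩
    · exact ⟨0, by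
        rw [map_zero]; exact ((congrArg _ (if_neg h)).trans (mul_zero _)).symm⟩⟩
  map_add' f g := dpSeries_ext fun e => by
    change (if e s = 0 then coeff e (f + g : MvPowerSeries σ K) else 0) =
      (if e s = 0 then coeff e (f : MvPowerSeries σ K) else 0) +
        (if e s = 0 then coeff e (g : MvPowerSeries σ K) else 0)
    split_ifs <;> simp
  map_smul' c f := dpSeries_ext fun e => by
    change (if e s = 0 then c • coeff e (f : MvPowerSeries σ K) else 0) =
      c • (if e s = 0 then coeff e (f : MvPowerSeries σ K) else 0)
    split_ifs <;> simp

open Classical in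
theorem coeff_dpEval (s : σ) (f : dpSeries R K σ) (e : σ →₀ ℕ) :
    coeff e (dpEval s f : MvPowerSeries σ K) =
      if e s = 0 then coeff e (f : MvPowerSeries σ K) else 0 := rfl

open Classical in
/-- Integration in a variable, without constant term. -/
noncomputable def dpInt (s : σ) : dpSeries R K σ →ₗ[R] dpSeries R K σ where
  toFun f := ⟨fun e => if e s = 0 then 0 else
      coeff (e - Finsupp.single s 1) (f : MvPowerSeries σ K) / (e s : K), fun e => by
    by_cases h : e s = 0
    · exact ⟨0, by
        rw [map_zero]; exact ((congrArg _ (if_pos h)).trans (mul_zero _)).symm⟩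
    · obtain ⟨e, rfl⟩ : ∃ e', e = e' + Finsupp.single s 1 :=
        ⟨_, (tsub_add_cancel_of_le (Finsupp.single_le_iff.mpr (by omega))).symm⟩
      -- Integration divides the coefficient by `e s + 1`, and the factorial of the new exponent has
      -- gained precisely this factor. The same `r` therefore serves; on power series over `R` the
      -- division would fail.
      obtain ⟨r, hr⟩ := f.2 e
      refine ⟨r, hr.trans ?_⟩
      have h1 : (((e + Finsupp.single s 1 : σ →₀ ℕ) s : ℕ) : K) = (e s : K) + 1 := by simp
      have h2 : (e s : K) + 1 ≠ 0 := Nat.cast_add_one_ne_zero _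
      rw [factorial_add_single]
      change _ = _ * (if _ then _ else _)
      rw [if_neg h, h1, add_tsub_cancel_right]
      push_cast
      field_simp⟩
  map_add' f g := dpSeries_ext fun e => by
    change (if e s = 0 then 0 else
        coeff (e - Finsupp.single s 1) (f + g : MvPowerSeries σ K) / (e s : K)) =
      (if e s = 0 then 0 else
        coeff (e - Finsupp.single s 1) (f : MvPowerSeries σ K) / (e s : K)) +
      (if e s = 0 then 0 else coeff (e - Finsupp.single s 1) (g : MvPowerSeries σ K) / (e s : K))
    split_ifs
    · simp
    · simp [add_div]
  map_smul' c f := dpSeries_ext fun e => by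
    change (if e s = 0 then 0 else
        (c • coeff (e - Finsupp.single s 1) (f : MvPowerSeries σ K)) / (e s : K)) = c •
      (if e s = 0 then 0 else coeff (e - Finsupp.single s 1) (f : MvPowerSeries σ K) / (e s : K))
    split_ifs
    · simp
    · rw [smul_div_assoc]

open Classical in
theorem coeff_dpInt (s : σ) (f : dpSeries R K σ) (e : σ →₀ ℕ) :
    coeff e (dpInt s f : MvPowerSeries σ K) = if e s = 0 then 0 else
      coeff (e - Finsupp.single s 1) (f : MvPowerSeries σ K) / (e s : K) := rfl

theorem dpDeriv_dpInt_self (s : σ) (f : dpSeries R K σ) : dpDeriv s (dpInt s f) = f := by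
  refine dpSeries_ext fun e => ?_
  have h2 : (e s : K) + 1 ≠ 0 := Nat.cast_add_one_ne_zero _
  rw [coeff_dpDeriv, coeff_dpInt, if_neg (by simp), add_tsub_cancel_right]
  simp only [Finsupp.add_apply, Finsupp.single_eq_same, Nat.cast_add, Nat.cast_one]
  field_simp

theorem dpInt_dpDeriv_self (s : σ) (f : dpSeries R K σ) :
    dpInt s (dpDeriv s f) = f - dpEval s f := by
  refine dpSeries_ext fun e => ?_
  rw [Submodule.coe_sub, map_sub, coeff_dpInt, coeff_dpEval]
  by_cases h : e s = 0
  · simp [h]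
  · obtain ⟨e, rfl⟩ : ∃ e', e = e' + Finsupp.single s 1 :=
      ⟨_, (tsub_add_cancel_of_le (Finsupp.single_le_iff.mpr (by omega))).symm⟩
    have h2 : (e s : K) + 1 ≠ 0 := Nat.cast_add_one_ne_zero _
    rw [if_neg h, if_neg h, add_tsub_cancel_right, coeff_dpDeriv]
    simp only [Finsupp.add_apply, Finsupp.single_eq_same, Nat.cast_add, Nat.cast_one]
    field_simp
    simp

theorem dpDeriv_dpInt_of_ne {s t : σ} (h : t ≠ s) (f : dpSeries R K σ) :
    dpDeriv t (dpInt s f) = dpInt s (dpDeriv t f) := by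
  refine dpSeries_ext fun e => ?_
  rw [coeff_dpDeriv, coeff_dpInt, coeff_dpInt]
  have h1 : (e + Finsupp.single t 1 : σ →₀ ℕ) s = e s := by simp [h]
  rw [h1]
  by_cases h0 : e s = 0
  · simp [h0]
  · obtain ⟨e, rfl⟩ : ∃ e', e = e' + Finsupp.single s 1 :=
      ⟨_, (tsub_add_cancel_of_le (Finsupp.single_le_iff.mpr (by omega))).symm⟩
    rw [if_neg h0, if_neg h0, add_tsub_cancel_right, coeff_dpDeriv, add_right_comm,
      add_tsub_cancel_right]
    have h2 : (e + Finsupp.single s 1 : σ →₀ ℕ) t = e t := by simp [h.symm]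
    rw [h2]
    ring

variable (R K σ) in
/-- The filtration of `dpSeries` by the order of vanishing at the origin. -/
def dpOrder (N : ℕ) : Submodule R (dpSeries R K σ) where
  carrier := {f | ∀ e : σ →₀ ℕ, e.degree < N → coeff e (f : MvPowerSeries σ K) = 0}
  add_mem' := by
    intro f g hf hg e he
    rw [Submodule.coe_add, map_add, hf e he, hg e he, add_zero]
  zero_mem' := fun e _ => by simp
  smul_mem' := by
    intro c f hf e he
    rw [coeff_smul_dpSeries, hf e he, smul_zero]

theorem dpDeriv_mem_dpOrder {N : ℕ} {f : dpSeries R K σ} (hf : f ∈ dpOrder R K σ (N + 1))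
    (s : σ) : dpDeriv s f ∈ dpOrder R K σ N := by
  intro e he
  rw [coeff_dpDeriv, hf, zero_mul]
  rw [map_add, Finsupp.degree_single]
  omega

theorem dpEval_mem_dpOrder {N : ℕ} {f : dpSeries R K σ} (hf : f ∈ dpOrder R K σ N)
    (s : σ) : dpEval s f ∈ dpOrder R K σ N := by
  intro e he
  rw [coeff_dpEval, hf e he, ite_self]

theorem dpInt_mem_dpOrder {N : ℕ} {f : dpSeries R K σ} (hf : f ∈ dpOrder R K σ N)
    (s : σ) : dpInt s f ∈ dpOrder R K σ (N + 1) := by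
  intro e he
  rw [coeff_dpInt]
  split_ifs with h
  · rfl
  · rw [hf, zero_div]
    obtain ⟨e, rfl⟩ : ∃ e', e = e' + Finsupp.single s 1 :=
      ⟨_, (tsub_add_cancel_of_le (Finsupp.single_le_iff.mpr (by omega))).symm⟩
    rw [map_add, Finsupp.degree_single] at he
    rw [add_tsub_cancel_right]
    omega

theorem eq_zero_of_mem_dpOrder {f : dpSeries R K σ} (hf : ∀ N, f ∈ dpOrder R K σ N) : f = 0 :=
  dpSeries_ext fun e => by rw [hf (e.degree + 1) e (Nat.lt_succ_self _)]; simp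

/-- The sum of a sequence of elements whose orders tend to infinity. -/
noncomputable def dpSum : (ℕ → dpSeries R K σ) →ₗ[R] dpSeries R K σ where
  -- Truncation at the degree of `e` keeps the definition linear on all sequences. When `g k` has
  -- order at least `k`, the omitted terms contribute nothing.
  toFun g := ⟨fun e => ∑ k ∈ Finset.range (e.degree + 1), coeff e (g k : MvPowerSeries σ K),
    fun e => by
      choose r hr using fun k => (g k).2 e
      refine ⟨∑ k ∈ Finset.range (e.degree + 1), r k, ?_⟩
      rw [map_sum]
      simp only [hr, ← Finset.mul_sum]
      rfl⟩
  map_add' g h := dpSeries_ext fun e => by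
    change ∑ k ∈ Finset.range (e.degree + 1), coeff e (g k + h k : MvPowerSeries σ K) =
      ∑ k ∈ Finset.range (e.degree + 1), coeff e (g k : MvPowerSeries σ K) +
        ∑ k ∈ Finset.range (e.degree + 1), coeff e (h k : MvPowerSeries σ K)
    simp [Finset.sum_add_distrib]
  map_smul' c g := dpSeries_ext fun e => by
    change ∑ k ∈ Finset.range (e.degree + 1), c • coeff e (g k : MvPowerSeries σ K) =
      c • ∑ k ∈ Finset.range (e.degree + 1), coeff e (g k : MvPowerSeries σ K)
    rw [Finset.smul_sum]

theorem coeff_dpSum (g : ℕ → dpSeries R K σ) (e : σ →₀ ℕ) :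
    coeff e (dpSum g : MvPowerSeries σ K) =
      ∑ k ∈ Finset.range (e.degree + 1), coeff e (g k : MvPowerSeries σ K) := rfl

theorem dpSum_sub_mem_dpOrder {g : ℕ → dpSeries R K σ} (hg : ∀ k, g k ∈ dpOrder R K σ k)
    (N : ℕ) : dpSum g - ∑ k ∈ Finset.range N, g k ∈ dpOrder R K σ N := by
  intro e he
  rw [Submodule.coe_sub, map_sub, coeff_dpSum, Submodule.coe_sum, map_sum, sub_eq_zero]
  refine Finset.sum_subset (Finset.range_mono he) fun k _ hk => hg k e ?_
  simpa using hk

end Calculus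

/-! ### The Poincaré lemma for a constant frame. -/

section Poincare

/-- The operators on functions used in the proof of the Poincaré lemma: commuting partial
derivatives, integrations, evaluations at zero, and a complete separated filtration. -/
structure PoincareData (R M ι : Type*) [CommRing R] [AddCommGroup M] [Module R M] where
  /-- Partial derivatives. -/
  deriv : ι → M →ₗ[R] M
  /-- Integration in a variable. -/
  int : ι → M →ₗ[R] M
  /-- Setting a variable to zero. -/
  ev : ι → M →ₗ[R] M
  /-- The filtration by the order of vanishing. -/
  fil : ℕ → Submodule R M
  /-- Summation of convergent series. -/
  sum : (ℕ → M) →ₗ[R] M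
  deriv_comm : ∀ i j f, deriv i (deriv j f) = deriv j (deriv i f)
  deriv_int_self : ∀ j f, deriv j (int j f) = f
  int_deriv_self : ∀ j f, int j (deriv j f) = f - ev j f
  deriv_int_of_ne : ∀ j k f, k ≠ j → deriv k (int j f) = int j (deriv k f)
  deriv_mem : ∀ N j, ∀ f ∈ fil (N + 1), deriv j f ∈ fil N
  int_mem : ∀ N j, ∀ f ∈ fil N, int j f ∈ fil (N + 1)
  ev_mem : ∀ N j, ∀ f ∈ fil N, ev j f ∈ fil N
  fil_zero : fil 0 = ⊤
  fil_succ_le : ∀ N, fil (N + 1) ≤ fil N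
  separated : ∀ f, (∀ N, f ∈ fil N) → f = 0
  sum_mem : ∀ g : ℕ → M, (∀ k, g k ∈ fil k) → ∀ N, sum g - ∑ k ∈ Finset.range N, g k ∈ fil N

variable {R L M ι : Type*} [CommRing R] [AddCommGroup L] [Module R L] [AddCommGroup M] [Module R M]
  [Fintype ι] (b : Module.Basis ι R L)

variable (L) in
/-- Forms with values in a submodule. -/
def formSub (F : Submodule R M) : Submodule R (Forms R L M) where
  carrier := {w | ∀ q v, w q v ∈ F}
  add_mem' := fun ha hb q v => add_mem (ha q v) (hb q v)
  zero_mem' := fun _ _ => zero_mem _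
  smul_mem' := fun c _ ha q v => Submodule.smul_mem _ c (ha q v)

theorem uncurryForm_mem_formSub {g : L →ₗ[R] Forms R L M} {F : Submodule R M}
    (h : ∀ x, g x ∈ formSub L F) : uncurryForm g ∈ formSub L F := by
  intro q v
  rcases q with _ | q
  · exact zero_mem _
  · rw [uncurryForm_succ]
    exact Submodule.sum_mem _ fun i _ => zsmul_mem (h _ _ _) _

theorem mapForm_mem_formSub {f : M →ₗ[R] M} {F F' : Submodule R M}
    (h : ∀ a ∈ F, f a ∈ F') {w : Forms R L M}
    (hw : w ∈ formSub L F) : mapForm f w ∈ formSub L F' :=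
  fun q v => h _ (hw q v)

theorem contr_mem_formSub (x : L) {F : Submodule R M} {w : Forms R L M}
    (hw : w ∈ formSub L F) : contr x w ∈ formSub L F :=
  fun q _ => hw (q + 1) _

theorem actD_mem_formSub {A : L →ₗ[R] M →ₗ[R] M} {F F' : Submodule R M}
    (h : ∀ x, ∀ a ∈ F, A x a ∈ F') {w : Forms R L M} (hw : w ∈ formSub L F) :
    actD A w ∈ formSub L F' :=
  uncurryForm_mem_formSub fun x => mapForm_mem_formSub (h x) hw

/-- Exterior multiplication with a coordinate form. -/
noncomputable def wedgeCoord (j : ι) : Forms R L M →ₗ[R] Forms R L M :=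
  actD ((b.coord j).smulRight LinearMap.id)

theorem contr_wedgeCoord_self (j : ι) (w : Forms R L M) :
    contr (b j) (wedgeCoord b j w) = w - wedgeCoord b j (contr (b j) w) := by
  rw [wedgeCoord, contr_actD]
  congr 1
  rw [LinearMap.smulRight_apply, Module.Basis.coord_apply, Module.Basis.repr_self,
    Finsupp.single_eq_same, one_smul, mapForm_id]

theorem contr_wedgeCoord_of_ne {j k : ι} (h : k ≠ j) (w : Forms R L M) :
    contr (b k) (wedgeCoord b j w) = - wedgeCoord b j (contr (b k) w) := by
  rw [wedgeCoord, contr_actD, LinearMap.smulRight_apply, Module.Basis.coord_apply,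
    Module.Basis.repr_self, Finsupp.single_eq_of_ne h.symm, zero_smul, map_zero,
    LinearMap.zero_apply, zero_sub]

theorem contr_contr_self (x : L) (w : Forms R L M) : contr x (contr x w) = 0 := by
  funext q
  exact AlternatingMap.curryLeft_same (w (q + 2)) x

namespace PoincareData

variable (D : PoincareData R M ι)

/-- The constant vector field attached to an element of a module with a basis. -/
noncomputable def constField : L →ₗ[R] M →ₗ[R] M :=
  ∑ j, (b.coord j).smulRight (D.deriv j)

theorem constField_apply (x : L) (f : M) :
    D.constField b x f = ∑ j, b.coord j x • D.deriv j f := by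
  simp [constField, LinearMap.sum_apply]

theorem constField_mem_fil {N : ℕ} (x : L) {f : M} (hf : f ∈ D.fil (N + 1)) :
    D.constField b x f ∈ D.fil N := by
  rw [constField_apply]
  exact Submodule.sum_mem _ fun j _ => Submodule.smul_mem _ _ (D.deriv_mem N j f hf)

theorem constField_comm (x y : L) (f : M) :
    D.constField b x (D.constField b y f) = D.constField b y (D.constField b x f) := by
  simp only [constField_apply, map_sum, map_smul, Finset.smul_sum]
  rw [Finset.sum_comm]
  refine Finset.sum_congr rfl fun i _ => Finset.sum_congr rfl fun j _ => ?_
  rw [D.deriv_comm, smul_comm]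

theorem constField_basis (j : ι) : D.constField b (b j) = D.deriv j := by
  classical
  ext f
  simp [constField_apply, Finsupp.single_apply]

/-- The projection killing the coordinate form and the variable of index `j`. -/
noncomputable def killCoord (j : ι) : Forms R L M →ₗ[R] Forms R L M :=
  mapForm (D.ev j) ∘ₗ (LinearMap.id - wedgeCoord b j ∘ₗ contr (b j))

theorem killCoord_apply (j : ι) (w : Forms R L M) :
    D.killCoord b j w = mapForm (D.ev j) w -
      mapForm (D.ev j) (wedgeCoord b j (contr (b j) w)) := by
  rw [killCoord, LinearMap.comp_apply, LinearMap.sub_apply, map_sub]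
  rfl

/-- Integration in variable `j` commutes with the other partial derivatives, while its commutator
with the derivative in `j` is evaluation at zero. So its commutator with the exterior derivative is
evaluation followed by the coordinate form `j`. -/
theorem actD_constField_mapForm_int (j : ι) (w : Forms R L M) :
    actD (D.constField b) (mapForm (D.int j) w) =
      mapForm (D.int j) (actD (D.constField b) w) +
        wedgeCoord b j (mapForm (D.ev j) w) := by
  rw [actD_mapForm, mapForm_actD, wedgeCoord, actD_mapForm, ← sub_eq_iff_eq_add', ← actD_sub]
  congr 1
  refine congrArg _ (LinearMap.ext₂ fun x f => ?_)
  simp only [LinearMap.sub_apply, LinearMap.compl₂_apply, LinearMap.compr₂_apply,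
    constField_apply, map_sum, map_smul, ← Finset.sum_sub_distrib, ← smul_sub,
    LinearMap.smulRight_apply, LinearMap.smul_apply, LinearMap.id_apply]
  rw [Finset.sum_eq_single j]
  · rw [D.deriv_int_self, D.int_deriv_self, sub_sub_cancel]
  · intro k _ hk
    rw [D.deriv_int_of_ne j k _ hk, sub_self, smul_zero]
  · simp

/-- The homotopy is "contract with `b j`, then integrate in `j`". By the Cartan formula the
contributions of the exterior derivative cancel, apart from integrating the derivative in `j` and
the evaluation term; together these give `w` minus its part free of the variable and the form of
index `j`. -/
theorem coord_homotopy (j : ι) (w : Forms R L M) :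
    actD (D.constField b) (mapForm (D.int j) (contr (b j) w)) +
      mapForm (D.int j) (contr (b j) (actD (D.constField b) w)) = w - D.killCoord b j w := by
  have h1 : mapForm (D.int j) (mapForm (D.deriv j) w) = w - mapForm (D.ev j) w := by
    funext q
    ext1 v
    exact D.int_deriv_self _ _
  have h2 : wedgeCoord b j (mapForm (D.ev j) (contr (b j) w)) =
      mapForm (D.ev j) (wedgeCoord b j (contr (b j) w)) :=
    (mapForm_actD_comm _ _ _ (fun x f => by simp) _).symm
  rw [actD_constField_mapForm_int, contr_actD, map_sub, constField_basis, h1, h2, killCoord_apply]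
  abel

theorem contr_killCoord_self (j : ι) (w : Forms R L M) :
    contr (b j) (D.killCoord b j w) = 0 := by
  rw [killCoord_apply, map_sub, contr_mapForm, contr_mapForm, contr_wedgeCoord_self,
    contr_contr_self, map_zero, sub_zero, sub_self]

theorem contr_killCoord_of_ne {j k : ι} (h : k ≠ j) {w : Forms R L M}
    (hw : contr (b k) w = 0) : contr (b k) (D.killCoord b j w) = 0 := by
  rw [killCoord_apply, map_sub, contr_mapForm, contr_mapForm, contr_wedgeCoord_of_ne b h,
    contr_contr, hw]
  simp

theorem killCoord_mem_formSub (j : ι) {N : ℕ} {w : Forms R L M}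
    (hw : w ∈ formSub L (D.fil N)) : D.killCoord b j w ∈ formSub L (D.fil N) := by
  rw [killCoord_apply]
  exact sub_mem (mapForm_mem_formSub (D.ev_mem N j) hw) (mapForm_mem_formSub (D.ev_mem N j)
    (actD_mem_formSub (fun x a ha => Submodule.smul_mem _ _ ha) (contr_mem_formSub _ hw)))

/-- The Poincaré lemma: a homotopy between the identity and the evaluation at the origin. -/
theorem exists_homotopy (l : List ι) :
    ∃ H P : Forms R L M →ₗ[R] Forms R L M,
      (∀ w, actD (D.constField b) (H w) + H (actD (D.constField b) w) = w - P w) ∧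
      (∀ N, ∀ w ∈ formSub L (D.fil N), H w ∈ formSub L (D.fil (N + 1))) ∧
      (∀ N, ∀ w ∈ formSub L (D.fil N), P w ∈ formSub L (D.fil N)) ∧
      (∀ j ∈ l, ∀ w, contr (b j) (P w) = 0) ∧
      ∀ w v, P w 0 v = l.foldr (fun j => D.ev j) (w 0 v) := by
  classical
  induction l with
  | nil =>
    exact ⟨0, LinearMap.id, by simp, fun N w _ => zero_mem _, fun N w hw => hw, by simp, by simp⟩
  | cons j l ih =>
    obtain ⟨H, P, h1, h2, h3, h4, h5⟩ := ih
    have hd : ∀ w : Forms R L M, actD (D.constField b) (actD (D.constField b) w) = 0 :=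
      actD_actD_of_comm _ (D.constField_comm b)
    have hP : ∀ w, P (actD (D.constField b) w) = actD (D.constField b) (P w) := by
      intro w
      have e1 := congrArg (actD (D.constField b)) (h1 w)
      have e2 := h1 (actD (D.constField b) w)
      rw [map_add, hd, zero_add, map_sub] at e1
      rw [hd, map_zero, add_zero] at e2
      exact sub_right_injective (e2.symm.trans e1)
    -- Homotopies are concatenated: the coordinate homotopy is applied to the output of `P`. By `hP`
    -- the map `P` commutes with the differential, so the two homotopy formulas telescope.
    refine ⟨H + mapForm (D.int j) ∘ₗ contr (b j) ∘ₗ P, D.killCoord b j ∘ₗ P, ?_, ?_, ?_, ?_, ?_⟩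
    · intro w
      have e1 := h1 w
      have e2 := D.coord_homotopy b j (P w)
      simp only [LinearMap.add_apply, LinearMap.comp_apply, map_add, hP]
      rw [add_add_add_comm, e1, e2]
      abel
    · intro N w hw
      exact add_mem (h2 N w hw) (mapForm_mem_formSub (D.int_mem N j)
        (contr_mem_formSub _ (h3 N w hw)))
    · intro N w hw
      exact D.killCoord_mem_formSub b j (h3 N w hw)
    · intro k hk w
      by_cases hkj : k = j
      · subst hkj
        exact D.contr_killCoord_self b k _
      · exact D.contr_killCoord_of_ne b hkj
          (h4 k ((List.mem_cons.mp hk).resolve_left hkj) w)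
    · intro w v
      rw [LinearMap.comp_apply, killCoord_apply, List.foldr_cons, ← h5]
      simp [wedgeCoord]

end PoincareData

end Poincare

/-! ### Passage from a constant frame to a frame with variable coefficients. -/

section Exactness

variable {R L M ι : Type*} [CommRing R] [LieRing L] [LieAlgebra R L] [AddCommGroup M] [Module R M]
  [Fintype ι] (b : Module.Basis ι R L) (D : PoincareData R M ι)
  [IsDomain R] [CharZero R] [Module.IsTorsionFree R M]

theorem trivD_mem_formSub {F : Submodule R M} {w : Forms R L M}
    (hw : w ∈ formSub L F) : trivD w ∈ formSub L F := by
  intro q v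
  rcases q with _ | _ | q
  · exact zero_mem _
  · exact zero_mem _
  · rw [trivD_apply, ceSum]
    exact Submodule.sum_mem _ fun i _ => Submodule.sum_mem _ fun j _ =>
      Submodule.smul_mem _ _ (hw _ _)

/-- Exactness of the Chevalley-Eilenberg complex for an action by vector fields which agree with
a constant frame up to operators preserving the order of vanishing. -/
theorem PoincareData.exists_chevD_eq {A : L →ₗ[R] M →ₗ[R] M}
    (hA : ∀ x y a, A ⁅x, y⁆ a = A x (A y a) - A y (A x a))
    (hA' : ∀ N x, ∀ a ∈ D.fil N, A x a - D.constField b x a ∈ D.fil N)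
    {w : Forms R L M} (hw : chevD A w = 0)
    (hw0 : ∀ v, (Finset.univ : Finset ι).toList.foldr (fun j => D.ev j) (w 0 v) = 0) :
    ∃ u, chevD A u = w := by
  obtain ⟨H, P, h1, h2, -, h4, h5⟩ := D.exists_homotopy b (Finset.univ : Finset ι).toList
  have hd : ∀ w, chevD A (chevD A w) = 0 := chevD_chevD A hA
  -- All contractions of `P w` with basis vectors vanish, so only its degree zero part can survive.
  have hP : ∀ w, P w 0 = 0 → P w = 0 := by
    intro w hw
    refine form_ext hw fun x => ?_
    rw [map_zero, ← b.sum_repr x, map_sum, LinearMap.sum_apply]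
    exact Finset.sum_eq_zero fun j _ => by
      rw [map_smul, LinearMap.smul_apply, h4 j (by simp), smul_zero]
  have hPd : ∀ u, P (chevD A u) = 0 := by
    refine fun u => hP _ ?_
    ext1 v
    have h0 : chevD A u 0 = 0 := by simp [chevD_apply]
    have h0' : ∀ l : List ι, l.foldr (fun j => D.ev j) 0 = 0 := by
      intro l
      induction l with
      | nil => rfl
      | cons j l ih => rw [List.foldr_cons, ih, map_zero]
    rw [h5, h0]
    exact h0' _
  have hdiff : ∀ N, ∀ w ∈ formSub L (D.fil N),
      chevD A w - actD (D.constField b) w ∈ formSub L (D.fil N) := by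
    intro N w hw
    have : chevD A w - actD (D.constField b) w = actD (A - D.constField b) w + trivD w := by
      rw [actD_sub, chevD_apply]
      abel
    rw [this]
    exact add_mem (actD_mem_formSub (fun x a ha => hA' N x a ha) hw) (trivD_mem_formSub hw)
  have hle : ∀ N, formSub L (D.fil (N + 1)) ≤ formSub L (D.fil N) :=
    fun N w hw q v => D.fil_succ_le N (hw q v)
  have hdN : ∀ N, ∀ w ∈ formSub L (D.fil (N + 1)), chevD A w ∈ formSub L (D.fil N) := by
    intro N w hw
    have h' : actD (D.constField b) w ∈ formSub L (D.fil N) :=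
      actD_mem_formSub (fun x a ha => D.constField_mem_fil b x ha) hw
    simpa using add_mem (hle N (hdiff (N + 1) w hw)) h'
  -- Successive approximation: the constant-coefficient homotopy gives a primitive up to an error,
  -- and the error is fed back in. Each round raises the order of vanishing of the error `W k` by
  -- one.
  let W : ℕ → Forms R L M := fun k => (fun w => w - chevD A (H w))^[k] w
  have hW0 : W 0 = w := rfl
  have hWs : ∀ k, W (k + 1) = W k - chevD A (H (W k)) := fun k =>
    Function.iterate_succ_apply' _ _ _
  have hWT : ∀ k, chevD A (W k) = 0 ∧ P (W k) = 0 ∧ W k ∈ formSub L (D.fil k) := by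
    intro k
    induction k with
    | zero =>
      refine ⟨hw, hP _ ?_, fun q v => ?_⟩
      · ext1 v
        exact (h5 w v).trans (hw0 v)
      · rw [D.fil_zero]
        trivial
    | succ k ih =>
      obtain ⟨a1, a2, a3⟩ := ih
      refine ⟨?_, ?_, ?_⟩
      · rw [hWs, map_sub, a1, hd, sub_zero]
      · rw [hWs, map_sub, a2, hPd, sub_zero]
      have e1 := h1 (W k)
      rw [a2, sub_zero] at e1
      -- Since `P (W k) = 0`, the homotopy formula replaces `W k`. What remains involves `H`, which
      -- raises the order, and the difference between `chevD A` and the constant-frame differential,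
      -- which preserves it. In the first term, `chevD A (W k) = 0` turns the constant-frame
      -- differential of `W k` into such a difference too.
      have e2 : W (k + 1) = H (actD (D.constField b) (W k)) -
          (chevD A (H (W k)) - actD (D.constField b) (H (W k))) := by
        rw [hWs, sub_sub_eq_add_sub, add_comm, e1]
      rw [e2]
      refine sub_mem (h2 k _ ?_) (hdiff _ _ (h2 k _ a3))
      have := hdiff k _ a3
      rw [a1, zero_sub] at this
      simpa using neg_mem this
  -- The sum of the partial primitives `H (W k)`, of order at least `k + 1`, converges in the
  -- filtration.
  let u : Forms R L M := fun q =>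
    D.sum.compAlternatingMap (AlternatingMap.pi fun k => H (W k) q)
  have hu : ∀ N, u - ∑ k ∈ Finset.range N, H (W k) ∈ formSub L (D.fil N) := by
    intro N q v
    have := D.sum_mem (fun k => H (W k) q v)
      (fun k => D.fil_succ_le k (h2 k _ (hWT k).2.2 q v)) N
    have e : (u - ∑ k ∈ Finset.range N, H (W k)) q v =
        D.sum (fun k => H (W k) q v) - ∑ k ∈ Finset.range N, H (W k) q v := by
      rw [Pi.sub_apply, AlternatingMap.sub_apply]
      congr 1
      clear this
      induction N with
      | zero => simp
      | succ N ih =>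
        rw [Finset.sum_range_succ, Finset.sum_range_succ, Pi.add_apply,
          AlternatingMap.add_apply, ih]
    rwa [e]
  have hsum : ∀ N, chevD A (∑ k ∈ Finset.range N, H (W k)) = w - W N := by
    intro N
    induction N with
    | zero => simp [hW0]
    | succ N ih =>
      rw [Finset.sum_range_succ, map_add, ih, hWs]
      abel
  refine ⟨u, sub_eq_zero.mp ?_⟩
  -- The differential lowers the order by at most one, so cutting the sum at `N + 1` terms changes
  -- `chevD A u` only in order `N`; the truncated sum misses `w` by `W (N + 1)`.
  have hN : ∀ N, chevD A u - w ∈ formSub L (D.fil N) := by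
    intro N
    have e1 := hdN N _ (hu (N + 1))
    rw [map_sub, hsum] at e1
    have e2 := sub_mem e1 (hle N (hWT (N + 1)).2.2)
    have e3 : chevD A u - w = chevD A u - (w - W (N + 1)) - W (N + 1) := by abel
    rw [e3]
    exact e2
  funext q
  ext1 v
  exact D.separated _ fun N => hN N q v

end Exactness

end FGL

end

/-! ### Exactness of the columns, and differentials squaring to zero. -/

section

open MvPowerSeries

namespace FGL

/-- The calculus of divided power series in the variables `s`. -/
noncomputable def dpPoincare (R K : Type*) {σ ι : Type*} [CommRing R] [Field K] [CharZero K]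
    [Algebra R K] [Fintype σ] {s : ι → σ} (hs : Function.Injective s) :
    PoincareData R (dpSeries R K σ) ι where
  deriv j := dpDeriv (s j)
  int j := dpInt (s j)
  ev j := dpEval (s j)
  fil := dpOrder R K σ
  sum := dpSum
  deriv_comm i j f := dpDeriv_comm _ _ f
  deriv_int_self j f := dpDeriv_dpInt_self _ f
  int_deriv_self j f := dpInt_dpDeriv_self _ f
  deriv_int_of_ne j k f h := dpDeriv_dpInt_of_ne (hs.ne h) f
  deriv_mem _ j _ hf := dpDeriv_mem_dpOrder hf _
  int_mem _ j _ hf := dpInt_mem_dpOrder hf _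
  ev_mem _ j _ hf := dpEval_mem_dpOrder hf _
  fil_zero := by
    rw [eq_top_iff]
    exact fun f _ e he => absurd he (Nat.not_lt_zero _)
  fil_succ_le N f hf e he := hf e (by omega)
  separated _ hf := eq_zero_of_mem_dpOrder hf
  sum_mem _ hg N := dpSum_sub_mem_dpOrder hg N

theorem foldr_dpEval_eq_zero {R K σ ι : Type*} [CommRing R] [Field K] [CharZero K]
    [Algebra R K] [Fintype σ] (s : ι → σ) (l : List ι) (f : dpSeries R K σ)
    (hf : ∀ e : σ →₀ ℕ, (∀ j ∈ l, e (s j) = 0) → coeff e (f : MvPowerSeries σ K) = 0) :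
    l.foldr (fun j => dpEval (s j)) f = 0 := by
  have key : ∀ e : σ →₀ ℕ, coeff e ((l.foldr (fun j => dpEval (s j)) f : dpSeries R K σ) : MvPowerSeries σ K) ≠ 0 →
      (∀ j ∈ l, e (s j) = 0) ∧
        coeff e ((l.foldr (fun j => dpEval (s j)) f : dpSeries R K σ) : MvPowerSeries σ K) =
          coeff e (f : MvPowerSeries σ K) := by
    clear hf
    intro e
    induction l with
    | nil => simp
    | cons j l ih =>
      rw [List.foldr_cons, coeff_dpEval]
      split_ifs with h
      · intro he
        obtain ⟨a1, a2⟩ := ih he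
        exact ⟨by simpa [h] using a1, a2⟩
      · exact fun h => absurd rfl h
  refine dpSeries_ext fun e => ?_
  by_contra hne
  have hne' : coeff e ((l.foldr (fun j => dpEval (s j)) f : dpSeries R K σ) : MvPowerSeries σ K) ≠ 0 := by
    simpa using hne
  obtain ⟨a1, a2⟩ := key e hne'
  exact hne' (a2.trans (hf e a1))

theorem coeff_mul_eq_zero {K σ : Type*} [CommRing K] {g f : MvPowerSeries σ K}
    (hg : constantCoeff g = 0) {N : ℕ}
    (hf : ∀ e : σ →₀ ℕ, e.degree < N → coeff e f = 0) {e : σ →₀ ℕ} (he : e.degree < N + 1) :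
    coeff e (g * f) = 0 := by
  refine coeff_of_lt_order (lt_of_lt_of_le ?_ le_order_mul)
  have h1 : (1 : ℕ∞) ≤ g.order := one_le_order_iff_constCoeff_eq_zero.mpr hg
  have h2 : (N : ℕ∞) ≤ f.order := nat_le_order hf
  refine lt_of_lt_of_le ?_ (add_le_add h1 h2)
  rw [add_comm]
  exact_mod_cast he

end FGL

namespace FormalGroupLaw

open FGL

variable {R : Type*} [CommRing R] [IsDomain R] [CharZero R] {m : ℕ} (G : FormalGroupLaw R m)

instance (n : ℕ) : Module.IsTorsionFree R (G.Cochain n) where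
  isSMulRegular r hr f g h := by
    refine dpSeries_ext fun e => ?_
    have h' := congrArg (fun a : G.Cochain n =>
      coeff e (a : MvPowerSeries (Fin n × Fin m) (FractionRing R))) h
    simp only [coeff_smul_dpSeries, Algebra.smul_def] at h'
    refine mul_left_cancel₀ ?_ h'
    exact (map_ne_zero_iff _ (IsFractionRing.injective R (FractionRing R))).mpr hr.ne_zero

/-- The standard basis of the Lie algebra. -/
noncomputable def basis : Module.Basis (Fin m) R G.LieAlg := Pi.basisFun R (Fin m)

/-- The calculus in the last block of variables. -/
noncomputable def lastPoincare (n : ℕ) : PoincareData R (G.Cochain (n + 1)) (Fin m) :=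
  dpPoincare R (FractionRing R) (s := fun j : Fin m => (Fin.last n, j)) fun i j h => by simpa using h

/-- At the origin the left-invariant frame is the coordinate frame, so the coefficients of the
difference have no constant term. Multiplying by them regains the order lost by differentiating.
This is the perturbation hypothesis of `PoincareData.exists_chevD_eq`. -/
theorem lastAction_sub_constField_mem {n N : ℕ} (x : G.LieAlg) {f : G.Cochain (n + 1)}
    (hf : f ∈ dpOrder R (FractionRing R) (Fin (n + 1) × Fin m) N) :
    G.lastAction (n + 1) x f - (G.lastPoincare n).constField G.basis x f ∈
      dpOrder R (FractionRing R) (Fin (n + 1) × Fin m) N := by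
  rcases N with _ | N
  · exact fun e he => absurd he (Nat.not_lt_zero _)
  intro e he
  have hc : ∀ l j : Fin m, constantCoeff
      ((G.vf (fun k => (X (Fin.last n, k) : MvPowerSeries (Fin (n + 1) × Fin m) R)) l j).map
        (algebraMap R (FractionRing R)) - C (if l = j then 1 else 0)) = 0 := by
    intro l j
    rw [map_sub, constantCoeff_map, constantCoeff_vf (by simp), constantCoeff_C]
    split_ifs <;> simp
  have h1 : ((G.lastAction (n + 1) x f - (G.lastPoincare n).constField G.basis x f :
      G.Cochain (n + 1)) : MvPowerSeries (Fin (n + 1) × Fin m) (FractionRing R)) =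
      ∑ l, (show Fin m → R from x) l • ∑ j,
        ((G.vf (fun k => (X (Fin.last n, k) : MvPowerSeries (Fin (n + 1) × Fin m) R)) l j).map
          (algebraMap R (FractionRing R)) - C (if l = j then 1 else 0)) *
            pderiv (FractionRing R) (Fin.last n, j) (f : MvPowerSeries _ (FractionRing R)) := by
    rw [Submodule.coe_sub, lastAction_succ, coe_lieAction, PoincareData.constField_apply,
      Submodule.coe_sum, ← Finset.sum_sub_distrib]
    refine Finset.sum_congr rfl fun l _ => ?_
    rw [opBasis_apply, Submodule.coe_smul]
    have h2 : G.basis.coord l x = (show Fin m → R from x) l :=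
      Pi.basisFun_repr R (Fin m) (show Fin m → R from x) l
    rw [h2, ← smul_sub]
    congr 1
    simp only [sub_mul, Finset.sum_sub_distrib]
    congr 1
    rw [Finset.sum_eq_single l]
    · rw [if_pos rfl, map_one, one_mul]
      rfl
    · intro j _ hj
      rw [if_neg hj.symm, map_zero, zero_mul]
    · simp
  rw [h1, map_sum]
  refine Finset.sum_eq_zero fun l _ => ?_
  rw [Algebra.smul_def, MvPowerSeries.algebraMap_apply, coeff_C_mul, map_sum,
    Finset.sum_eq_zero, mul_zero]
  intro j _
  exact coeff_mul_eq_zero (hc l j) (fun e' he' => dpDeriv_mem_dpOrder hf (Fin.last n, j) e' he') he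

theorem dpDeriv_restr {n : ℕ} (i : Fin n) (j : Fin m) (f : G.Cochain (n + 1)) :
    dpDeriv (i, j) (G.restr n f) = G.restr n (dpDeriv (i.castSucc, j) f) := by
  ext1
  have hs := hasSubst_map (R := R) (m := m) (constantCoeff_restrVar (n := n))
  rw [coe_dpDeriv, restr, coe_substCochain, coe_substCochain, chain_rule hs,
    Finset.sum_eq_single (i.castSucc, j)]
  · rw [restrVar_of_lt (by simp), ← map_pderiv]
    change _ * map _ (pderiv R (i, j) (X (i, j))) = _
    rw [pderiv_X_self, map_one, mul_one]
    rfl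
  · intro p _ hp
    rw [← map_pderiv]
    by_cases h : (p.1 : ℕ) < n
    · rw [restrVar_of_lt h, pderiv_X_of_ne, map_zero, mul_zero]
      intro he
      refine hp (Prod.ext (Fin.ext ?_) ?_)
      · simpa [Fin.ext_iff] using congrArg (fun q => (q.1 : ℕ)) he
      · simpa using congrArg Prod.snd he
    · rw [restrVar_of_eq (by omega), map_zero, map_zero, mul_zero]
  · simp

theorem constantCoeff_restr {n : ℕ} (f : G.Cochain (n + 1)) :
    constantCoeff (G.restr n f : MvPowerSeries (Fin n × Fin m) (FractionRing R)) =
      constantCoeff (f : MvPowerSeries (Fin (n + 1) × Fin m) (FractionRing R)) := by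
  rw [← algebraMap_counit, counit_restr, algebraMap_counit]

/-- By induction on the degree: a variable outside the last block is removed by differentiating,
which commutes with restriction, and the remaining integer factor is invertible in the fraction
field. -/
theorem coeff_eq_zero_of_restr_eq_zero {n : ℕ} {f : G.Cochain (n + 1)} (hf : G.restr n f = 0)
    {e : Fin (n + 1) × Fin m →₀ ℕ} (he : ∀ j, e (Fin.last n, j) = 0) :
    coeff e (f : MvPowerSeries (Fin (n + 1) × Fin m) (FractionRing R)) = 0 := by
  induction hN : e.degree generalizing e f with
  | zero =>
    rw [Finsupp.degree_eq_zero_iff] at hN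
    subst hN
    have := G.constantCoeff_restr f
    rw [hf] at this
    simpa using this.symm
  | succ N ih =>
    obtain ⟨⟨i, j⟩, hi⟩ : ∃ i, e i ≠ 0 := by
      by_contra! hc
      have : e = 0 := Finsupp.ext hc
      simp [this] at hN
    obtain ⟨e, rfl⟩ : ∃ e', e = e' + Finsupp.single (i, j) 1 :=
      ⟨_, (tsub_add_cancel_of_le (Finsupp.single_le_iff.mpr (by omega))).symm⟩
    have hil : i ≠ Fin.last n := by
      rintro rfl
      exact hi (he j)
    obtain ⟨i, rfl⟩ := Fin.exists_castSucc_eq.mpr hil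
    have h1 := ih (f := dpDeriv (i.castSucc, j) f) (e := e)
      (by rw [← dpDeriv_restr, hf, map_zero])
      (fun k => by have := he k; rw [Finsupp.add_apply] at this; omega)
      (by rw [map_add, Finsupp.degree_single] at hN; omega)
    rw [coeff_dpDeriv] at h1
    exact (mul_eq_zero.mp h1).resolve_right (Nat.cast_add_one_ne_zero _)

/-- The Chevalley-Eilenberg differential of forms with values in cochains. -/
noncomputable def formD (n : ℕ) : Forms R G.LieAlg (G.Cochain n) →ₗ[R]
    Forms R G.LieAlg (G.Cochain n) := chevD (G.lastAction n)

theorem formD_formD {n : ℕ} (w : Forms R G.LieAlg (G.Cochain n)) :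
    G.formD n (G.formD n w) = 0 :=
  chevD_chevD _ (fun x y f => G.lastAction_bracket x y f) w

/-- The other blocks are parameters, so the only obstruction is the value of the degree zero part
where the last block vanishes. -/
theorem exists_formD_eq {n : ℕ} {w : Forms R G.LieAlg (G.Cochain (n + 1))}
    (hw : G.formD (n + 1) w = 0) (hw0 : ∀ v, G.restr n (w 0 v) = 0) :
    ∃ u, G.formD (n + 1) u = w :=
  (G.lastPoincare n).exists_chevD_eq G.basis (fun x y f => G.lastAction_bracket x y f)
    (fun _ x _ hf => G.lastAction_sub_constField_mem x hf) hw fun v =>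
      foldr_dpEval_eq_zero (fun j : Fin m => (Fin.last n, j)) _ _ fun _ he =>
        G.coeff_eq_zero_of_restr_eq_zero (hw0 v) fun j => he j (by simp)

theorem trivD_eq_zero_of_mem_homogForm_zero {L M : Type*} [LieRing L] [LieAlgebra R L]
    [AddCommGroup M] [Module R M] [Module.IsTorsionFree R M] {w : Forms R L M}
    (h : w ∈ homogForm R L M 0) : trivD w = 0 := by
  funext q
  by_cases hq : q = 1
  · subst hq; rfl
  · exact trivD_mem_homogForm h q hq

/-- Derivations in the last block kill whatever does not depend on it, so only the bracket part of
the differential remains. -/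
theorem formD_mapForm_incl {n : ℕ} (w : Forms R G.LieAlg (G.Cochain n)) :
    G.formD (n + 1) (mapForm (G.incl n) w) = mapForm (G.incl n) (trivD w) := by
  rw [formD, ← chevD_zero]
  exact (mapForm_chevD_comm _ _ _ (fun x f => by simp [lastAction_incl]) w).symm

/-- Closed forms of degree zero do not depend on the last block of variables. -/
theorem eq_mapForm_incl_of_formD_eq_zero {n : ℕ} {w : Forms R G.LieAlg (G.Cochain (n + 1))}
    (hh : w ∈ homogForm R G.LieAlg (G.Cochain (n + 1)) 0) (hw : G.formD (n + 1) w = 0) :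
    w = mapForm (G.incl n) (mapForm (G.restr n) w) := by
  have h0 : trivD (mapForm (G.restr n) w) = 0 :=
    trivD_eq_zero_of_mem_homogForm_zero (mapForm_mem_homogForm _ hh)
  -- The difference is closed and restricts to zero, hence is exact; but exact forms have no degree
  -- zero part, and the difference lives in degree zero.
  obtain ⟨u, hu⟩ := G.exists_formD_eq
    (w := w - mapForm (G.incl n) (mapForm (G.restr n) w))
    (by rw [map_sub, hw, formD_mapForm_incl, h0, map_zero, sub_zero])
    (fun v => by
      rw [Pi.sub_apply, AlternatingMap.sub_apply, map_sub, mapForm_apply, restr_incl,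
        mapForm_apply, sub_self])
  refine sub_eq_zero.mp ?_
  have h1 : w - mapForm (G.incl n) (mapForm (G.restr n) w) ∈
      homogForm R G.LieAlg (G.Cochain (n + 1)) 0 :=
    sub_mem hh (mapForm_mem_homogForm _ (mapForm_mem_homogForm _ hh))
  funext q
  by_cases hq : q = 0
  · subst hq
    rw [← hu]
    simp [formD, chevD_apply]
  · exact h1 q hq

/-- A formal function is determined by the restrictions to `t_last = 0` of its iterated derivatives
along a frame. In the induction on the order, the coordinate derivative differs from the invariant
one by an element of order `N`, so it has order `N` itself and controls the next coefficients. -/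
theorem eq_zero_of_stable {n : ℕ} (P : Set (G.Cochain (n + 1))) (h0 : ∀ f ∈ P, G.restr n f = 0)
    (h1 : ∀ f ∈ P, ∀ x, G.lastAction (n + 1) x f ∈ P) {f : G.Cochain (n + 1)} (hf : f ∈ P) :
    f = 0 := by
  refine eq_zero_of_mem_dpOrder fun N => ?_
  induction N generalizing f with
  | zero => exact fun e he => absurd he (Nat.not_lt_zero _)
  | succ N ih =>
    intro e he
    by_cases hej : ∀ j, e (Fin.last n, j) = 0
    · exact G.coeff_eq_zero_of_restr_eq_zero (h0 f hf) hej
    · push Not at hej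
      obtain ⟨j, hj⟩ := hej
      obtain ⟨e, rfl⟩ : ∃ e', e = e' + Finsupp.single (Fin.last n, j) 1 :=
        ⟨_, (tsub_add_cancel_of_le (Finsupp.single_le_iff.mpr (by omega))).symm⟩
      have h2 := sub_mem (ih (h1 f hf (G.basis j)))
        (G.lastAction_sub_constField_mem (G.basis j) (ih hf))
      rw [sub_sub_cancel, PoincareData.constField_basis] at h2
      have h3 := h2 e (by rw [map_add, Finsupp.degree_single] at he; omega)
      have h4 := (coeff_dpDeriv (Fin.last n, j) f e).symm.trans h3
      exact (mul_eq_zero.mp h4).resolve_right (Nat.cast_add_one_ne_zero _)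

/-- This replaces the cosimplicial identities: the square commutes with the invariant derivations,
and `restr_transD_succ` reduces its restriction to the square one step lower, so `eq_zero_of_stable`
applies to its range. -/
theorem transD_transD {n : ℕ} (f : G.Cochain n) : G.transD (n + 1) (G.transD n f) = 0 := by
  induction n with
  | zero =>
    refine G.eq_zero_of_stable (Set.range fun f => G.transD 1 (G.transD 0 f)) ?_ ?_ ⟨f, rfl⟩
    · rintro _ ⟨f, rfl⟩
      dsimp only
      rw [restr_transD_succ, restr_transD_zero]
      module
    · rintro _ ⟨f, rfl⟩ x
      exact ⟨G.lastAction _ x f, by simp only [transD_lastAction]⟩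
  | succ n ih =>
    refine G.eq_zero_of_stable
      (Set.range fun f => G.transD (n + 1 + 1) (G.transD (n + 1) f)) ?_ ?_ ⟨f, rfl⟩
    · rintro _ ⟨f, rfl⟩
      dsimp only
      rw [restr_transD_succ, restr_transD_succ, map_add, ih, map_smul, pow_succ (-1 : R) (n + 1)]
      module
    · rintro _ ⟨f, rfl⟩ x
      exact ⟨G.lastAction _ x f, by simp only [transD_lastAction]⟩

theorem cobarD_cobarD {n : ℕ} (f : G.Cochain n) : G.cobarD (n + 1) (G.cobarD n f) = 0 := by
  refine G.incl_injective _ ?_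
  rw [← transD_incl, ← transD_incl, transD_transD, map_zero]

end FormalGroupLaw

end

section

open MvPowerSeries

namespace FGL

/-! ### Expansion of an antisymmetrisation along the last argument. -/

section Alternatization

open Equiv

/-- The permutation sending the last index to `i` and permuting the others by `τ`. -/
def permLast {n : ℕ} (p : Fin (n + 1) × Perm (Fin n)) : Perm (Fin (n + 1)) :=
  p.1.cycleRange⁻¹ * Perm.decomposeFin.symm (0, p.2) * finRotate (n + 1)

theorem permLast_last {n : ℕ} (p : Fin (n + 1) × Perm (Fin n)) :
    permLast p (Fin.last n) = p.1 := by
  simp [permLast, Perm.mul_apply, Perm.inv_def]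

theorem permLast_castSucc {n : ℕ} (p : Fin (n + 1) × Perm (Fin n)) (k : Fin n) :
    permLast p k.castSucc = p.1.succAbove (p.2 k) := by
  simp [permLast, Perm.mul_apply, Perm.inv_def]

/-- The rotation bringing the last index to the front contributes `(-1) ^ n`, and the cycle moving
it to position `p.1` contributes `(-1) ^ p.1`. -/
theorem sign_permLast {n : ℕ} (p : Fin (n + 1) × Perm (Fin n)) :
    Perm.sign (permLast p) = (-1) ^ n * ((-1) ^ (p.1 : ℕ) * Perm.sign p.2) := by
  rw [permLast, Perm.sign_mul, Perm.sign_mul, Perm.sign_inv, Fin.sign_cycleRange, sign_finRotate,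
    mul_comm]
  simp

theorem permLast_bijective (n : ℕ) :
    Function.Bijective (permLast : Fin (n + 1) × Perm (Fin n) → Perm (Fin (n + 1))) := by
  rw [Fintype.bijective_iff_injective_and_card]
  constructor
  · intro p q h
    have h1 : p.1 = q.1 := by rw [← permLast_last p, h, permLast_last]
    refine Prod.ext h1 (Equiv.ext fun k => ?_)
    have h2 := permLast_castSucc p k
    rw [h, permLast_castSucc, h1] at h2
    exact (Fin.succAbove_right_injective h2).symm
  · simp [Fintype.card_perm, Nat.factorial_succ]

/-- Expansion of an alternatization along the last argument. -/
theorem alternatization_succ_apply {R L : Type*} [CommRing R] [AddCommGroup L] [Module R L] {n : ℕ}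
    (A : MultilinearMap R (fun _ : Fin (n + 1) => L) R)
    (E : L → MultilinearMap R (fun _ : Fin n => L) R)
    (h : ∀ v, A v = E (v (Fin.last n)) (fun i => v i.castSucc)) (v : Fin (n + 1) → L) :
    MultilinearMap.alternatization A v = (-1 : ℤ) ^ n • ∑ i : Fin (n + 1), (-1 : ℤ) ^ (i : ℕ) •
      MultilinearMap.alternatization (E (v i)) (i.removeNth v) := by
  rw [MultilinearMap.alternatization_apply,
    ← (Equiv.ofBijective _ (permLast_bijective n)).sum_comp, Fintype.sum_prod_type, Finset.smul_sum]
  refine Finset.sum_congr rfl fun i _ => ?_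
  rw [MultilinearMap.alternatization_apply, Finset.smul_sum, Finset.smul_sum]
  refine Finset.sum_congr rfl fun τ _ => ?_
  rw [Equiv.ofBijective_apply, sign_permLast, MultilinearMap.domDomCongr_apply, h,
    MultilinearMap.domDomCongr_apply, permLast_last]
  simp only [permLast_castSucc, Units.smul_def, Units.val_pow_eq_pow_val,
    Units.val_neg, Units.val_one, mul_smul]
  rfl

end Alternatization

/-! ### Forms of degree zero and homogeneous components. -/

section Forms

variable {R L M M' : Type*} [CommRing R] [AddCommGroup L] [Module R L] [AddCommGroup M] [Module R M]
  [AddCommGroup M'] [Module R M']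

variable (R L M) in
/-- Elements of the coefficient module as forms of degree zero. -/
def constForm : M →ₗ[R] Forms R L M :=
  LinearMap.single R (fun q => L [⋀^Fin q]→ₗ[R] M) 0 ∘ₗ
    (AlternatingMap.constLinearEquivOfIsEmpty (R' := R) (ι := Fin 0)).toLinearMap

theorem constForm_apply (f : M) :
    constForm R L M f = Pi.single 0 (AlternatingMap.constOfIsEmpty R L (Fin 0) f) := rfl

theorem constForm_zero_apply (f : M) (v : Fin 0 → L) : constForm R L M f 0 v = f := by
  rw [constForm_apply, Pi.single_eq_same]
  rfl

theorem constForm_mem_homogForm (f : M) : constForm R L M f ∈ homogForm R L M 0 :=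
  single_mem_homogForm _ _

theorem mapForm_constForm (g : M →ₗ[R] M') (f : M) :
    mapForm g (constForm R L M f) = constForm R L M' (g f) := by
  rw [constForm_apply, mapForm_single]
  rfl

theorem eq_constForm {w : Forms R L M} (h : w ∈ homogForm R L M 0) :
    w = constForm R L M (w 0 ![]) := by
  rw [eq_single_of_mem_homogForm h, constForm_apply, Pi.single_eq_same]
  congr 1
  ext v
  rw [Subsingleton.elim v ![]]
  rfl

theorem constForm_injective : Function.Injective (constForm R L M) := by
  intro f g h
  rw [← constForm_zero_apply (R := R) (L := L) f ![], h, constForm_zero_apply]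

theorem actD_zero (w : Forms R L M) : actD (0 : L →ₗ[R] M →ₗ[R] M) w = 0 := by
  rw [← sub_self (0 : L →ₗ[R] M →ₗ[R] M), actD_sub, sub_self]

end Forms

section LieForms

variable {R L M : Type*} [CommRing R] [LieRing L] [LieAlgebra R L] [AddCommGroup M] [Module R M]
  [IsDomain R] [CharZero R] [Module.IsTorsionFree R M]

theorem chevD_zero_apply (A : L →ₗ[R] M →ₗ[R] M) (w : Forms R L M) : chevD A w 0 = 0 := by
  simp [chevD_apply]

/-- A primitive found in the product of all degrees may be inhomogeneous. As the differential raises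
the degree by exactly one, its component in degree `q` is already a primitive. -/
theorem chevD_single (A : L →ₗ[R] M →ₗ[R] M) {q : ℕ} {w : Forms R L M}
    (hw : chevD A w ∈ homogForm R L M (q + 1)) :
    chevD A (Pi.single q (w q)) = chevD A w := by
  have h1 := chevD_mem_homogForm A (single_mem_homogForm q (w q))
  funext q'
  by_cases hq : q' = q + 1
  · subst hq
    have h0 : (w - Pi.single q (w q) : Forms R L M) q = 0 := by simp
    have h2 : chevD A (w - Pi.single q (w q)) (q + 1) = 0 := by
      ext v
      rw [chevD_apply, Pi.add_apply, AlternatingMap.add_apply, actD_succ]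
      rcases q with _ | q
      · simp [h0]
      · rw [trivD_apply]
        simp only [ceSum, h0, AlternatingMap.zero_apply, map_zero, smul_zero,
          Finset.sum_const_zero, add_zero]
    rw [map_sub, Pi.sub_apply, sub_eq_zero] at h2
    exact h2.symm
  · rw [h1 q' hq, hw q' hq]

theorem trivD_single {q : ℕ} {w : Forms R L M} (hw : trivD w ∈ homogForm R L M (q + 1)) :
    trivD (Pi.single q (w q)) = trivD w := by
  rw [← chevD_zero] at hw ⊢
  exact chevD_single 0 hw

theorem trivD_trivD (w : Forms R L M) : trivD (trivD w) = 0 := by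
  rw [← chevD_zero]
  exact chevD_chevD 0 (by simp) w

theorem trivD_single_eq (n : ℕ) (ω : L [⋀^Fin n]→ₗ[R] R) :
    trivD (Pi.single n ω : Forms R L R) = Pi.single (n + 1) (ceD R L n ω) := by
  rw [eq_single_of_mem_homogForm (trivD_mem_homogForm (single_mem_homogForm n ω)), trivD_eq_ceD,
    Pi.single_eq_same]

theorem ceD_ceD (n : ℕ) (ω : L [⋀^Fin n]→ₗ[R] R) : ceD R L (n + 1) (ceD R L n ω) = 0 := by
  have := congrFun (trivD_trivD (Pi.single n ω : Forms R L R)) (n + 2)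
  rwa [trivD_eq_ceD, trivD_eq_ceD, Pi.single_eq_same] at this

theorem trivD_apply_mem_coboundaries (η : Forms R L R) (n : ℕ) :
    trivD η n ∈ coboundaries (C := fun n => L [⋀^Fin n]→ₗ[R] R) (ceD R L) n := by
  rcases n with _ | n
  · exact zero_mem _
  · rw [trivD_eq_ceD]
    exact ⟨_, rfl⟩

theorem single_mem_range_trivD {n : ℕ} {ω : L [⋀^Fin n]→ₗ[R] R}
    (h : ω ∈ coboundaries (C := fun n => L [⋀^Fin n]→ₗ[R] R) (ceD R L) n) :
    (Pi.single n ω : Forms R L R) ∈ LinearMap.range (trivD : Forms R L R →ₗ[R] Forms R L R) := by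
  rcases n with _ | n
  · obtain rfl : ω = 0 := h
    simp
  · obtain ⟨η, rfl⟩ := h
    exact ⟨_, trivD_single_eq n η⟩

end LieForms

end FGL

/-! ### The comparison map extended to the double complex. -/

namespace FormalGroupLaw

open FGL

variable {R : Type*} [CommRing R] [IsDomain R] [CharZero R] {m : ℕ} (G : FormalGroupLaw R m)

attribute [local instance] LieRing.ofAssociativeRing

theorem formD_mapForm_transD {n : ℕ} (w : Forms R G.LieAlg (G.Cochain n)) :
    G.formD (n + 1) (mapForm (G.transD n) w) = mapForm (G.transD n) (G.formD n w) :=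
  (mapForm_chevD_comm _ _ _ (fun x f => G.transD_lastAction x f) w).symm

theorem mapForm_transD_transD {n : ℕ} (w : Forms R G.LieAlg (G.Cochain n)) :
    mapForm (G.transD (n + 1)) (mapForm (G.transD n) w) = 0 := by
  funext q
  ext1 v
  exact G.transD_transD _

theorem mapForm_restr_transD_zero (w : Forms R G.LieAlg (G.Cochain 0)) :
    mapForm (G.restr 0) (mapForm (G.transD 0) w) = w := by
  funext q
  ext1 v
  exact G.restr_transD_zero _

theorem mapForm_restr_transD_succ {n : ℕ} (w : Forms R G.LieAlg (G.Cochain (n + 1))) :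
    mapForm (G.restr (n + 1)) (mapForm (G.transD (n + 1)) w) =
      mapForm (G.transD n) (mapForm (G.restr n) w) + (-1 : R) ^ (n + 1) • w := by
  funext q
  ext1 v
  exact G.restr_transD_succ _

theorem neg_one_pow_smul_smul {M : Type*} [AddCommGroup M] [Module R M] (n : ℕ) (a : M) :
    (-1 : R) ^ n • (-1 : R) ^ n • a = a := by
  rw [smul_smul, ← mul_pow, neg_one_mul, neg_neg, one_pow, one_smul]

theorem eq_transD_of_transD_eq_zero {n : ℕ} {w : Forms R G.LieAlg (G.Cochain (n + 1))}
    (hw : mapForm (G.transD (n + 1)) w = 0) :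
    w = (-1 : R) ^ n • mapForm (G.transD n) (mapForm (G.restr n) w) := by
  have h := G.mapForm_restr_transD_succ w
  rw [hw, map_zero, pow_succ, mul_neg, mul_one, neg_smul, ← sub_eq_add_neg, eq_comm,
    sub_eq_zero] at h
  rw [h, neg_one_pow_smul_smul]

/-- Restriction to the locus where the last block vanishes, followed by differentiation in the
preceding block. -/
noncomputable def stepMap (n : ℕ) : Forms R G.LieAlg (G.Cochain (n + 1)) →ₗ[R]
    Forms R G.LieAlg (G.Cochain n) :=
  actD (G.lastAction n) ∘ₗ mapForm (G.restr n)

theorem stepMap_apply {n : ℕ} (w : Forms R G.LieAlg (G.Cochain (n + 1))) :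
    G.stepMap n w = actD (G.lastAction n) (mapForm (G.restr n) w) := rfl

/-- The failure of `restr` to commute with `transD` is a multiple of the identity; followed by
differentiation it becomes the `actD` part of `formD`. -/
theorem stepMap_transD {n : ℕ} (w : Forms R G.LieAlg (G.Cochain (n + 1))) :
    G.stepMap (n + 1) (mapForm (G.transD (n + 1)) w) =
      mapForm (G.transD n) (G.stepMap n w) +
        (-1 : R) ^ (n + 1) • actD (G.lastAction (n + 1)) w := by
  rw [stepMap_apply, mapForm_restr_transD_succ, map_add, map_smul, stepMap_apply,
    mapForm_actD_comm _ _ _ (fun x f => G.transD_lastAction x f)]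

theorem formD_stepMap {n : ℕ} (w : Forms R G.LieAlg (G.Cochain (n + 1))) :
    G.formD n (G.stepMap n w) = - G.stepMap n (trivD w) := by
  rw [formD, chevD_apply, stepMap_apply,
    actD_actD_add _ (fun x y f => G.lastAction_bracket x y f), stepMap_apply, mapForm_trivD]
  abel

theorem stepMap_zero (w : Forms R G.LieAlg (G.Cochain 1)) : G.stepMap 0 w = 0 := actD_zero _

/-- The iteration of `stepMap`, restricted to the origin at the end. -/
noncomputable def evalMap : ∀ n : ℕ, Forms R G.LieAlg (G.Cochain (n + 1)) →ₗ[R]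
    Forms R G.LieAlg (G.Cochain 0)
  | 0 => mapForm (G.restr 0)
  | n + 1 => evalMap n ∘ₗ G.stepMap (n + 1)

theorem evalMap_zero (w : Forms R G.LieAlg (G.Cochain 1)) :
    G.evalMap 0 w = mapForm (G.restr 0) w := rfl

theorem evalMap_succ {n : ℕ} (w : Forms R G.LieAlg (G.Cochain (n + 2))) :
    G.evalMap (n + 1) w = G.evalMap n (G.stepMap (n + 1) w) := rfl

/-- At each stage `stepMap_transD` supplies the `actD` part of `formD`. The induction hypothesis
contributes `formD (stepMap w)`, which `formD_stepMap` turns into the missing `trivD` part with the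
right sign. The descent ends because `stepMap 0 = 0`. -/
theorem evalMap_transD {n : ℕ} (w : Forms R G.LieAlg (G.Cochain (n + 1))) :
    G.evalMap (n + 1) (mapForm (G.transD (n + 1)) w) =
      (-1 : R) ^ (n + 1) • G.evalMap n (G.formD (n + 1) w) + trivD (G.evalMap n w) := by
  induction n with
  | zero =>
    rw [evalMap_succ, stepMap_transD, stepMap_zero, map_zero, map_add, map_zero, map_smul, formD,
      chevD_apply, map_add, evalMap_zero, evalMap_zero, evalMap_zero, mapForm_trivD]
    module
  | succ n ih =>
    rw [evalMap_succ, stepMap_transD, map_add, map_smul, ih, formD_stepMap, map_neg, ← evalMap_succ,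
      ← evalMap_succ, formD, chevD_apply, map_add]
    module

theorem evalMap_congr {n : ℕ} {w w' : Forms R G.LieAlg (G.Cochain (n + 1))}
    (h : mapForm (G.restr n) w = mapForm (G.restr n) w') : G.evalMap n w = G.evalMap n w' := by
  rcases n with _ | n
  · exact h
  · rw [evalMap_succ, evalMap_succ, stepMap_apply, h, stepMap_apply]

/-- Differentiation inserts a second antisymmetrised vector in front of the one already inserted;
exchanging the two costs a sign by `uncurryForm_uncurryForm_flip`. -/
theorem stepMap_uncurryForm {n : ℕ} (g : G.LieAlg →ₗ[R] Forms R G.LieAlg (G.Cochain (n + 1))) :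
    G.stepMap n (uncurryForm g) = - uncurryForm (G.stepMap n ∘ₗ g) := by
  rw [stepMap_apply, mapForm_uncurryForm, actD_apply]
  have h1 : (mapForm ∘ₗ G.lastAction n).flip (uncurryForm (mapForm (G.restr n) ∘ₗ g)) =
      uncurryForm ∘ₗ ((mapForm ∘ₗ G.lastAction n).compl₂ (mapForm (G.restr n) ∘ₗ g) :
        G.LieAlg →ₗ[R] G.LieAlg →ₗ[R] Forms R G.LieAlg (G.Cochain n)) := by
    refine LinearMap.ext fun x => ?_
    exact mapForm_uncurryForm _ _
  rw [h1, uncurryForm_uncurryForm_flip]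
  rfl

theorem evalMap_uncurryForm {n : ℕ} (g : G.LieAlg →ₗ[R] Forms R G.LieAlg (G.Cochain (n + 1))) :
    G.evalMap n (uncurryForm g) = (-1 : R) ^ n • uncurryForm (G.evalMap n ∘ₗ g) := by
  induction n with
  | zero =>
    rw [pow_zero, one_smul]
    exact mapForm_uncurryForm _ _
  | succ n ih =>
    rw [evalMap_succ, stepMap_uncurryForm, map_neg, ih, pow_succ, mul_neg, mul_one, neg_smul]
    rfl

/-- The extension of the comparison map to forms with values in cochains. -/
noncomputable def cmpMap (n : ℕ) : Forms R G.LieAlg (G.Cochain (n + 1)) →ₗ[R]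
    Forms R G.LieAlg R := mapForm (G.counit 0) ∘ₗ G.evalMap n

theorem cmpMap_apply {n : ℕ} (w : Forms R G.LieAlg (G.Cochain (n + 1))) :
    G.cmpMap n w = mapForm (G.counit 0) (G.evalMap n w) := rfl

/-- For a form `u`, the images `δ u` and `formD u` are consecutive members of a zigzag; their values
under `cmpMap` agree up to sign and an exact form. -/
theorem cmpMap_transD {n : ℕ} (w : Forms R G.LieAlg (G.Cochain (n + 1))) :
    G.cmpMap (n + 1) (mapForm (G.transD (n + 1)) w) =
      (-1 : R) ^ (n + 1) • G.cmpMap n (G.formD (n + 1) w) + trivD (G.cmpMap n w) := by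
  rw [cmpMap_apply, evalMap_transD, map_add, map_smul, mapForm_trivD]
  rfl

/-- Cochains as forms which do not depend on the last block of variables. -/
noncomputable def embed (n : ℕ) : G.Cochain n →ₗ[R] Forms R G.LieAlg (G.Cochain (n + 1)) :=
  constForm R G.LieAlg (G.Cochain (n + 1)) ∘ₗ G.incl n

theorem embed_apply {n : ℕ} (f : G.Cochain n) :
    G.embed n f = constForm R G.LieAlg (G.Cochain (n + 1)) (G.incl n f) := rfl

/-- The first step turns `f` into the one-form `x ↦ x • f`, and the antisymmetrisation can be pulled
through the remaining steps. These see `x • f` only after its last block is set to zero, which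
permits replacing it by `embed n` of the restriction. -/
theorem cmpMap_embed_succ {n : ℕ} (f : G.Cochain (n + 1)) :
    G.cmpMap (n + 1) (G.embed (n + 1) f) = (-1 : R) ^ n •
      uncurryForm (G.cmpMap n ∘ₗ G.embed n ∘ₗ G.restr n ∘ₗ (G.lastAction (n + 1)).flip f) := by
  have h1 : G.stepMap (n + 1) (G.embed (n + 1) f) = uncurryForm
      (constForm R G.LieAlg (G.Cochain (n + 1)) ∘ₗ (G.lastAction (n + 1)).flip f) := by
    rw [stepMap_apply, embed_apply, mapForm_constForm, restr_incl, actD_apply]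
    congr 1
    refine LinearMap.ext fun x => ?_
    exact mapForm_constForm _ _
  rw [cmpMap_apply, evalMap_succ, h1, evalMap_uncurryForm, map_smul, mapForm_uncurryForm]
  congr 2
  refine LinearMap.ext fun x => ?_
  refine congrArg (mapForm (G.counit 0)) (G.evalMap_congr ?_)
  change mapForm (G.restr n) (constForm R G.LieAlg _ (G.lastAction (n + 1) x f)) =
    mapForm (G.restr n) (G.embed n (G.restr n (G.lastAction (n + 1) x f)))
  rw [embed_apply, mapForm_constForm, mapForm_constForm, restr_incl]

theorem restr_prod_lieAction {n : ℕ} (l : List (Fin n)) (v : Fin n → G.LieAlg)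
    (f : G.Cochain (n + 1)) :
    G.restr n ((l.map fun i => G.lieAction i.castSucc (v i)).prod f) =
      (l.map fun i => G.lieAction i (v i)).prod (G.restr n f) := by
  induction l with
  | nil => rfl
  | cons i l ih =>
    rw [List.map_cons, List.prod_cons, Module.End.mul_apply, ← lieAction_restr, ih,
      List.map_cons, List.prod_cons, Module.End.mul_apply]

/-- The restriction of `alphaStar` to the Lie algebra. -/
noncomputable def lieStar (n : ℕ) (f : G.Cochain n) :
    MultilinearMap R (fun _ : Fin n => G.LieAlg) R :=
  (G.alphaStar n f).compLinearMap
    (fun _ => (UniversalEnvelopingAlgebra.ι R : G.LieAlg →ₗ⁅R⁆ _).toLinearMap)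

theorem lieStar_apply {n : ℕ} (f : G.Cochain n) (v : Fin n → G.LieAlg) :
    G.lieStar n f v =
      G.counit n (((List.finRange n).map fun i => G.lieAction i (v i)).prod f) := by
  have h : ∀ i : Fin n, G.envAction i (UniversalEnvelopingAlgebra.ι R (v i)) =
      G.lieAction i (v i) := fun i => UniversalEnvelopingAlgebra.lift_ι_apply R _ _
  rw [← List.ofFn_eq_map]
  simp only [← h]
  rfl

theorem lieStar_succ_apply {n : ℕ} (f : G.Cochain (n + 1)) (v : Fin (n + 1) → G.LieAlg) :
    G.lieStar (n + 1) f v =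
      G.lieStar n (G.restr n (G.lastAction (n + 1) (v (Fin.last n)) f)) fun i => v i.castSucc := by
  rw [lieStar_apply, lieStar_apply, ← counit_restr, List.finRange_succ_last, List.map_append,
    List.prod_append, Module.End.mul_apply, List.map_map]
  rw [← restr_prod_lieAction]
  simp only [List.map_cons, List.map_nil, List.prod_cons, List.prod_nil, mul_one]
  rfl

theorem phi_apply {n : ℕ} (f : G.Cochain n) :
    G.phi n f = MultilinearMap.alternatization (G.lieStar n f) := rfl

/-- Both sides satisfy the same recursion: evaluating `α(x_1) ⊗ ⋯ ⊗ α(x_{n+1})` on `f` means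
differentiating in the last block, setting it to zero and continuing, and
`alternatization_succ_apply` expands the signs in the same way as `cmpMap_embed_succ`. -/
theorem cmpMap_embed {n : ℕ} (f : G.Cochain n) :
    G.cmpMap n (G.embed n f) = Pi.single n (G.phi n f) := by
  induction n with
  | zero =>
    rw [cmpMap_apply, evalMap_zero, embed_apply, mapForm_constForm, mapForm_constForm, restr_incl,
      constForm_apply]
    congr 1
    ext v
    rw [phi_apply, MultilinearMap.alternatization_apply]
    simp [lieStar_apply]
  | succ n ih =>
    rw [cmpMap_embed_succ]
    funext q
    by_cases hq : q = n + 1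
    · subst hq
      ext v
      rw [Pi.single_eq_same, phi_apply, alternatization_succ_apply _
        (fun x => G.lieStar n (G.restr n (G.lastAction (n + 1) x f)))
        (fun v => G.lieStar_succ_apply f v), Pi.smul_apply, AlternatingMap.smul_apply,
        uncurryForm_succ]
      simp only [LinearMap.comp_apply, ih, Pi.single_eq_same, LinearMap.flip_apply, phi_apply,
        zsmul_eq_mul, smul_eq_mul]
      push_cast
      rfl
    · rw [Pi.single_eq_of_ne hq]
      rcases q with _ | q
      · simp
      · ext v
        rw [Pi.smul_apply, AlternatingMap.smul_apply, uncurryForm_succ]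
        simp only [LinearMap.comp_apply, ih, Pi.single_eq_of_ne (show q ≠ n by omega)]
        simp

end FormalGroupLaw

end

/-! ### The zigzag between cochains and Lie algebra cochains. -/

section

open MvPowerSeries

namespace FormalGroupLaw

open FGL

variable {R : Type*} [CommRing R] [IsDomain R] [CharZero R] {m : ℕ} (G : FormalGroupLaw R m)

theorem mapForm_transD_embed {n : ℕ} (f : G.Cochain n) :
    mapForm (G.transD (n + 1)) (G.embed n f) = G.embed (n + 1) (G.cobarD n f) := by
  rw [embed_apply, embed_apply, mapForm_constForm, transD_incl]

theorem formD_embed {n : ℕ} (f : G.Cochain n) : G.formD (n + 1) (G.embed n f) = 0 := by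
  rw [embed_apply, ← mapForm_constForm, formD_mapForm_incl,
    trivD_eq_zero_of_mem_homogForm_zero (constForm_mem_homogForm f), map_zero]

theorem embed_injective (n : ℕ) : Function.Injective (G.embed n) :=
  constForm_injective.comp (G.incl_injective n)

/-- This is `cmpMap_transD` on `embed n f`: the vertical differential of `embed n f` vanishes, and
its horizontal differential is the embedded cobar differential. -/
theorem ceD_phi {n : ℕ} (f : G.Cochain n) :
    G.phi (n + 1) (G.cobarD n f) = ceD R G.LieAlg n (G.phi n f) := by
  have h := G.cmpMap_transD (G.embed n f)
  rw [mapForm_transD_embed, cmpMap_embed, formD_embed, map_zero, smul_zero, cmpMap_embed,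
    trivD_single_eq] at h
  have h1 := congrFun h (n + 1)
  rwa [Pi.single_eq_same, Pi.add_apply, Pi.single_eq_same, Pi.zero_apply, zero_add] at h1

/-- Closed forms of degree zero are cochains. -/
theorem exists_embed_eq {n : ℕ} {w : Forms R G.LieAlg (G.Cochain (n + 1))}
    (hh : w ∈ homogForm R G.LieAlg (G.Cochain (n + 1)) 0) (hw : G.formD (n + 1) w = 0) :
    ∃ f, G.embed n f = w := by
  have h := G.eq_mapForm_incl_of_formD_eq_zero hh hw
  rw [eq_constForm (mapForm_mem_homogForm (G.restr n) hh), mapForm_constForm] at h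
  exact ⟨_, h.symm⟩

/-- The Poincaré lemma in positive degrees. -/
theorem exists_homogForm_formD_eq {n q : ℕ} {w : Forms R G.LieAlg (G.Cochain (n + 1))}
    (hh : w ∈ homogForm R G.LieAlg (G.Cochain (n + 1)) (q + 1)) (hw : G.formD (n + 1) w = 0) :
    ∃ u ∈ homogForm R G.LieAlg (G.Cochain (n + 1)) q, G.formD (n + 1) u = w := by
  obtain ⟨u, rfl⟩ := G.exists_formD_eq hw fun v => by
    rw [hh 0 (Nat.succ_ne_zero q).symm, AlternatingMap.zero_apply, map_zero]
  exact ⟨_, single_mem_homogForm q (u q), chevD_single _ hh⟩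

/-- Each step trades one form degree for one block of variables: a closed form has a vertical
primitive `u`, and `δ u` is again closed for both differentials. The equation `N = n + q` is stated
separately so that no transport along it is needed. -/
theorem exists_cobarD_eq_zero (q : ℕ) : ∀ (n : ℕ) (w : Forms R G.LieAlg (G.Cochain (n + 1))),
    w ∈ homogForm R G.LieAlg (G.Cochain (n + 1)) q → G.formD (n + 1) w = 0 →
    mapForm (G.transD (n + 1)) w = 0 →
    ∃ (N : ℕ) (f : G.Cochain N) (k : ℕ) (η : Forms R G.LieAlg R), N = n + q ∧
      G.cobarD N f = 0 ∧ G.cmpMap N (G.embed N f) = (-1 : R) ^ k • G.cmpMap n w + trivD η := by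
  induction q with
  | zero =>
    intro n w hh hw hδ
    obtain ⟨f, rfl⟩ := G.exists_embed_eq hh hw
    refine ⟨n, f, 0, 0, rfl, ?_, ?_⟩
    · rw [mapForm_transD_embed] at hδ
      exact G.embed_injective _ (hδ.trans (map_zero _).symm)
    · rw [pow_zero, one_smul, map_zero, add_zero]
  | succ q ih =>
    intro n w hh hw hδ
    obtain ⟨u, hu, rfl⟩ := G.exists_homogForm_formD_eq hh hw
    obtain ⟨N, f, k, η, hN, hf, he⟩ := ih (n + 1) (mapForm (G.transD (n + 1)) u)
      (mapForm_mem_homogForm _ hu) (by rw [formD_mapForm_transD, hδ])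
      (G.mapForm_transD_transD u)
    refine ⟨N, f, k + (n + 1), (-1 : R) ^ k • G.cmpMap n u + η, by omega, hf, ?_⟩
    rw [he, cmpMap_transD, map_add, map_smul, pow_add]
    module

/-- The counit of constant cochains as an isomorphism. -/
noncomputable def counitEquiv : G.Cochain 0 ≃ₗ[R] R :=
  LinearEquiv.ofBijective (G.counit 0) G.counit_zero_bijective

theorem counit_counitEquiv_symm (r : R) : G.counit 0 (G.counitEquiv.symm r) = r :=
  G.counitEquiv.apply_symm_apply r

theorem counitEquiv_symm_counit (f : G.Cochain 0) : G.counitEquiv.symm (G.counit 0 f) = f :=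
  G.counitEquiv.symm_apply_apply f

theorem mapForm_counit_symm (w : Forms R G.LieAlg R) :
    mapForm (G.counit 0) (mapForm G.counitEquiv.symm.toLinearMap w) = w := by
  funext q
  ext1 v
  exact G.counit_counitEquiv_symm _

theorem mapForm_symm_counit (w : Forms R G.LieAlg (G.Cochain 0)) :
    mapForm G.counitEquiv.symm.toLinearMap (mapForm (G.counit 0) w) = w := by
  funext q
  ext1 v
  exact G.counitEquiv_symm_counit _

/-- Every Lie algebra cocycle is cohomologous to the image of a cocycle. -/
theorem exists_phi_sub_mem_coboundaries {n : ℕ} {ω : G.LieAlg [⋀^Fin n]→ₗ[R] R}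
    (hω : ceD R G.LieAlg n ω = 0) : ∃ f : G.Cochain n, G.cobarD n f = 0 ∧ G.phi n f - ω ∈
      coboundaries (C := fun n => G.LieAlg [⋀^Fin n]→ₗ[R] R) (ceD R G.LieAlg) n := by
  -- The cocycle is placed on the row augmentation edge, as a form with constant coefficients; its
  -- image under `transD 0` starts the zigzag.
  set v : Forms R G.LieAlg (G.Cochain 0) :=
    mapForm G.counitEquiv.symm.toLinearMap (Pi.single n ω) with hv
  have hc : G.cmpMap 0 (mapForm (G.transD 0) v) = Pi.single n ω := by
    rw [cmpMap_apply, evalMap_zero, mapForm_restr_transD_zero, hv, mapForm_counit_symm]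
  obtain ⟨N, f, k, η, hN, hf, he⟩ := G.exists_cobarD_eq_zero n 0 (mapForm (G.transD 0) v)
    (mapForm_mem_homogForm _ (mapForm_mem_homogForm _ (single_mem_homogForm n ω)))
    (by rw [transD_zero, formD_mapForm_incl, hv, ← mapForm_trivD, trivD_single_eq, hω,
      Pi.single_zero, map_zero, map_zero])
    (G.mapForm_transD_transD v)
  obtain rfl : N = n := by omega
  -- The factor undoes the sign accumulated along the zigzag.
  refine ⟨(-1 : R) ^ k • f, by rw [map_smul, hf, smul_zero], ?_⟩
  rw [cmpMap_embed, hc] at he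
  have h1 := congrFun he N
  rw [Pi.single_eq_same, Pi.add_apply, Pi.smul_apply, Pi.single_eq_same] at h1
  have h2 : (-1 : R) ^ k • G.phi N f - ω = (-1 : R) ^ k • trivD η N := by
    rw [h1, smul_add, sub_eq_iff_eq_add', add_left_inj]
    exact neg_one_pow_smul_smul k ω
  rw [map_smul, h2]
  exact Submodule.smul_mem _ _ (trivD_apply_mem_coboundaries η N)

/-- The forms which represent coboundaries under the zigzag between forms and cochains. -/
noncomputable def nullForm : ℕ → ∀ n : ℕ, Submodule R (Forms R G.LieAlg (G.Cochain (n + 1)))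
  | 0, n => (coboundaries (C := fun n => G.Cochain n) G.cobarD n).map (G.embed n)
  | q + 1, n => (homogForm R G.LieAlg (G.Cochain (n + 1)) q ⊓
      (nullForm q (n + 1)).comap (mapForm (G.transD (n + 1)))).map (G.formD (n + 1))

/-- In degree zero the form is an embedded cochain, so `δ` gives an embedded coboundary. In positive
degree it has a primitive `u`; then `δ u` is a primitive of its image, and `δ (δ u) = 0`. -/
theorem mapForm_transD_mem_nullForm {q n : ℕ} {w : Forms R G.LieAlg (G.Cochain (n + 1))}
    (hh : w ∈ homogForm R G.LieAlg (G.Cochain (n + 1)) q) (hw : G.formD (n + 1) w = 0) :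
    mapForm (G.transD (n + 1)) w ∈ G.nullForm q (n + 1) := by
  rcases q with _ | q
  · obtain ⟨f, rfl⟩ := G.exists_embed_eq hh hw
    rw [mapForm_transD_embed]
    exact Submodule.mem_map_of_mem ⟨f, rfl⟩
  · obtain ⟨u, hu, rfl⟩ := G.exists_homogForm_formD_eq hh hw
    rw [← formD_mapForm_transD]
    refine Submodule.mem_map_of_mem ⟨mapForm_mem_homogForm _ hu, ?_⟩
    change mapForm (G.transD (n + 2)) (mapForm (G.transD (n + 1)) u) ∈ G.nullForm q (n + 2)
    rw [mapForm_transD_transD]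
    exact zero_mem _

theorem mem_nullForm_zero {q : ℕ} {w : Forms R G.LieAlg (G.Cochain 1)}
    (hh : w ∈ homogForm R G.LieAlg (G.Cochain 1) q) (hδ : mapForm (G.transD 1) w = 0)
    (hc : G.cmpMap 0 w ∈ LinearMap.range (trivD : Forms R G.LieAlg R →ₗ[R] _)) :
    w ∈ G.nullForm q 0 := by
  obtain ⟨η, hη⟩ := hc
  have h1 := G.eq_transD_of_transD_eq_zero hδ
  rw [pow_zero, one_smul] at h1
  rw [cmpMap_apply, evalMap_zero] at hη
  have h2 : mapForm (G.restr 0) w = trivD (mapForm G.counitEquiv.symm.toLinearMap η) := by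
    rw [← mapForm_trivD, hη, mapForm_symm_counit]
  have h3 := mapForm_mem_homogForm (G.restr 0) hh
  rcases q with _ | q
  · have h4 : mapForm (G.restr 0) w = 0 := by
      rw [eq_single_of_mem_homogForm h3, h2, ← chevD_zero, chevD_zero_apply, Pi.single_zero]
    rw [h1, h4, map_zero]
    exact zero_mem _
  · rw [h2] at h3
    -- On constants `transD 0` is the inclusion, which turns `trivD` into `formD`. So `w` is the
    -- vertical differential of `δ` of a primitive on the augmentation edge.
    rw [h1, h2, ← trivD_single h3, transD_zero, ← formD_mapForm_incl, ← transD_zero]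
    refine Submodule.mem_map_of_mem ⟨mapForm_mem_homogForm _ (single_mem_homogForm q _), ?_⟩
    change mapForm (G.transD 1) (mapForm (G.transD 0) _) ∈ G.nullForm q 1
    rw [mapForm_transD_transD]
    exact zero_mem _

/-- By row exactness `w` is, up to sign, `δ v` with `v` its restriction. The form `formD v` lies one
block lower and one degree higher, and by `cmpMap_transD` its comparison value is still exact, so
induction on the number of blocks applies to it. -/
theorem mem_nullForm (n : ℕ) : ∀ (q : ℕ) (w : Forms R G.LieAlg (G.Cochain (n + 1))),
    w ∈ homogForm R G.LieAlg (G.Cochain (n + 1)) q → G.formD (n + 1) w = 0 →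
    mapForm (G.transD (n + 1)) w = 0 →
    G.cmpMap n w ∈ LinearMap.range (trivD : Forms R G.LieAlg R →ₗ[R] _) →
    w ∈ G.nullForm q n := by
  induction n with
  | zero => exact fun q w hh _ hδ hc => G.mem_nullForm_zero hh hδ hc
  | succ n ih =>
    intro q w hh hw hδ hc
    have h1 := G.eq_transD_of_transD_eq_zero hδ
    set v := mapForm (G.restr (n + 1)) w with hv
    have hvh : v ∈ homogForm R G.LieAlg (G.Cochain (n + 1)) q := mapForm_mem_homogForm _ hh
    have h2 : mapForm (G.transD (n + 1)) v = (-1 : R) ^ (n + 1) • w := by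
      rw [h1, neg_one_pow_smul_smul]
    have h3 : G.cmpMap n (G.formD (n + 1) v) ∈
        LinearMap.range (trivD : Forms R G.LieAlg R →ₗ[R] _) := by
      have h := G.cmpMap_transD v
      rw [h2, map_smul, ← sub_eq_iff_eq_add] at h
      rw [← neg_one_pow_smul_smul (R := R) (n + 1) (G.cmpMap n (G.formD (n + 1) v)), ← h]
      exact Submodule.smul_mem _ _ (sub_mem (Submodule.smul_mem _ _ hc) ⟨_, rfl⟩)
    obtain ⟨u, ⟨hu, hu'⟩, he⟩ := ih (q + 1) (G.formD (n + 1) v) (chevD_mem_homogForm _ hvh)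
      (G.formD_formD v)
      (by rw [← formD_mapForm_transD, h2, map_smul, hw, smul_zero]) h3
    -- The induction provides another primitive `u` of `formD v`, with `δ u` null. As `v - u` is
    -- closed, `δ (v - u)` is null as well, and the two add up to `δ v`.
    have h4 := G.mapForm_transD_mem_nullForm (sub_mem hvh hu) (by rw [map_sub, he, sub_self])
    rw [map_sub] at h4
    have h5 := add_mem h4 hu'
    rw [sub_add_cancel] at h5
    rw [h1]
    exact Submodule.smul_mem _ _ h5

/-- Cocycles whose image is a Lie algebra coboundary are coboundaries. -/
theorem mem_coboundaries_of_phi_mem {n : ℕ} {f : G.Cochain n} (hf : G.cobarD n f = 0)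
    (h : G.phi n f ∈ coboundaries (C := fun n => G.LieAlg [⋀^Fin n]→ₗ[R] R) (ceD R G.LieAlg) n) :
    f ∈ coboundaries (C := fun n => G.Cochain n) G.cobarD n := by
  obtain ⟨g, hg, he⟩ := G.mem_nullForm n 0 (G.embed n f) (constForm_mem_homogForm _)
    (G.formD_embed f) (by rw [mapForm_transD_embed, hf, map_zero])
    (by rw [cmpMap_embed]; exact single_mem_range_trivD h)
  rwa [← G.embed_injective n he]

theorem phi_mem_coboundaries {n : ℕ} {f : G.Cochain n}
    (hf : f ∈ coboundaries (C := fun n => G.Cochain n) G.cobarD n) :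
    G.phi n f ∈ coboundaries (C := fun n => G.LieAlg [⋀^Fin n]→ₗ[R] R) (ceD R G.LieAlg) n := by
  rcases n with _ | n
  · obtain rfl : f = 0 := hf
    rw [map_zero]
    exact zero_mem _
  · obtain ⟨g, rfl⟩ := hf
    exact ⟨_, (G.ceD_phi g).symm⟩

/-- The comparison map on cocycles. -/
noncomputable def phiCocycle (n : ℕ) :
    LinearMap.ker (G.cobarD n) →ₗ[R] LinearMap.ker (ceD R G.LieAlg n) :=
  (G.phi n).restrict fun f hf => by
    rw [LinearMap.mem_ker, ← ceD_phi, LinearMap.mem_ker.mp hf, map_zero]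

theorem coboundaries_le_comap_phiCocycle (n : ℕ) :
    (coboundaries (C := fun n => G.Cochain n) G.cobarD n).submoduleOf
        (LinearMap.ker (G.cobarD n)) ≤
      ((coboundaries (C := fun n => G.LieAlg [⋀^Fin n]→ₗ[R] R) (ceD R G.LieAlg) n).submoduleOf
        (LinearMap.ker (ceD R G.LieAlg n))).comap (G.phiCocycle n) :=
  fun _ hf => G.phi_mem_coboundaries hf

/-- The comparison map on cohomology. -/
noncomputable def phiCohomology (n : ℕ) : G.ModifiedCohomology n →ₗ[R] G.LieCohomology n :=
  Submodule.mapQ _ _ (G.phiCocycle n) (G.coboundaries_le_comap_phiCocycle n)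

theorem phiCohomology_bijective (n : ℕ) : Function.Bijective (G.phiCohomology n) := by
  constructor
  · rw [injective_iff_map_eq_zero]
    intro x hx
    obtain ⟨f, rfl⟩ := Submodule.Quotient.mk_surjective _ x
    rw [phiCohomology, Submodule.mapQ_apply] at hx
    replace hx := (Submodule.Quotient.mk_eq_zero _).mp hx
    exact (Submodule.Quotient.mk_eq_zero _).mpr (G.mem_coboundaries_of_phi_mem f.2 hx)
  · intro y
    obtain ⟨ω, rfl⟩ := Submodule.Quotient.mk_surjective _ y
    obtain ⟨f, hf, h⟩ := G.exists_phi_sub_mem_coboundaries ω.2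
    exact ⟨Submodule.Quotient.mk ⟨f, hf⟩, (Submodule.Quotient.eq _).mpr h⟩

end FormalGroupLaw

end

theorem mainTheorem4 {R : Type*} [CommRing R] [IsDomain R] [CharZero R] {m : ℕ}
    (G : FormalGroupLaw R m) :
    (∀ n, G.cobarD (n + 1) ∘ₗ G.cobarD n = 0) ∧
    (∀ n, FGL.ceD R G.LieAlg (n + 1) ∘ₗ FGL.ceD R G.LieAlg n = 0) ∧
    (∀ n, G.phi (n + 1) ∘ₗ G.cobarD n = FGL.ceD R G.LieAlg n ∘ₗ G.phi n) ∧
    ∀ n, ∃ Φ : G.ModifiedCohomology n ≃ₗ[R] G.LieCohomology n,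
      ∀ f : LinearMap.ker (G.cobarD n),
        ∃ h : G.phi n f ∈ LinearMap.ker (FGL.ceD R G.LieAlg n),
          Φ (Submodule.Quotient.mk f) = Submodule.Quotient.mk ⟨G.phi n f, h⟩ := by
  refine ⟨fun n => LinearMap.ext fun f => G.cobarD_cobarD f,
    fun n => LinearMap.ext fun ω => FGL.ceD_ceD n ω,
    fun n => LinearMap.ext fun f => G.ceD_phi f, fun n => ?_⟩
  exact ⟨LinearEquiv.ofBijective _ (G.phiCohomology_bijective n),
    fun f => ⟨(G.phiCocycle n f).2, rfl⟩⟩
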